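/- **Setting.** Let $A>0$ and let $q_0:\mathbb R\to\mathbb C$ be step-like initial data: $q_0\to 0$ on the left and $q_0\to A$ on the right in the sense that $\int_{\mathbb R}(1+|x|)\,|q_0(x)-A\mathbf 1_{x>0}|\,dx<\infty$. Consider the $x$-part, at $t=0$, of the Lax pair of the nonlocal Lakshmanan–Porsezian–Daniel equation, $$\phi_x=\begin{pmatrix}-i\xi & q_0(x)\\ -\overline{q_0(-x)} & i\xi\end{pmatrix}\phi ,$$ and its Jost solutions $\phi_\pm(x,\xi)$, whose columns $\phi_\pm^{(j)}$ are determined by $\phi_\pm(x,\xi)e^{i\xi\sigma_3x}\to L_\pm(\xi)$ as $x\to\pm\infty$ (column by column), where $$L_+(\xi)=\begin{pmatrix}1&\frac{A}{2i\xi}\\0&1\end{pmatrix},\qquad L_-(\xi)=\begin{pmatrix}1&0\\ \frac{A}{2i\xi}&1\end{pmatrix},\qquad \sigma_3=\begin{pmatrix}1&0\\0&-1\end{pmatrix}.$$ The scattering coefficients are the Wronskians (determinants) at $x=0$ $$a_1=\det(\phi_-^{(1)},\phi_+^{(2)})\ (\operatorname{Im}\xi\ge0,\ \xi\ne0),\quad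 a_2=\det(\phi_+^{(1)},\phi_-^{(2)})\ (\operatorname{Im}\xi\le0),\quad b=\det(\phi_+^{(1)},\phi_-^{(1)})\ (\xi\in\mathbb R\setminus\{0\}).$$ Suppose that in $\{\operatorname{Im}\xi\ge 0\}\setminus\{0\}$ the function $a_1$ has exactly one zero, that it is simple, and that it is $i\xi_1$ with $\xi_1>0$. Below, $\ln g$ is the branch of the logarithm that is continuous on $\mathbb R$ (with $g$ extended to $\vartheta=0$ by continuity) and tends to $0$ at $\pm\infty$, and $\mathrm{v.p.}\!\int_{-\infty}^{\infty}=\lim_{\varepsilon\to0^+,\,R\to\infty}\int_{\varepsilon<|\vartheta|<R}$. **Proposition.** (i) *Case 1.* Suppose that $a_2$ has no zero in $\{\operatorname{Im}\xi\le 0\}$. Then the logarithm and the principal value below exist, and $$\xi_1=\frac A2\exp\left\{-\frac1{2\pi i}\,\mathrm{v.p.}\!\int_{-\infty}^{\infty}\frac{\ln\left[\frac{\vartheta^2}{\vartheta^2+1}\bigl(1-b(\vartheta)\overline{b(-\vartheta)}\bigr)\right]}{\vartheta}\,d\vartheta\right\}.$$ (ii) *Case 2.* Suppose that $\xi=0$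 is the only zero of $a_2$ in $\{\operatorname{Im}\xi\le0\}$, that $a_2$ has a derivative $\dot a_2(0)\neq0$ at $0$ (within $\{\operatorname{Im}\xi\le0\}$), and that $\lim_{\xi\to0}\xi a_1(\xi)$ (within $\{\operatorname{Im}\xi\ge0\}\setminus\{0\}$) exists and is nonzero. Then $b(0):=\lim_{\xi\to0}b(\xi)$ exists, $|b(0)|<1$, the logarithm and the principal value below exist, and $$\xi_1=A\,\frac{\sqrt{(\operatorname{Re}b(0))^2+F_2^2}-\operatorname{Re}b(0)}{2F_1F_2},$$ where the real numbers $F_1,F_2$ are $$F_1=\exp\left\{\frac1{2\pi i}\,\mathrm{v.p.}\!\int_{-\infty}^{\infty}\frac{\ln\bigl(1-b(\vartheta)\overline{b(-\vartheta)}\bigr)}{\vartheta}\,d\vartheta\right\},\qquad F_2=\exp\left\{\tfrac12\ln\bigl(1-|b(0)|^2\bigr)\right\}.$$ -/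

import Mathlib

open Filter Topology MeasureTheory

namespace NonlocalLPD

/-- The pure step with the value `0` on the left and `A` on the right. -/
noncomputable def step (A : ℝ) (x : ℝ) : ℂ := if 0 < x then (A : ℂ) else 0

/-- Step-like initial data: `q₀` approaches `0` on the left and `A` on the right, and its
deviation from the pure step has a finite first moment,
`∫ (1 + |x|) |q₀(x) - step A x| dx < ∞`. -/
def IsStepLike (A : ℝ) (q₀ : ℝ → ℂ) : Prop :=
  Integrable (fun x : ℝ => ((1 + |x| : ℝ) : ℂ) * (q₀ x - step A x))

/-- The coefficient `M = -iξσ₃ + Q` at time `0` of the `x`-part `φ_x = M φ` of the Lax pair, with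
`Q = [[0, q₀(x)], [-conj q₀(-x), 0]]`. -/
noncomputable def laxM (q₀ : ℝ → ℂ) (ξ : ℂ) (x : ℝ) : Matrix (Fin 2) (Fin 2) ℂ :=
  !![-(Complex.I * ξ), q₀ x; -(starRingEnd ℂ) (q₀ (-x)), Complex.I * ξ]

/-- Vector solutions of `φ_x = M φ` on the line, in integrated form (the data need not be
continuous). -/
def IsLaxSolution (q₀ : ℝ → ℂ) (ξ : ℂ) (φ : ℝ → Fin 2 → ℂ) : Prop :=
  Continuous φ ∧ ∀ x y : ℝ, φ y - φ x = ∫ s in x..y, (laxM q₀ ξ s).mulVec (φ s)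

/-- `L₋`, which diagonalizes the limit of `M` at `-∞`. -/
noncomputable def Lminus (A : ℝ) (ξ : ℂ) : Matrix (Fin 2) (Fin 2) ℂ :=
  !![1, 0; (A : ℂ) / (2 * Complex.I * ξ), 1]

/-- `L₊`, which diagonalizes the limit of `M` at `+∞`. -/
noncomputable def Lplus (A : ℝ) (ξ : ℂ) : Matrix (Fin 2) (Fin 2) ℂ :=
  !![1, (A : ℂ) / (2 * Complex.I * ξ); 0, 1]

/-- The diagonal entries of `σ₃`. -/
def sigma3 (j : Fin 2) : ℂ := if j = 0 then 1 else -1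

/-- `φ` is the `j`-th column of the Jost solution normalized at the end `l` (`atBot` or `atTop`)
by the matrix `L`: it solves `φ_x = M φ`, and `φ e^{iξσ₃x}` (that is, `ψ`) tends to column `j`
of `L`. -/
def IsJostColumn (q₀ : ℝ → ℂ) (ξ : ℂ) (l : Filter ℝ) (L : Matrix (Fin 2) (Fin 2) ℂ) (j : Fin 2)
    (φ : ℝ → Fin 2 → ℂ) : Prop :=
  IsLaxSolution q₀ ξ φ ∧
    Tendsto (fun x : ℝ => Complex.exp (sigma3 j * Complex.I * ξ * x) • φ x) l
      (𝓝 (fun i => L i j))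

/-- Column `j` of the Jost solution `φ₋` at time `0`. For step-like data it exists and is unique
for `j = 0` if `Im ξ ≥ 0`, `ξ ≠ 0`, and for `j = 1` if `Im ξ ≤ 0`. -/
noncomputable def phiMinus (A : ℝ) (q₀ : ℝ → ℂ) (ξ : ℂ) (j : Fin 2) : ℝ → Fin 2 → ℂ :=
  Classical.epsilon (IsJostColumn q₀ ξ atBot (Lminus A ξ) j)

/-- Column `j` of the Jost solution `φ₊` at time `0`. For step-like data it exists and is unique
for `j = 0` if `Im ξ ≤ 0`, and for `j = 1` if `Im ξ ≥ 0`, `ξ ≠ 0`. -/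
noncomputable def phiPlus (A : ℝ) (q₀ : ℝ → ℂ) (ξ : ℂ) (j : Fin 2) : ℝ → Fin 2 → ℂ :=
  Classical.epsilon (IsJostColumn q₀ ξ atTop (Lplus A ξ) j)

/-- The Wronskian of two columns. -/
def wr (u v : Fin 2 → ℂ) : ℂ := u 0 * v 1 - u 1 * v 0

/-- `a₁(ξ)`, meaningful for `Im ξ ≥ 0`, `ξ ≠ 0`. -/
noncomputable def a₁ (A : ℝ) (q₀ : ℝ → ℂ) (ξ : ℂ) : ℂ :=
  wr (phiMinus A q₀ ξ 0 0) (phiPlus A q₀ ξ 1 0)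

/-- `a₂(ξ)`, meaningful for `Im ξ ≤ 0`. -/
noncomputable def a₂ (A : ℝ) (q₀ : ℝ → ℂ) (ξ : ℂ) : ℂ :=
  wr (phiPlus A q₀ ξ 0 0) (phiMinus A q₀ ξ 1 0)

/-- `b(ξ)`, meaningful for real `ξ ≠ 0`. -/
noncomputable def b (A : ℝ) (q₀ : ℝ → ℂ) (ξ : ℝ) : ℂ :=
  wr (phiPlus A q₀ (ξ : ℂ) 0 0) (phiMinus A q₀ (ξ : ℂ) 0 0)

/-- `iξ₁` is a zero of `a₁` in the closed upper half-plane without `0`, it is simple, and there is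
no other zero. -/
def HasSingleSimpleZero (A : ℝ) (q₀ : ℝ → ℂ) (ξ₁ : ℝ) : Prop :=
  0 < ξ₁ ∧ (∀ ξ : ℂ, 0 ≤ ξ.im → ξ ≠ 0 → (a₁ A q₀ ξ = 0 ↔ ξ = Complex.I * ξ₁)) ∧
    deriv (a₁ A q₀) (Complex.I * ξ₁) ≠ 0

/-- First case: `a₂` has no zero in the closed lower half-plane. -/
def Case1 (A : ℝ) (q₀ : ℝ → ℂ) (ξ₁ : ℝ) : Prop :=
  HasSingleSimpleZero A q₀ ξ₁ ∧ ∀ ξ : ℂ, ξ.im ≤ 0 → a₂ A q₀ ξ ≠ 0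

/-- Second case: `0` is the only zero of `a₂` in the closed lower half-plane, the derivative of
`a₂` at `0` (in the closed lower half-plane) is not zero, and the limit of `ξ a₁(ξ)` at `0` (in
the closed upper half-plane) exists and is not zero. -/
def Case2 (A : ℝ) (q₀ : ℝ → ℂ) (ξ₁ : ℝ) : Prop :=
  HasSingleSimpleZero A q₀ ξ₁ ∧
    (∀ ξ : ℂ, ξ.im ≤ 0 → (a₂ A q₀ ξ = 0 ↔ ξ = 0)) ∧
    (∃ d : ℂ, d ≠ 0 ∧ HasDerivWithinAt (a₂ A q₀) d {ξ : ℂ | ξ.im ≤ 0} 0) ∧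
    (∃ a₁₁ : ℂ, a₁₁ ≠ 0 ∧
      Tendsto (fun ξ : ℂ => ξ * a₁ A q₀ ξ) (𝓝[{ξ : ℂ | 0 ≤ ξ.im ∧ ξ ≠ 0}] 0) (𝓝 a₁₁))

/-- `l` is the branch of `ln g` that is continuous on the line and vanishes at `±∞`, where `g` is
given off `0` and extended to `0` by continuity. There is at most one such `l`. -/
def IsLogBranch (g l : ℝ → ℂ) : Prop :=
  Continuous l ∧ (∀ x : ℝ, x ≠ 0 → Complex.exp (l x) = g x) ∧
    Tendsto l atBot (𝓝 0) ∧ Tendsto l atTop (𝓝 0)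

/-- The principal value `v.p. ∫ f(x) dx` over the line, with respect to the point `0` and to
infinity, exists and equals `c`. -/
def HasPrincipalValue (f : ℝ → ℂ) (c : ℂ) : Prop :=
  Tendsto (fun p : ℝ × ℝ => ∫ x in {x : ℝ | p.1 < |x| ∧ |x| < p.2}, f x)
    ((𝓝[>] 0) ×ˢ atTop) (𝓝 c)

end NonlocalLPD

/-!
The value of `ξ₁` is read off from a scalar factorization problem on the line. The determinant of
the scattering matrix gives `1 - b(x) conj b(-x) = a₁(x) a₂(x)` (`one_sub_b_mul`), and `a₁`, `a₂`
are holomorphic in the upper and lower half-plane. Multiply them by rational functions whose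
product is `1` (or `ξ² / (ξ² + 1)` in the first case) so as to cancel the zero `i ξ₁`, the pole of
`a₁` at `0` and the zero of `a₂` there, if any. This leaves factors `f₁(ξ)` and `f₂(-ξ)` that are
continuous and without zeros in the closed half-planes and tend to `1` at infinity. Such a factor
has a logarithm `L` (`UpperFactor.exists_log`), and Cauchy's theorem for `L(z) dz / z` in a
half-annulus gives `v.p. ∫ L(x) dx / x = i π L(0)`: the principal value sees half of the residue
(`hasPrincipalValue_upper`). The symmetry `conj f(-conj ξ) = f(ξ)` makes `L(0)` real, so that the
principal value determines the quotient of `f₁(0)` and `f₂(0)` (`exists_logBranch`); in the second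
case their product is known as well, as the limit of `1 - b(x) conj b(-x)` at `0`. Since `ξ₁` enters
these values explicitly, what remains is to know the behaviour of `a₁`, `a₂` and `b` at `0`.

The analytic input comes from the Jost solutions. At `-∞` the coefficient matrix tends to
`[[-iξ, 0], [-A, iξ]]`, and variation of constants yields a Volterra equation on `(-∞, x]` whose
kernel involves `∫₀ᵗ e^{2iητ} dτ = O(t)`; the first moment in the hypothesis makes it integrable
uniformly up to `η = 0`. After multiplication of the first column by `η / (η + i)` nothing is
singular at `η = 0`. The Picard series (`IsVolterra`) gives continuity in the closed half-plane and
holomorphy inside, and a Riemann–Lebesgue lemma in the half-plane (`norm_integral_exp_mul_le`)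
gives the limits at infinity. The Jost solutions at `+∞` are the images of those at `-∞` under
`φ(x, ξ) ↦ conj φ(-x, -conj ξ)` with swapped components (`phiPlus_eq`). So `a₁` and `a₂` are
quadratic expressions `scat` in the solutions at `-∞` alone.

At `η = 0` the regularized first column is `-A / 2` times the second one (`jostF_zero_zero`). In the
first case this relates the leading coefficient of `a₁` to `a₂(0)`, which then cancels from the
quotient `f₂(0) / f₁(0) = 4 ξ₁² / A²`. In the second case it yields the limit of `b` and a linear
relation between `lim ξ a₁(ξ)`, `ȧ₂(0)` and `Re b(0)` (`exists_tendsto_b`); with the values of the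
two factors at `0` this is a quadratic equation for `ξ₁` (`eq_of_quadratic`).
-/

namespace NonlocalLPD

/-! ### Primitives of locally integrable functions -/

/-- `G` is a primitive of the locally integrable function `g`. -/
def IsPrim (G g : ℝ → ℂ) : Prop :=
  (∀ x y : ℝ, IntervalIntegrable g volume x y) ∧ ∀ x y : ℝ, G y - G x = ∫ s in x..y, g s

namespace IsPrim

variable {G g H h : ℝ → ℂ}

theorem continuous (hG : IsPrim G g) : Continuous G := by
  have h1 : G = fun y => G 0 + ∫ s in (0 : ℝ)..y, g s := by
    funext y
    rw [← hG.2 0 y]; ring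
  rw [h1]
  exact continuous_const.add (intervalIntegral.continuous_primitive hG.1 0)

theorem add (hG : IsPrim G g) (hH : IsPrim H h) :
    IsPrim (fun x => G x + H x) (fun x => g x + h x) := by
  refine ⟨fun x y => (hG.1 x y).add (hH.1 x y), fun x y => ?_⟩
  rw [intervalIntegral.integral_add (hG.1 x y) (hH.1 x y), ← hG.2, ← hH.2]
  ring

theorem sub (hG : IsPrim G g) (hH : IsPrim H h) :
    IsPrim (fun x => G x - H x) (fun x => g x - h x) := by
  refine ⟨fun x y => (hG.1 x y).sub (hH.1 x y), fun x y => ?_⟩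
  rw [intervalIntegral.integral_sub (hG.1 x y) (hH.1 x y), ← hG.2, ← hH.2]
  ring

theorem const_mul (c : ℂ) (hG : IsPrim G g) :
    IsPrim (fun x => c * G x) (fun x => c * g x) := by
  refine ⟨fun x y => (hG.1 x y).const_mul c, fun x y => ?_⟩
  rw [intervalIntegral.integral_const_mul, ← hG.2]
  ring

theorem const (c : ℂ) : IsPrim (fun _ => c) (fun _ => 0) :=
  ⟨fun _ _ => intervalIntegrable_const, fun x y => by simp⟩

theorem of_hasDerivAt (hG : ∀ x, HasDerivAt G (g x) x) (hg : Continuous g) : IsPrim G g :=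
  ⟨fun x y => hg.intervalIntegrable x y, fun x y =>
    (intervalIntegral.integral_eq_sub_of_hasDerivAt (fun z _ => hG z)
      (hg.intervalIntegrable x y)).symm⟩

theorem congr_right (hG : IsPrim G g) (hgh : ∀ x, g x = h x) : IsPrim G h := by
  rwa [← funext hgh]

theorem absolutelyContinuousOnInterval (hG : IsPrim G g) (x y : ℝ) :
    AbsolutelyContinuousOnInterval G x y := by
  have hre : IntervalIntegrable (fun s => (g s).re) volume x y :=
    ⟨(hG.1 x y).1.re, (hG.1 x y).2.re⟩
  have him : IntervalIntegrable (fun s => (g s).im) volume x y :=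
    ⟨(hG.1 x y).1.im, (hG.1 x y).2.im⟩
  have hc (c : ℂ) : AbsolutelyContinuousOnInterval (fun _ : ℝ => c) x y :=
    ((LipschitzWith.const c).lipschitzOnWith (s := Set.uIcc x y)).absolutelyContinuousOnInterval
  have h1 := ((hre.absolutelyContinuousOnInterval_intervalIntegral
    (c := x) Set.left_mem_uIcc).smul (hc 1)).add ((him.absolutelyContinuousOnInterval_intervalIntegral
    (c := x) Set.left_mem_uIcc).smul (hc Complex.I))
  have h2 := (hc (G x)).add h1
  have e : G = (fun _ => G x) + ((fun z => ∫ s in x..z, (g s).re) • (fun _ => (1 : ℂ)) +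
      (fun z => ∫ s in x..z, (g s).im) • (fun _ => Complex.I)) := by
    funext z
    have h3 := hG.2 x z
    have e1 : (∫ s in x..z, (g s).re) = (∫ s in x..z, g s).re :=
      Complex.reCLM.intervalIntegral_comp_comm (hG.1 x z)
    have e2 : (∫ s in x..z, (g s).im) = (∫ s in x..z, g s).im :=
      Complex.imCLM.intervalIntegral_comp_comm (hG.1 x z)
    simp only [Pi.add_apply, Pi.smul_apply', e1, e2, ← h3, Complex.real_smul, mul_one,
      Complex.re_add_im]
    ring
  rw [e]
  exact h2

theorem ae_hasDerivAt (hG : IsPrim G g) : ∀ᵐ x, HasDerivAt G (g x) x := by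
  have hl : LocallyIntegrable g volume := by
    refine (locallyIntegrable_iff).2 fun K hK => ?_
    obtain ⟨a, b, hab⟩ : ∃ a b, K ⊆ Set.Icc a b := by
      obtain ⟨a, ha⟩ := hK.bddBelow
      obtain ⟨b, hb⟩ := hK.bddAbove
      exact ⟨a, b, fun z hz => ⟨ha hz, hb hz⟩⟩
    by_cases h : a ≤ b
    · exact ((intervalIntegrable_iff_integrableOn_Icc_of_le h).1 (hG.1 a b)).mono_set hab
    · rw [Set.Icc_eq_empty h] at hab
      exact integrableOn_empty.mono_set hab
  filter_upwards [LocallyIntegrable.ae_hasDerivAt_integral hl] with x hx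
  have h2 := (hx 0).const_add (G 0)
  refine h2.congr_of_eventuallyEq (Eventually.of_forall fun z => ?_)
  change G z = G 0 + ∫ t in (0 : ℝ)..z, g t
  rw [← hG.2 0 z]; ring

/-- The product rule for primitives, by absolute continuity. -/
theorem mul (hG : IsPrim G g) (hH : IsPrim H h) :
    IsPrim (fun x => G x * H x) (fun x => g x * H x + G x * h x) := by
  have hint (x y : ℝ) : IntervalIntegrable (fun x => g x * H x + G x * h x) volume x y :=
    ((hG.1 x y).mul_continuousOn hH.continuous.continuousOn).add
      ((hH.1 x y).continuousOn_mul hG.continuous.continuousOn)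
  refine ⟨hint, fun x y => ?_⟩
  have hP : IsPrim (fun z => ∫ s in x..z, (g s * H s + G s * h s))
      (fun x => g x * H x + G x * h x) :=
    ⟨hint, fun a b => intervalIntegral.integral_interval_sub_left (hint x b) (hint x a)⟩
  have hac := ((hG.absolutelyContinuousOnInterval x y).smul
    (hH.absolutelyContinuousOnInterval x y)).sub (hP.absolutelyContinuousOnInterval x y)
  obtain ⟨C, hC⟩ := hac.const_of_ae_hasDerivAt_zero (by
    filter_upwards [hG.ae_hasDerivAt, hH.ae_hasDerivAt, hP.ae_hasDerivAt] with z h1 h2 h3 _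
    have h4 := (h1.mul h2).sub h3
    rw [sub_self] at h4
    exact h4)
  have e1 := hC x Set.left_mem_uIcc
  have e2 := hC y Set.right_mem_uIcc
  simp only [Pi.sub_apply, smul_eq_mul, intervalIntegral.integral_same,
    sub_zero, Pi.mul_apply] at e1 e2
  linear_combination e2 - e1

theorem pow (hG : IsPrim G g) (n : ℕ) :
    IsPrim (fun x => G x ^ (n + 1)) (fun x => (n + 1) * (G x ^ n * g x)) := by
  induction n with
  | zero => simpa using hG
  | succ n ih =>
    have h1 := (ih.mul hG).congr_right (h := fun x => ((n + 1 : ℕ) + 1) * (G x ^ (n + 1) * g x))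
      (fun x => by push_cast; ring)
    simpa only [pow_succ] using h1

/-- A primitive with zero derivative is constant. -/
theorem eq_of_zero (hG : IsPrim G g) (h0 : ∀ x, g x = 0) (x y : ℝ) : G x = G y := by
  have h1 := hG.2 x y
  simp only [h0, intervalIntegral.integral_zero] at h1
  exact (sub_eq_zero.1 h1).symm

/-- A function that is integrable on every half-line `(-∞, x]` has the primitive
`x ↦ ∫_{-∞}^x g`. -/
theorem integral_Iic (hg : ∀ x, IntegrableOn g (Set.Iic x)) :
    IsPrim (fun x => ∫ s in Set.Iic x, g s) g := by
  refine ⟨fun x y => ?_, fun x y => intervalIntegral.integral_Iic_sub_Iic (hg x) (hg y)⟩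
  rw [intervalIntegrable_iff]
  exact (hg (max x y)).mono_set fun z hz => hz.2

end IsPrim

/-! ### Parametric integrals -/

/-- An integral that depends on a parameter through a holomorphic, uniformly dominated integrand
is holomorphic; Cauchy's estimate dominates the derivative of the integrand. -/
theorem differentiableOn_integral_of_dominated {α E : Type*} [MeasurableSpace α] {μ : Measure α}
    [NormedAddCommGroup E] [NormedSpace ℂ E] [CompleteSpace E] {U : Set ℂ} (hU : IsOpen U)
    {F : ℂ → α → E} {bound : α → ℝ} (hmeas : ∀ ξ ∈ U, AEStronglyMeasurable (F ξ) μ)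
    (hint : Integrable bound μ) (hbound : ∀ᵐ a ∂μ, ∀ ξ ∈ U, ‖F ξ a‖ ≤ bound a)
    (hdiff : ∀ᵐ a ∂μ, DifferentiableOn ℂ (fun ξ => F ξ a) U) :
    DifferentiableOn ℂ (fun ξ => ∫ a, F ξ a ∂μ) U := by
  intro ξ₀ h₀
  obtain ⟨r, hr, hball⟩ := Metric.isOpen_iff.1 hU ξ₀ h₀
  have hsub : ∀ ξ ∈ Metric.ball ξ₀ (r / 2), Metric.closedBall ξ (r / 3) ⊆ U := by
    intro ξ hξ z hz
    refine hball ?_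
    rw [Metric.mem_ball] at hξ ⊢
    rw [Metric.mem_closedBall] at hz
    linarith [dist_triangle z ξ ξ₀]
  have hmem : ∀ ξ ∈ Metric.ball ξ₀ (r / 2), ξ ∈ U := fun ξ hξ =>
    hsub ξ hξ (Metric.mem_closedBall_self (by positivity))
  have hd : ∀ᵐ a ∂μ, ∀ ξ ∈ Metric.ball ξ₀ (r / 2),
      HasDerivAt (fun ξ => F ξ a) (deriv (fun ξ => F ξ a) ξ) ξ := by
    filter_upwards [hdiff] with a ha ξ hξ
    exact (ha.differentiableAt (hU.mem_nhds (hmem ξ hξ))).hasDerivAt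
  have hmeas' : AEStronglyMeasurable (fun a => deriv (fun ξ => F ξ a) ξ₀) μ := by
    have hseq : Tendsto (fun n : ℕ => ξ₀ + ((r / 3 / ((n : ℝ) + 1) : ℝ) : ℂ)) atTop (𝓝[≠] ξ₀) := by
      refine tendsto_nhdsWithin_iff.2 ⟨?_, Eventually.of_forall fun n => ?_⟩
      · have h1 : Tendsto (fun n : ℕ => r / 3 * (1 / ((n : ℝ) + 1))) atTop (𝓝 (r / 3 * 0)) :=
          tendsto_one_div_add_atTop_nhds_zero_nat.const_mul _
        have h2 := (Complex.continuous_ofReal.tendsto _).comp h1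
        simpa [Function.comp_def, div_eq_mul_inv] using h2.const_add ξ₀
      · have : (0 : ℝ) < r / 3 / ((n : ℝ) + 1) := by positivity
        rw [Set.mem_compl_singleton_iff, Ne, add_eq_left, Complex.ofReal_eq_zero]
        exact this.ne'
    refine aestronglyMeasurable_of_tendsto_ae (u := atTop)
      (f := fun (n : ℕ) a => slope (fun ξ => F ξ a) ξ₀ (ξ₀ + ((r / 3 / ((n : ℝ) + 1) : ℝ) : ℂ)))
      ?_ ?_
    · intro n
      refine AEStronglyMeasurable.const_smul ((hmeas _ ?_).sub (hmeas _ h₀)) _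
      refine hsub ξ₀ (Metric.mem_ball_self (by positivity)) ?_
      have h1 : (0 : ℝ) < r / 3 / ((n : ℝ) + 1) := by positivity
      rw [Metric.mem_closedBall, dist_eq_norm, add_sub_cancel_left, Complex.norm_real,
        Real.norm_of_nonneg h1.le]
      exact div_le_self (by positivity) (by simp)
    · filter_upwards [hd] with a ha
      exact (hasDerivAt_iff_tendsto_slope.1 (ha ξ₀ (Metric.mem_ball_self (by positivity)))).comp hseq
  refine (hasDerivAt_integral_of_dominated_loc_of_deriv_le
    (F' := fun ξ a => deriv (fun ξ => F ξ a) ξ) (bound := fun a => bound a / (r / 3))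
    (Metric.ball_mem_nhds ξ₀ (by positivity : 0 < r / 2))
    ?_ ?_ hmeas' ?_ (hint.div_const _) hd).2.differentiableAt.differentiableWithinAt
  · filter_upwards [hU.mem_nhds h₀] with ξ hξ using hmeas ξ hξ
  · exact hint.mono' (hmeas ξ₀ h₀) (hbound.mono fun a ha => ha ξ₀ h₀)
  · filter_upwards [hdiff, hbound] with a ha hb ξ hξ
    refine Complex.norm_deriv_le_of_forall_mem_sphere_norm_le (by positivity) ?_ fun z hz =>
      hb z (hsub ξ hξ (Metric.sphere_subset_closedBall hz))
    refine DifferentiableOn.diffContOnCl (ha.mono ?_)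
    rw [closure_ball _ (by positivity : r / 3 ≠ 0)]
    exact hsub ξ hξ

/-- If `ρ` has mass `P x` on `(-∞, x]`, then `∫_{-∞}^x ρ Pⁿ = P x ^ (n + 1) / (n + 1)`. -/
theorem integral_Iic_mul_pow {ρ : ℝ → ℝ} (hρ : ∀ x, IntegrableOn ρ (Set.Iic x)) (n : ℕ) (x : ℝ) :
    IntegrableOn (fun s => ρ s * (∫ t in Set.Iic s, ρ t) ^ n) (Set.Iic x) ∧
    ∫ s in Set.Iic x, ρ s * (∫ t in Set.Iic s, ρ t) ^ n =
      (∫ t in Set.Iic x, ρ t) ^ (n + 1) / (n + 1) := by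
  have hprim : IsPrim (fun x => ((∫ t in Set.Iic x, ρ t : ℝ) : ℂ)) (fun s => (ρ s : ℂ)) := by
    have := IsPrim.integral_Iic (g := fun s => (ρ s : ℂ)) fun x => (hρ x).ofReal
    simpa only [integral_complex_ofReal] using this
  have hcont : Continuous fun x => ∫ t in Set.Iic x, ρ t := by
    simpa using! Complex.continuous_re.comp hprim.continuous
  have hbot : Tendsto (fun x => ∫ t in Set.Iic x, ρ t) atBot (𝓝 0) := by
    have h1 := intervalIntegral_tendsto_integral_Iic 0 (hρ 0) tendsto_id
    have h2 := (tendsto_const_nhds (x := ∫ t in Set.Iic (0 : ℝ), ρ t)).sub h1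
    rw [sub_self] at h2
    refine h2.congr fun a => ?_
    rw [id, ← intervalIntegral.integral_Iic_sub_Iic (hρ a) (hρ 0)]; ring
  have hbdd : ∃ C, ∀ s ≤ x, ‖(∫ t in Set.Iic s, ρ t) ^ n‖ ≤ C := by
    obtain ⟨a, ha⟩ := (eventually_atBot.1 (hbot.norm.eventually_le_const
      (by simp : ‖(0 : ℝ)‖ < 1)))
    obtain ⟨C, hC⟩ := (isCompact_Icc (a := a) (b := x)).exists_bound_of_continuousOn
      hcont.continuousOn
    refine ⟨(max 1 C) ^ n, fun s hs => ?_⟩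
    rw [norm_pow]
    refine pow_le_pow_left₀ (norm_nonneg _) ?_ n
    rcases le_total s a with h | h
    · exact (ha s h).trans (le_max_left _ _)
    · exact (hC s ⟨h, hs⟩).trans (le_max_right _ _)
  obtain ⟨C, hC⟩ := hbdd
  have hI : IntegrableOn (fun s => ρ s * (∫ t in Set.Iic s, ρ t) ^ n) (Set.Iic x) := by
    refine Integrable.mul_bdd (hρ x) (hcont.pow n).aestronglyMeasurable (c := C) ?_
    filter_upwards [ae_restrict_mem measurableSet_Iic] with s hs using hC s hs
  refine ⟨hI, ?_⟩
  have h1 := intervalIntegral_tendsto_integral_Iic x hI tendsto_id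
  have h2 : Tendsto (fun a : ℝ => ((∫ t in Set.Iic x, ρ t) ^ (n + 1) -
      (∫ t in Set.Iic a, ρ t) ^ (n + 1)) / (n + 1)) atBot
      (𝓝 (((∫ t in Set.Iic x, ρ t) ^ (n + 1) - 0 ^ (n + 1)) / (n + 1))) :=
    ((tendsto_const_nhds).sub (hbot.pow _)).div_const _
  rw [zero_pow (Nat.succ_ne_zero n), sub_zero] at h2
  refine tendsto_nhds_unique h1 (h2.congr fun a => ?_)
  have h3 := (hprim.pow n).2 a x
  rw [intervalIntegral.integral_const_mul] at h3
  have hne : ((n : ℝ) + 1) ≠ 0 := by positivity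
  rw [div_eq_iff hne]
  have h4 : (∫ s in a..x, ((∫ t in Set.Iic s, ρ t : ℝ) : ℂ) ^ n * (ρ s : ℂ)) =
      ((∫ s in a..x, ρ s * (∫ t in Set.Iic s, ρ t) ^ n : ℝ) : ℂ) := by
    rw [← intervalIntegral.integral_ofReal]
    congr 1
    funext s
    push_cast; ring
  rw [h4] at h3
  have h5 : (((∫ t in Set.Iic x, ρ t) ^ (n + 1) - (∫ t in Set.Iic a, ρ t) ^ (n + 1) : ℝ) : ℂ) =
      (((∫ s in a..x, ρ s * (∫ t in Set.Iic s, ρ t) ^ n) * (n + 1) : ℝ) : ℂ) := by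
    push_cast
    linear_combination h3
  exact_mod_cast h5

/-! ### Volterra equations on a half-line -/

section Volterra

open scoped Matrix

/-- The Picard iterates of the Volterra equation
`F ξ x = f₀ ξ + ∫_{-∞}^x k ξ x s F ξ s ds`. -/
noncomputable def picard (k : ℂ → ℝ → ℝ → Matrix (Fin 2) (Fin 2) ℂ) (f₀ : ℂ → Fin 2 → ℂ) :
    ℕ → ℂ → ℝ → Fin 2 → ℂ
  | 0 => fun ξ _ => f₀ ξ
  | n + 1 => fun ξ x => ∫ s in Set.Iic x, k ξ x s *ᵥ picard k f₀ n ξ s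

/-- The sum of the Picard iterates. -/
noncomputable def volterraSol (k : ℂ → ℝ → ℝ → Matrix (Fin 2) (Fin 2) ℂ) (f₀ : ℂ → Fin 2 → ℂ)
    (ξ : ℂ) (x : ℝ) : Fin 2 → ℂ :=
  ∑' n, picard k f₀ n ξ x

/-- The kernel `k` and the free term `f₀` are continuous in the parameter `ξ ∈ U`, the free term is
bounded by `C`, and the kernel on `s ≤ x ≤ X` is dominated by a function `ρ` of `s` with finite
mass on every half-line `(-∞, x]`. -/
structure IsVolterra (k : ℂ → ℝ → ℝ → Matrix (Fin 2) (Fin 2) ℂ) (f₀ : ℂ → Fin 2 → ℂ)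
    (U : Set ℂ) (X : ℝ) (ρ : ℝ → ℝ) (C : ℝ) : Prop where
  ρ_nonneg : ∀ s, 0 ≤ ρ s
  ρ_int : ∀ x, IntegrableOn ρ (Set.Iic x)
  C_nonneg : 0 ≤ C
  f₀_le : ∀ ξ ∈ U, ‖f₀ ξ‖ ≤ C
  f₀_cont : ContinuousOn f₀ U
  k_meas : ∀ ξ ∈ U, ∀ x ≤ X, AEStronglyMeasurable (k ξ x) (volume.restrict (Set.Iic x))
  k_le : ∀ ξ ∈ U, ∀ x ≤ X, ∀ s ≤ x, ∀ v, ‖k ξ x s *ᵥ v‖ ≤ ρ s * ‖v‖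
  k_cont : ∀ s, ContinuousOn (fun p : ℂ × ℝ => k p.1 p.2 s) (U ×ˢ Set.Icc s X)

namespace IsVolterra

variable {k : ℂ → ℝ → ℝ → Matrix (Fin 2) (Fin 2) ℂ} {f₀ : ℂ → Fin 2 → ℂ} {U : Set ℂ} {X : ℝ}
  {ρ : ℝ → ℝ} {C : ℝ}

theorem mass_nonneg (h : IsVolterra k f₀ U X ρ C) (x : ℝ) : 0 ≤ ∫ t in Set.Iic x, ρ t :=
  setIntegral_nonneg measurableSet_Iic fun s _ => h.ρ_nonneg s

theorem mass_mono (h : IsVolterra k f₀ U X ρ C) {x y : ℝ} (hxy : x ≤ y) :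
    ∫ t in Set.Iic x, ρ t ≤ ∫ t in Set.Iic y, ρ t :=
  setIntegral_mono_set (h.ρ_int y) (Eventually.of_forall h.ρ_nonneg)
    (Set.Iic_subset_Iic.2 hxy).eventuallyLE

theorem meas_mulVec (h : IsVolterra k f₀ U X ρ C) {G : ℂ → ℝ → Fin 2 → ℂ}
    (hG : ContinuousOn (fun p : ℂ × ℝ => G p.1 p.2) (U ×ˢ Set.Iic X)) {ξ : ℂ} (hξ : ξ ∈ U) {x : ℝ}
    (hx : x ≤ X) :
    AEStronglyMeasurable (fun s => k ξ x s *ᵥ G ξ s) (volume.restrict (Set.Iic x)) := by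
  have h1 : AEStronglyMeasurable (G ξ) (volume.restrict (Set.Iic x)) := by
    refine ContinuousOn.aestronglyMeasurable ?_ measurableSet_Iic
    exact hG.comp (by fun_prop : Continuous fun s : ℝ => (ξ, s)).continuousOn
      fun s hs => ⟨hξ, le_trans hs hx⟩
  have h2 : Continuous fun p : Matrix (Fin 2) (Fin 2) ℂ × (Fin 2 → ℂ) => p.1 *ᵥ p.2 :=
    continuous_fst.matrix_mulVec continuous_snd
  exact h2.comp_aestronglyMeasurable ((h.k_meas ξ hξ x hx).prodMk h1)

theorem integrable_mulVec (h : IsVolterra k f₀ U X ρ C) {G : ℂ → ℝ → Fin 2 → ℂ} {B : ℝ}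
    (hG : ContinuousOn (fun p : ℂ × ℝ => G p.1 p.2) (U ×ˢ Set.Iic X))
    (hB : ∀ ξ ∈ U, ∀ x ≤ X, ‖G ξ x‖ ≤ B) {ξ : ℂ} (hξ : ξ ∈ U) {x : ℝ} (hx : x ≤ X) :
    IntegrableOn (fun s => k ξ x s *ᵥ G ξ s) (Set.Iic x) := by
  refine ((h.ρ_int x).mul_const B).mono' (h.meas_mulVec hG hξ hx) ?_
  filter_upwards [ae_restrict_mem measurableSet_Iic] with s hs
  exact (h.k_le ξ hξ x hx s hs _).trans
    (mul_le_mul_of_nonneg_left (hB ξ hξ s (le_trans hs hx)) (h.ρ_nonneg s))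

theorem continuousOn_integral (h : IsVolterra k f₀ U X ρ C) {G : ℂ → ℝ → Fin 2 → ℂ} {B : ℝ}
    (hG : ContinuousOn (fun p : ℂ × ℝ => G p.1 p.2) (U ×ˢ Set.Iic X))
    (hB : ∀ ξ ∈ U, ∀ x ≤ X, ‖G ξ x‖ ≤ B) :
    ContinuousOn (fun p : ℂ × ℝ => ∫ s in Set.Iic p.2, k p.1 p.2 s *ᵥ G p.1 s)
      (U ×ˢ Set.Iic X) := by
  rintro ⟨ξ₀, x₀⟩ ⟨hξ₀, hx₀⟩
  have hrew : (fun p : ℂ × ℝ => ∫ s in Set.Iic p.2, k p.1 p.2 s *ᵥ G p.1 s) =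
      fun p : ℂ × ℝ => ∫ s, (Set.Iic p.2).indicator (fun s => k p.1 p.2 s *ᵥ G p.1 s) s := by
    funext p
    rw [integral_indicator measurableSet_Iic]
  rw [hrew]
  refine continuousWithinAt_of_dominated
    (bound := (Set.Iic X).indicator fun s => ρ s * B) ?_ ?_ ?_ ?_
  · filter_upwards [self_mem_nhdsWithin] with p hp
    exact (aestronglyMeasurable_indicator_iff measurableSet_Iic).2 (h.meas_mulVec hG hp.1 hp.2)
  · filter_upwards [self_mem_nhdsWithin] with p hp
    refine Eventually.of_forall fun s => ?_
    by_cases hs : s ∈ Set.Iic p.2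
    · rw [Set.indicator_of_mem hs, Set.indicator_of_mem (Set.mem_Iic.2 (le_trans hs hp.2))]
      exact (h.k_le _ hp.1 _ hp.2 s hs _).trans
        (mul_le_mul_of_nonneg_left (hB _ hp.1 s (le_trans hs hp.2)) (h.ρ_nonneg s))
    · rw [Set.indicator_of_notMem hs, norm_zero]
      refine Set.indicator_nonneg (fun s _ => mul_nonneg (h.ρ_nonneg s) ?_) s
      exact (norm_nonneg _).trans (hB ξ₀ hξ₀ x₀ hx₀)
  · exact (integrable_indicator_iff measurableSet_Iic).2 ((h.ρ_int X).mul_const B)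
  · have hne : ∀ᵐ s : ℝ, s ≠ x₀ := by simp [ae_iff, measure_singleton]
    filter_upwards [hne] with s hs
    rcases lt_or_gt_of_ne hs with hs | hs
    · have hev : ∀ᶠ p : ℂ × ℝ in 𝓝[U ×ˢ Set.Iic X] (ξ₀, x₀), s < p.2 :=
        mem_nhdsWithin_of_mem_nhds ((continuous_snd.tendsto (ξ₀, x₀)).eventually_const_lt hs)
      have hnh : U ×ˢ Set.Icc s X ∈ 𝓝[U ×ˢ Set.Iic X] (ξ₀, x₀) := by
        filter_upwards [hev, self_mem_nhdsWithin] with p hp hp'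
        exact ⟨hp'.1, hp.le, hp'.2⟩
      have hk : ContinuousWithinAt (fun p : ℂ × ℝ => k p.1 p.2 s) (U ×ˢ Set.Iic X) (ξ₀, x₀) :=
        (h.k_cont s (ξ₀, x₀) ⟨hξ₀, hs.le, hx₀⟩).mono_of_mem_nhdsWithin hnh
      have hG' : ContinuousWithinAt (fun p : ℂ × ℝ => G p.1 s) (U ×ˢ Set.Iic X) (ξ₀, x₀) :=
        ContinuousWithinAt.comp (t := U ×ˢ Set.Iic X) (g := fun p : ℂ × ℝ => G p.1 p.2)
          (f := fun p : ℂ × ℝ => (p.1, s)) (hG (ξ₀, s) ⟨hξ₀, hs.le.trans hx₀⟩)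
          (by fun_prop : Continuous fun p : ℂ × ℝ => (p.1, s)).continuousWithinAt
          fun p hp => ⟨hp.1, hs.le.trans hx₀⟩
      have h2 : Continuous fun p : Matrix (Fin 2) (Fin 2) ℂ × (Fin 2 → ℂ) => p.1 *ᵥ p.2 :=
        continuous_fst.matrix_mulVec continuous_snd
      have h3 := (h2.tendsto _).comp (hk.prodMk_nhds hG')
      refine Tendsto.congr' ?_ ((show Tendsto _ _ (𝓝 (k ξ₀ x₀ s *ᵥ G ξ₀ s)) from h3).trans ?_)
      · filter_upwards [hev] with p hp
        rw [Set.indicator_of_mem (Set.mem_Iic.2 hp.le)]; rfl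
      · exact le_of_eq (by simp only [Set.indicator_of_mem (Set.mem_Iic.2 hs.le)])
    · have hev : ∀ᶠ p : ℂ × ℝ in 𝓝[U ×ˢ Set.Iic X] (ξ₀, x₀), p.2 < s :=
        mem_nhdsWithin_of_mem_nhds ((continuous_snd.tendsto (ξ₀, x₀)).eventually_lt_const hs)
      refine Tendsto.congr' ?_ (tendsto_const_nhds.trans (le_of_eq ?_)) (f₁ := fun _ => 0)
      · filter_upwards [hev] with p hp
        rw [Set.indicator_of_notMem (Set.notMem_Iic.2 hp)]
      · simp only [Set.indicator_of_notMem (Set.notMem_Iic.2 hs)]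

theorem picard_continuousOn_and_le (h : IsVolterra k f₀ U X ρ C) (n : ℕ) :
    ContinuousOn (fun p : ℂ × ℝ => picard k f₀ n p.1 p.2) (U ×ˢ Set.Iic X) ∧
    ∀ ξ ∈ U, ∀ x ≤ X, ‖picard k f₀ n ξ x‖ ≤ C * ((∫ t in Set.Iic x, ρ t) ^ n / n.factorial) := by
  induction n with
  | zero =>
    refine ⟨h.f₀_cont.comp continuousOn_fst fun p hp => hp.1, fun ξ hξ x _ => ?_⟩
    simpa [picard] using h.f₀_le ξ hξ
  | succ n ih =>
    have hB : ∀ ξ ∈ U, ∀ x ≤ X, ‖picard k f₀ n ξ x‖ ≤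
        C * ((∫ t in Set.Iic X, ρ t) ^ n / n.factorial) := fun ξ hξ x hx =>
      (ih.2 ξ hξ x hx).trans (mul_le_mul_of_nonneg_left (div_le_div_of_nonneg_right
        (pow_le_pow_left₀ (h.mass_nonneg x) (h.mass_mono hx) n) (by positivity)) h.C_nonneg)
    refine ⟨h.continuousOn_integral ih.1 hB, fun ξ hξ x hx => ?_⟩
    obtain ⟨hI, hval⟩ := integral_Iic_mul_pow h.ρ_int n x
    have h1 : ‖∫ s in Set.Iic x, k ξ x s *ᵥ picard k f₀ n ξ s‖ ≤
        ∫ s in Set.Iic x, C / n.factorial * (ρ s * (∫ t in Set.Iic s, ρ t) ^ n) := by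
      refine norm_integral_le_of_norm_le (hI.const_mul _) ?_
      filter_upwards [ae_restrict_mem measurableSet_Iic] with s hs
      refine (h.k_le ξ hξ x hx s hs _).trans ((mul_le_mul_of_nonneg_left
        (ih.2 ξ hξ s (le_trans hs hx)) (h.ρ_nonneg s)).trans (le_of_eq ?_))
      ring
    rw [integral_const_mul, hval] at h1
    refine h1.trans (le_of_eq ?_)
    rw [Nat.factorial_succ]
    push_cast
    field_simp

theorem picard_le (h : IsVolterra k f₀ U X ρ C) (n : ℕ) {ξ : ℂ} (hξ : ξ ∈ U) {x : ℝ}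
    (hx : x ≤ X) : ‖picard k f₀ n ξ x‖ ≤ C * ((∫ t in Set.Iic X, ρ t) ^ n / n.factorial) :=
  ((h.picard_continuousOn_and_le n).2 ξ hξ x hx).trans (mul_le_mul_of_nonneg_left
    (div_le_div_of_nonneg_right (pow_le_pow_left₀ (h.mass_nonneg x) (h.mass_mono hx) n)
      (by positivity)) h.C_nonneg)

theorem summable_bound (_h : IsVolterra k f₀ U X ρ C) :
    Summable fun n : ℕ => C * ((∫ t in Set.Iic X, ρ t) ^ n / n.factorial) :=
  (Real.summable_pow_div_factorial _).mul_left C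

theorem summable_picard (h : IsVolterra k f₀ U X ρ C) {ξ : ℂ} (hξ : ξ ∈ U) {x : ℝ}
    (hx : x ≤ X) : Summable fun n => picard k f₀ n ξ x :=
  Summable.of_norm_bounded h.summable_bound fun n => h.picard_le n hξ hx

theorem continuousOn_sol (h : IsVolterra k f₀ U X ρ C) :
    ContinuousOn (fun p : ℂ × ℝ => volterraSol k f₀ p.1 p.2) (U ×ˢ Set.Iic X) :=
  continuousOn_tsum (fun n => (h.picard_continuousOn_and_le n).1) h.summable_bound
    fun n _ hp => h.picard_le n hp.1 hp.2

theorem norm_sol_le (h : IsVolterra k f₀ U X ρ C) {ξ : ℂ} (hξ : ξ ∈ U) {x : ℝ} (hx : x ≤ X) :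
    ‖volterraSol k f₀ ξ x‖ ≤ ∑' n : ℕ, C * ((∫ t in Set.Iic X, ρ t) ^ n / n.factorial) :=
  tsum_of_norm_bounded h.summable_bound.hasSum fun n => h.picard_le n hξ hx

theorem sol_eq (h : IsVolterra k f₀ U X ρ C) {ξ : ℂ} (hξ : ξ ∈ U) {x : ℝ} (hx : x ≤ X) :
    volterraSol k f₀ ξ x = f₀ ξ + ∫ s in Set.Iic x, k ξ x s *ᵥ volterraSol k f₀ ξ s := by
  have hint (n : ℕ) : IntegrableOn (fun s => k ξ x s *ᵥ picard k f₀ n ξ s) (Set.Iic x) :=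
    h.integrable_mulVec (h.picard_continuousOn_and_le n).1 (fun ξ hξ x hx => h.picard_le n hξ hx)
      hξ hx
  have hsum : Summable fun n => ∫ s in Set.Iic x, ‖k ξ x s *ᵥ picard k f₀ n ξ s‖ := by
    refine Summable.of_nonneg_of_le (fun n => integral_nonneg fun s => norm_nonneg _) (fun n => ?_)
      (h.summable_bound.mul_left (∫ s in Set.Iic x, ρ s))
    rw [← integral_mul_const]
    refine setIntegral_mono_on (hint n).norm ((h.ρ_int x).mul_const _) measurableSet_Iic
      fun s hs => ?_
    exact (h.k_le ξ hξ x hx s hs _).trans (mul_le_mul_of_nonneg_left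
      (h.picard_le n hξ (le_trans hs hx)) (h.ρ_nonneg s))
  have h1 := integral_tsum_of_summable_integral_norm hint hsum
  have h2 : ∫ s in Set.Iic x, (∑' n, k ξ x s *ᵥ picard k f₀ n ξ s) =
      ∫ s in Set.Iic x, k ξ x s *ᵥ volterraSol k f₀ ξ s := by
    refine setIntegral_congr_fun measurableSet_Iic fun s hs => ?_
    have hc : Continuous fun v : Fin 2 → ℂ => k ξ x s *ᵥ v :=
      continuous_const.matrix_mulVec continuous_id
    exact ((h.summable_picard hξ (le_trans hs hx)).hasSum.map
      (Matrix.mulVecLin (k ξ x s)) hc).tsum_eq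
  rw [← h2, ← h1, volterraSol, (h.summable_picard hξ hx).tsum_eq_zero_add]
  rfl

theorem integrable_sol (h : IsVolterra k f₀ U X ρ C) {ξ : ℂ} (hξ : ξ ∈ U) {x : ℝ} (hx : x ≤ X) :
    IntegrableOn (fun s => k ξ x s *ᵥ volterraSol k f₀ ξ s) (Set.Iic x) :=
  h.integrable_mulVec h.continuousOn_sol (fun _ hξ _ hx => h.norm_sol_le hξ hx) hξ hx

/-- The solution tends to the free term at `-∞`. -/
theorem tendsto_sol_atBot (h : IsVolterra k f₀ U X ρ C) {ξ : ℂ} (hξ : ξ ∈ U) :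
    Tendsto (volterraSol k f₀ ξ) atBot (𝓝 (f₀ ξ)) := by
  set B := ∑' n : ℕ, C * ((∫ t in Set.Iic X, ρ t) ^ n / n.factorial)
  have hbot : Tendsto (fun x => (∫ t in Set.Iic x, ρ t) * B) atBot (𝓝 0) := by
    have h1 := intervalIntegral_tendsto_integral_Iic X (h.ρ_int X) tendsto_id
    have h2 := ((tendsto_const_nhds (x := ∫ t in Set.Iic X, ρ t)).sub h1).mul_const B
    rw [sub_self, zero_mul] at h2
    refine h2.congr fun a => ?_
    rw [id, ← intervalIntegral.integral_Iic_sub_Iic (h.ρ_int a) (h.ρ_int X)]; ring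
  rw [tendsto_iff_norm_sub_tendsto_zero]
  refine squeeze_zero' (Eventually.of_forall fun _ => norm_nonneg _) ?_ hbot
  filter_upwards [eventually_le_atBot X] with x hx
  rw [h.sol_eq hξ hx, add_sub_cancel_left, ← integral_mul_const]
  refine norm_integral_le_of_norm_le ((h.ρ_int x).mul_const B) ?_
  filter_upwards [ae_restrict_mem measurableSet_Iic] with s hs
  exact (h.k_le ξ hξ x hx s hs _).trans (mul_le_mul_of_nonneg_left
    (h.norm_sol_le hξ (le_trans hs hx)) (h.ρ_nonneg s))

theorem differentiableOn_sol (h : IsVolterra k f₀ U X ρ C) {U' : Set ℂ} (hU' : IsOpen U')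
    (hsub : U' ⊆ U) (hf : DifferentiableOn ℂ f₀ U')
    (hk : ∀ x ≤ X, ∀ s ≤ x, ∀ i j, DifferentiableOn ℂ (fun ξ => k ξ x s i j) U') {x : ℝ}
    (hx : x ≤ X) : DifferentiableOn ℂ (fun ξ => volterraSol k f₀ ξ x) U' := by
  have hp (n : ℕ) : ∀ x ≤ X, DifferentiableOn ℂ (fun ξ => picard k f₀ n ξ x) U' := by
    induction n with
    | zero => exact fun x _ => hf
    | succ n ih =>
      intro x hx
      refine differentiableOn_integral_of_dominated hU'
        (bound := fun s => ρ s * (C * ((∫ t in Set.Iic X, ρ t) ^ n / n.factorial)))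
        (fun ξ hξ => h.meas_mulVec (h.picard_continuousOn_and_le n).1 (hsub hξ) hx)
        ((h.ρ_int x).mul_const _) ?_ ?_
      · filter_upwards [ae_restrict_mem measurableSet_Iic] with s hs ξ hξ
        exact (h.k_le ξ (hsub hξ) x hx s hs _).trans (mul_le_mul_of_nonneg_left
          (h.picard_le n (hsub hξ) (le_trans hs hx)) (h.ρ_nonneg s))
      · filter_upwards [ae_restrict_mem measurableSet_Iic] with s hs
        have h1 := differentiableOn_pi.1 (ih s (le_trans hs hx))
        refine differentiableOn_pi.2 fun i => ?_
        simp only [Matrix.mulVec, dotProduct, Fin.sum_univ_two]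
        exact ((hk x hx s hs i 0).mul (h1 0)).add ((hk x hx s hs i 1).mul (h1 1))
  exact Complex.differentiableOn_tsum_of_summable_norm h.summable_bound (fun n => hp n x hx) hU'
    fun n ξ hξ => h.picard_le n (hsub hξ) hx

end IsVolterra

end Volterra

/-! ### The propagator of the constant background -/

/-- `∫₀ᵗ e^{2iητ} dτ`, an entire function of `η` that replaces `(e^{2iηt} - 1) / (2iη)`. -/
noncomputable def expInt (η : ℂ) (t : ℝ) : ℂ :=
  ∫ τ in (0 : ℝ)..t, Complex.exp (2 * Complex.I * η * τ)

theorem mul_expInt (η : ℂ) (t : ℝ) :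
    2 * Complex.I * η * expInt η t = Complex.exp (2 * Complex.I * η * t) - 1 := by
  have h1 := intervalIntegral.integral_eq_sub_of_hasDerivAt
    (f := fun τ : ℝ => Complex.exp (2 * Complex.I * η * τ))
    (f' := fun τ : ℝ => 2 * Complex.I * η * Complex.exp (2 * Complex.I * η * τ))
    (a := 0) (b := t) (fun τ _ => by
      have := ((hasDerivAt_id (τ : ℂ)).const_mul (2 * Complex.I * η)).cexp.comp_ofReal
      simpa [mul_comm] using this)
    (Continuous.intervalIntegrable (by fun_prop) _ _)
  rw [intervalIntegral.integral_const_mul] at h1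
  simpa [expInt] using h1

theorem continuous_expInt : Continuous fun p : ℂ × ℝ => expInt p.1 p.2 := by
  refine intervalIntegral.continuous_parametric_intervalIntegral_of_continuous ?_ continuous_snd
  fun_prop

theorem norm_exp_le_one {c : ℂ} (hc : c.re ≤ 0) {t : ℝ} (ht : 0 ≤ t) :
    ‖Complex.exp (c * t)‖ ≤ 1 := by
  rw [Complex.norm_exp]
  refine Real.exp_le_one_iff.2 ?_
  simpa using mul_nonpos_of_nonpos_of_nonneg hc ht

theorem two_I_mul_re (η : ℂ) : (2 * Complex.I * η).re = -2 * η.im := by simp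

theorem norm_expInt_le {η : ℂ} (hη : 0 ≤ η.im) {t : ℝ} (ht : 0 ≤ t) : ‖expInt η t‖ ≤ t := by
  have h1 := intervalIntegral.norm_integral_le_of_norm_le_const (a := 0) (b := t) (C := 1)
    (f := fun τ : ℝ => Complex.exp (2 * Complex.I * η * τ)) (fun τ hτ => by
      rw [Set.uIoc_of_le ht] at hτ
      exact norm_exp_le_one (by rw [two_I_mul_re]; linarith) hτ.1.le)
  simpa [expInt, abs_of_nonneg ht] using h1

theorem norm_expInt_le_inv {η : ℂ} (hη : 0 ≤ η.im) (h0 : η ≠ 0) {t : ℝ} (ht : 0 ≤ t) :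
    ‖expInt η t‖ ≤ 1 / ‖η‖ := by
  have h1 : ‖2 * Complex.I * η * expInt η t‖ ≤ 1 + 1 := by
    rw [mul_expInt]
    refine (norm_sub_le _ _).trans (add_le_add (norm_exp_le_one ?_ ht) (by simp))
    rw [two_I_mul_re]; linarith
  simp only [norm_mul, Complex.norm_ofNat, Complex.norm_I, mul_one] at h1
  rw [le_div_iff₀ (norm_pos_iff.2 h0)]
  linarith

theorem differentiableAt_expInt {η : ℂ} (hη : η ≠ 0) (t : ℝ) :
    DifferentiableAt ℂ (fun η => expInt η t) η := by
  have h1 : (fun η => expInt η t) =ᶠ[𝓝 η]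
      fun η => (Complex.exp (2 * Complex.I * η * t) - 1) / (2 * Complex.I * η) := by
    filter_upwards [isOpen_ne.mem_nhds hη] with z hz
    rw [eq_div_iff (by simpa using hz), mul_comm, mul_expInt]
  refine DifferentiableAt.congr_of_eventuallyEq ?_ h1
  exact DifferentiableAt.div (by fun_prop) (by fun_prop) (by simpa using hη)

section Convolution

variable {g : ℝ → ℂ}

theorem integrableOn_exp_mul (hg : ∀ x, IntegrableOn g (Set.Iic x)) {c : ℂ} (hc : c.re ≤ 0)
    (x y : ℝ) : IntegrableOn (fun s => Complex.exp (c * ((y - s : ℝ) : ℂ)) * g s) (Set.Iic x) := by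
  have h1 : IntegrableOn (fun s => Complex.exp (c * ((x - s : ℝ) : ℂ)) * g s) (Set.Iic x) := by
    refine Integrable.bdd_mul (c := 1) (hg x) (Continuous.aestronglyMeasurable (by fun_prop)) ?_
    filter_upwards [ae_restrict_mem measurableSet_Iic] with s hs
    exact norm_exp_le_one hc (sub_nonneg.2 hs)
  refine (h1.const_mul (Complex.exp (c * ((y - x : ℝ) : ℂ)))).congr
    (Eventually.of_forall fun s => ?_)
  simp only
  rw [← mul_assoc, ← Complex.exp_add]
  congr 2
  push_cast; ring

/-- Variation of constants for a scalar equation with a constant coefficient. -/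
theorem isPrim_expConv (hg : ∀ x, IntegrableOn g (Set.Iic x)) {c : ℂ} (hc : c.re ≤ 0) :
    IsPrim (fun x => ∫ s in Set.Iic x, Complex.exp (c * ((x - s : ℝ) : ℂ)) * g s)
      (fun x => c * (∫ s in Set.Iic x, Complex.exp (c * ((x - s : ℝ) : ℂ)) * g s) + g x) := by
  have h1 := IsPrim.integral_Iic (fun x => integrableOn_exp_mul hg hc x 0)
  have h2 : IsPrim (fun x : ℝ => Complex.exp (c * x)) fun x => c * Complex.exp (c * x) := by
    refine IsPrim.of_hasDerivAt (fun x => ?_) (by fun_prop)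
    have := ((hasDerivAt_id (x : ℂ)).const_mul c).cexp.comp_ofReal
    simpa [mul_comm] using this
  have h3 (x : ℝ) : Complex.exp (c * x) *
      (∫ s in Set.Iic x, Complex.exp (c * ((0 - s : ℝ) : ℂ)) * g s) =
      ∫ s in Set.Iic x, Complex.exp (c * ((x - s : ℝ) : ℂ)) * g s := by
    rw [← integral_const_mul]
    congr 1
    funext s
    rw [← mul_assoc, ← Complex.exp_add]
    congr 2
    push_cast; ring
  have h4 := h2.mul h1
  simp only [h3] at h4
  refine h4.congr_right fun x => ?_
  rw [mul_assoc, h3, ← mul_assoc, ← Complex.exp_add, ← mul_add]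
  congr 1
  rw [show (x : ℂ) + ((0 - x : ℝ) : ℂ) = 0 by push_cast; ring]
  simp

theorem integrableOn_expInt_mul (hg : ∀ x, IntegrableOn g (Set.Iic x))
    (hg' : ∀ x, IntegrableOn (fun s : ℝ => (s : ℂ) * g s) (Set.Iic x)) {η : ℂ} (hη : 0 ≤ η.im)
    (x : ℝ) : IntegrableOn (fun s => expInt η (x - s) * g s) (Set.Iic x) := by
  refine (((hg x).norm.const_mul |x|).add (hg' x).norm).mono'
    (AEStronglyMeasurable.mul (Continuous.aestronglyMeasurable ?_) (hg x).1) ?_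
  · exact continuous_expInt.comp (by fun_prop : Continuous fun s : ℝ => (η, x - s))
  · filter_upwards [ae_restrict_mem measurableSet_Iic] with s hs
    rw [norm_mul, Pi.add_apply, norm_mul, ← add_mul, Complex.norm_real, Real.norm_eq_abs]
    refine mul_le_mul_of_nonneg_right ((norm_expInt_le hη (sub_nonneg.2 hs)).trans ?_)
      (norm_nonneg _)
    linarith [le_abs_self x, neg_abs_le s]

theorem expInt_zero (t : ℝ) : expInt 0 t = t := by simp [expInt]

theorem mul_expIntConv (hg : ∀ x, IntegrableOn g (Set.Iic x)) {η : ℂ} (hη : 0 ≤ η.im) (x : ℝ) :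
    2 * Complex.I * η * (∫ s in Set.Iic x, expInt η (x - s) * g s) =
      (∫ s in Set.Iic x, Complex.exp (2 * Complex.I * η * ((x - s : ℝ) : ℂ)) * g s) -
        ∫ s in Set.Iic x, g s := by
  rw [← integral_const_mul, ← integral_sub
    (integrableOn_exp_mul hg (by rw [two_I_mul_re]; linarith) x x) (hg x)]
  congr 1
  funext s
  rw [← mul_assoc, mul_expInt]; ring

/-- The convolution with `expInt` is one integration more than that with the exponential. For
`η = 0` this is where the first moment of `g` is used. -/
theorem isPrim_expIntConv (hg : ∀ x, IntegrableOn g (Set.Iic x))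
    (hg' : ∀ x, IntegrableOn (fun s : ℝ => (s : ℂ) * g s) (Set.Iic x)) {η : ℂ} (hη : 0 ≤ η.im) :
    IsPrim (fun x => ∫ s in Set.Iic x, expInt η (x - s) * g s)
      (fun x => ∫ s in Set.Iic x, Complex.exp (2 * Complex.I * η * ((x - s : ℝ) : ℂ)) * g s) := by
  have hG := IsPrim.integral_Iic hg
  by_cases h0 : η = 0
  · subst h0
    have h1 := ((IsPrim.of_hasDerivAt (fun x => (hasDerivAt_id (x : ℂ)).comp_ofReal)
      continuous_const).mul hG).sub (IsPrim.integral_Iic hg')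
    have h2 (x : ℝ) : (x : ℂ) * (∫ s in Set.Iic x, g s) - ∫ s in Set.Iic x, (s : ℂ) * g s =
        ∫ s in Set.Iic x, expInt 0 (x - s) * g s := by
      rw [← integral_const_mul, ← integral_sub ((hg x).const_mul _) (hg' x)]
      congr 1
      funext s
      rw [expInt_zero]; push_cast; ring
    simp only [id, h2] at h1
    refine h1.congr_right fun x => ?_
    simp
  · have hne : 2 * Complex.I * η ≠ 0 := by simpa using h0
    have h1 := ((isPrim_expConv hg (c := 2 * Complex.I * η)
      (by rw [two_I_mul_re]; linarith)).sub hG).const_mul (2 * Complex.I * η)⁻¹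
    simp only [← mul_expIntConv hg hη] at h1
    simp only [inv_mul_cancel_left₀ hne] at h1
    refine h1.congr_right fun x => ?_
    rw [add_sub_cancel_right, inv_mul_cancel_left₀ hne]

end Convolution

/-! ### The Volterra equation of the Jost solutions at `-∞` -/

/-- The weight `(1 + |s|) (|q₀(s)| + |A - conj q₀(-s)|)` of the deviation of the Lax matrix from
its limit at `-∞`. -/
noncomputable def mass (A : ℝ) (q₀ : ℝ → ℂ) (s : ℝ) : ℝ :=
  (1 + |s|) * (‖q₀ s‖ + ‖(A : ℂ) - (starRingEnd ℂ) (q₀ (-s))‖)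

theorem mass_nonneg (A : ℝ) (q₀ : ℝ → ℂ) (s : ℝ) : 0 ≤ mass A q₀ s := by
  unfold mass; positivity

theorem norm_le_mass_left (A : ℝ) (q₀ : ℝ → ℂ) (s : ℝ) : (1 + |s|) * ‖q₀ s‖ ≤ mass A q₀ s := by
  unfold mass
  gcongr
  simp

theorem norm_le_mass_right (A : ℝ) (q₀ : ℝ → ℂ) (s : ℝ) :
    (1 + |s|) * ‖(A : ℂ) - (starRingEnd ℂ) (q₀ (-s))‖ ≤ mass A q₀ s := by
  unfold mass
  gcongr
  simp

theorem IsStepLike.aestronglyMeasurable {A : ℝ} {q₀ : ℝ → ℂ} (hq : IsStepLike A q₀) :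
    AEStronglyMeasurable q₀ := by
  have h1 : AEStronglyMeasurable (step A) :=
    (StronglyMeasurable.ite measurableSet_Ioi stronglyMeasurable_const
      stronglyMeasurable_const).aestronglyMeasurable
  have h2 : AEStronglyMeasurable (fun x : ℝ => ((1 + |x| : ℝ) : ℂ)⁻¹) :=
    Continuous.aestronglyMeasurable (Continuous.inv₀ (by fun_prop) fun x => by
      exact_mod_cast (by positivity : (1 + |x| : ℝ) ≠ 0))
  refine ((h2.mul hq.1).add h1).congr (Eventually.of_forall fun x => ?_)
  have : ((1 + |x| : ℝ) : ℂ) ≠ 0 := by exact_mod_cast (by positivity : (1 + |x| : ℝ) ≠ 0)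
  simp only [Pi.add_apply, Pi.mul_apply]
  rw [inv_mul_cancel_left₀ this]; ring

theorem IsStepLike.aestronglyMeasurable_conj_neg {A : ℝ} {q₀ : ℝ → ℂ} (hq : IsStepLike A q₀) :
    AEStronglyMeasurable (fun s => (starRingEnd ℂ) (q₀ (-s))) :=
  Complex.continuous_conj.comp_aestronglyMeasurable
    (hq.aestronglyMeasurable.comp_quasiMeasurePreserving
      (Measure.measurePreserving_neg volume).quasiMeasurePreserving)

theorem IsStepLike.integrableOn_mass {A : ℝ} (hA : 0 < A) {q₀ : ℝ → ℂ} (hq : IsStepLike A q₀)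
    (x : ℝ) : IntegrableOn (mass A q₀) (Set.Iic x) := by
  have h1 : IntegrableOn ((Set.Ici (0 : ℝ)).indicator fun s => 2 * (A * (1 + |s|)))
      (Set.Iic x) := by
    rw [IntegrableOn, integrable_indicator_iff measurableSet_Ici, IntegrableOn,
      Measure.restrict_restrict measurableSet_Ici, Set.Ici_inter_Iic]
    exact (Continuous.continuousOn (by fun_prop)).integrableOn_Icc
  refine ((hq.norm.integrableOn.add hq.comp_neg.norm.integrableOn).add h1).mono' ?_ ?_
  · refine (Continuous.aestronglyMeasurable (by fun_prop)).mul ?_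
    exact (hq.aestronglyMeasurable.norm.add
      (aestronglyMeasurable_const.sub hq.aestronglyMeasurable_conj_neg).norm).restrict
  · refine Eventually.of_forall fun s => ?_
    rw [Real.norm_of_nonneg (mass_nonneg A q₀ s)]
    simp only [Pi.add_apply, norm_mul, abs_neg, Complex.norm_real, mass]
    rw [Real.norm_of_nonneg (by positivity : 0 ≤ 1 + |s|), ← mul_add]
    have e1 : ‖q₀ s‖ ≤ ‖q₀ s - step A s‖ + (Set.Ici (0 : ℝ)).indicator (fun _ => A) s := by
      by_cases hs : 0 < s
      · rw [Set.indicator_of_mem (Set.mem_Ici.2 hs.le), step, if_pos hs]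
        simpa [abs_of_pos hA] using norm_le_norm_sub_add (q₀ s) (A : ℂ)
      · rw [step, if_neg hs, sub_zero]
        exact le_add_of_nonneg_right (Set.indicator_nonneg (fun _ _ => hA.le) _)
    have e2 : ‖(A : ℂ) - (starRingEnd ℂ) (q₀ (-s))‖ ≤
        ‖q₀ (-s) - step A (-s)‖ + (Set.Ici (0 : ℝ)).indicator (fun _ => A) s := by
      by_cases hs : 0 ≤ s
      · rw [Set.indicator_of_mem (Set.mem_Ici.2 hs), step, if_neg (by linarith), sub_zero, add_comm]
        simpa [abs_of_pos hA] using norm_sub_le (A : ℂ) ((starRingEnd ℂ) (q₀ (-s)))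
      · rw [Set.indicator_of_notMem (by simpa using hs), step, if_pos (by linarith), add_zero,
          norm_sub_rev, ← Complex.norm_conj (q₀ (-s) - A)]
        simp
    have e3 : (Set.Ici (0 : ℝ)).indicator (fun s => 2 * (A * (1 + |s|))) s =
        (1 + |s|) * (2 * (Set.Ici (0 : ℝ)).indicator (fun _ => A) s) := by
      by_cases hs : s ∈ Set.Ici (0 : ℝ)
      · simp only [Set.indicator_of_mem hs]; ring
      · simp only [Set.indicator_of_notMem hs]; ring
    rw [e3, ← mul_add]
    exact mul_le_mul_of_nonneg_left (by linarith) (by positivity)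

/-- The exponent, relative to the decaying factor `e^{-iηx}`, of the component `j` of the background
solution. -/
noncomputable def rate (j : Fin 2) (η : ℂ) : ℂ := if j = 0 then 0 else 2 * Complex.I * η

theorem rate_re_nonpos (j : Fin 2) {η : ℂ} (hη : 0 ≤ η.im) : (rate j η).re ≤ 0 := by
  unfold rate
  split_ifs
  · simp
  · rw [two_I_mul_re]; linarith

/-- The kernel of the Volterra equation for `F = e^{iηx} φ`, where `φ` is a multiple of column `j`
of the Jost solution at `-∞` and `η = σⱼ ξ`: the propagator of the constant background at `-∞`,
times the deviation of the Lax matrix from its limit. -/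
noncomputable def jostKernel (A : ℝ) (q₀ : ℝ → ℂ) (j : Fin 2) (η : ℂ) (x s : ℝ) :
    Matrix (Fin 2) (Fin 2) ℂ :=
  !![0, Complex.exp (rate j η * ((x - s : ℝ) : ℂ)) * q₀ s;
    Complex.exp (rate (1 - j) η * ((x - s : ℝ) : ℂ)) * ((A : ℂ) - (starRingEnd ℂ) (q₀ (-s))),
    -(A * (expInt η (x - s) * q₀ s))]

/-- The limit of `F` at `-∞`. For `j = 0` it is column `0` of `Lminus` times `η / (η + i)`, a factor
that removes the pole at `η = 0` and is bounded in the closed upper half-plane. -/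
noncomputable def jostFree (A : ℝ) (j : Fin 2) (η : ℂ) : Fin 2 → ℂ :=
  if j = 0 then ![η / (η + Complex.I), A / (2 * Complex.I) / (η + Complex.I)] else ![0, 1]

/-- The normalized Jost solutions at `-∞`, as functions of `η = σⱼ ξ`. -/
noncomputable def jostF (A : ℝ) (q₀ : ℝ → ℂ) (j : Fin 2) (η : ℂ) (x : ℝ) : Fin 2 → ℂ :=
  volterraSol (jostKernel A q₀ j) (jostFree A j) η x

theorem add_I_ne_zero {η : ℂ} (hη : 0 ≤ η.im) : η + Complex.I ≠ 0 := by
  intro h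
  have := congrArg Complex.im h
  simp at this
  linarith

theorem one_le_norm_add_I {η : ℂ} (hη : 0 ≤ η.im) : 1 ≤ ‖η + Complex.I‖ := by
  have h1 := Complex.abs_im_le_norm (η + Complex.I)
  rw [Complex.add_im, Complex.I_im, abs_of_nonneg (by linarith)] at h1
  linarith

theorem norm_le_norm_add_I {η : ℂ} (hη : 0 ≤ η.im) : ‖η‖ ≤ ‖η + Complex.I‖ := by
  rw [← sq_le_sq₀ (norm_nonneg _) (norm_nonneg _), ← Complex.normSq_eq_norm_sq,
    ← Complex.normSq_eq_norm_sq, Complex.normSq_apply, Complex.normSq_apply]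
  simp
  nlinarith

theorem fin_two_eq (j : Fin 2) : j = 0 ∨ j = 1 := by
  fin_cases j <;> simp

theorem jostFree_zero_zero (A : ℝ) (η : ℂ) : jostFree A 0 η 0 = η / (η + Complex.I) := by
  simp [jostFree]

theorem jostFree_zero_one (A : ℝ) (η : ℂ) :
    jostFree A 0 η 1 = A / (2 * Complex.I) / (η + Complex.I) := by
  simp [jostFree]

theorem jostFree_one_zero (A : ℝ) (η : ℂ) : jostFree A 1 η 0 = 0 := by
  simp [jostFree]

theorem jostFree_one_one (A : ℝ) (η : ℂ) : jostFree A 1 η 1 = 1 := by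
  simp [jostFree]

section Kernel

open scoped Matrix

variable {A : ℝ} {q₀ : ℝ → ℂ} {j : Fin 2} {η : ℂ} {x s : ℝ}

theorem jostKernel_mulVec_zero (v : Fin 2 → ℂ) : (jostKernel A q₀ j η x s *ᵥ v) 0 =
    Complex.exp (rate j η * ((x - s : ℝ) : ℂ)) * (q₀ s * v 1) := by
  simp [jostKernel, Matrix.mulVec, dotProduct, Fin.sum_univ_two, mul_assoc]

theorem jostKernel_mulVec_one (v : Fin 2 → ℂ) : (jostKernel A q₀ j η x s *ᵥ v) 1 =
    Complex.exp (rate (1 - j) η * ((x - s : ℝ) : ℂ)) *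
      (((A : ℂ) - (starRingEnd ℂ) (q₀ (-s))) * v 0) - A * (expInt η (x - s) * (q₀ s * v 1)) := by
  simp [jostKernel, Matrix.mulVec, dotProduct, Fin.sum_univ_two, mul_assoc, sub_eq_add_neg]

theorem norm_jostKernel_mulVec_le (hA : 0 < A) {X : ℝ} (hη : 0 ≤ η.im) (hx : x ≤ X) (hs : s ≤ x)
    (v : Fin 2 → ℂ) : ‖jostKernel A q₀ j η x s *ᵥ v‖ ≤
      (1 + A * (1 + |X|)) * mass A q₀ s * ‖v‖ := by
  have hsx : 0 ≤ x - s := sub_nonneg.2 hs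
  have e0 := norm_exp_le_one (rate_re_nonpos j hη) hsx
  have e1 := norm_exp_le_one (rate_re_nonpos (1 - j) hη) hsx
  have e2 := norm_expInt_le hη hsx
  have hX : x - s ≤ |X| + |s| := by linarith [le_abs_self X, neg_abs_le s]
  have hL : 0 ≤ |X| + |s| := by positivity
  set a := ‖q₀ s‖
  set b := ‖(A : ℂ) - (starRingEnd ℂ) (q₀ (-s))‖
  have ha : 0 ≤ a := norm_nonneg _
  have hb : 0 ≤ b := norm_nonneg _
  have hv : 0 ≤ ‖v‖ := norm_nonneg _
  have key : (1 + A * (|X| + |s|)) * (a + b) ≤ (1 + A * (1 + |X|)) * mass A q₀ s := by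
    change _ ≤ (1 + A * (1 + |X|)) * ((1 + |s|) * (a + b))
    rw [← mul_assoc]
    refine mul_le_mul_of_nonneg_right ?_ (add_nonneg ha hb)
    have := mul_nonneg (mul_nonneg hA.le (abs_nonneg X)) (abs_nonneg s)
    have := mul_nonneg hA.le (abs_nonneg s)
    have := abs_nonneg s
    linarith
  have t0 : a * ‖v 1‖ ≤ a * ‖v‖ := mul_le_mul_of_nonneg_left (norm_le_pi_norm v 1) ha
  have t1 : b * ‖v 0‖ ≤ b * ‖v‖ := mul_le_mul_of_nonneg_left (norm_le_pi_norm v 0) hb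
  have hav : 0 ≤ a * ‖v‖ := mul_nonneg ha hv
  have hbv : 0 ≤ b * ‖v‖ := mul_nonneg hb hv
  have hAL : 0 ≤ A * (|X| + |s|) := mul_nonneg hA.le hL
  have hALb : 0 ≤ A * (|X| + |s|) * (b * ‖v‖) := mul_nonneg hAL hbv
  have hALa : 0 ≤ A * (|X| + |s|) * (a * ‖v‖) := mul_nonneg hAL hav
  have hexpand : (1 + A * (|X| + |s|)) * (a + b) * ‖v‖ = a * ‖v‖ + b * ‖v‖ +
      A * (|X| + |s|) * (a * ‖v‖) + A * (|X| + |s|) * (b * ‖v‖) := by ring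
  refine le_trans ?_ (mul_le_mul_of_nonneg_right key hv)
  rw [pi_norm_le_iff_of_nonneg (mul_nonneg (by positivity) hv), hexpand]
  intro i
  rcases fin_two_eq i with rfl | rfl
  · rw [jostKernel_mulVec_zero, norm_mul, norm_mul]
    have := mul_le_of_le_one_left (mul_nonneg ha (norm_nonneg (v 1))) e0
    linarith
  · rw [jostKernel_mulVec_one]
    refine (norm_sub_le _ _).trans ?_
    rw [norm_mul, norm_mul, norm_mul, norm_mul, norm_mul, Complex.norm_real,
      Real.norm_of_nonneg hA.le]
    have := mul_le_of_le_one_left (mul_nonneg hb (norm_nonneg (v 0))) e1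
    have h5 : A * (‖expInt η (x - s)‖ * (a * ‖v 1‖)) ≤ A * ((|X| + |s|) * (a * ‖v‖)) :=
      mul_le_mul_of_nonneg_left (mul_le_mul (e2.trans hX) t0 (mul_nonneg ha (norm_nonneg _)) hL)
        hA.le
    linarith

theorem norm_jostFree_le (hA : 0 < A) (j : Fin 2) (hη : 0 ≤ η.im) : ‖jostFree A j η‖ ≤ 1 + A := by
  rw [pi_norm_le_iff_of_nonneg (by positivity)]
  intro i
  have h1 := one_le_norm_add_I hη
  rcases fin_two_eq j with rfl | rfl <;> rcases fin_two_eq i with rfl | rfl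
  · rw [jostFree_zero_zero, norm_div]
    exact (div_le_one_of_le₀ (norm_le_norm_add_I hη) (norm_nonneg _)).trans (by linarith)
  · rw [jostFree_zero_one, norm_div, norm_div, norm_mul, Complex.norm_ofNat, Complex.norm_I,
      Complex.norm_real, Real.norm_of_nonneg hA.le, div_le_iff₀ (by positivity)]
    nlinarith
  · rw [jostFree_one_zero, norm_zero]; linarith
  · rw [jostFree_one_one, norm_one]; linarith

theorem differentiableOn_jostFree (A : ℝ) (j : Fin 2) :
    DifferentiableOn ℂ (jostFree A j) {η | 0 ≤ η.im} := by
  have h1 : ∀ η ∈ {η : ℂ | 0 ≤ η.im}, η + Complex.I ≠ 0 := fun η hη => add_I_ne_zero hη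
  refine differentiableOn_pi.2 fun i => ?_
  rcases fin_two_eq j with rfl | rfl <;> rcases fin_two_eq i with rfl | rfl
  · simp only [jostFree_zero_zero]
    exact DifferentiableOn.div (by fun_prop) (by fun_prop) h1
  · simp only [jostFree_zero_one]
    exact DifferentiableOn.div (by fun_prop) (by fun_prop) h1
  · simp only [jostFree_one_zero]; fun_prop
  · simp only [jostFree_one_one]; fun_prop

theorem aestronglyMeasurable_jostKernel (hq : IsStepLike A q₀) (j : Fin 2) (η : ℂ) (x : ℝ) :
    AEStronglyMeasurable (jostKernel A q₀ j η x) := by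
  have hq1 := hq.aestronglyMeasurable
  have hq2 := hq.aestronglyMeasurable_conj_neg
  have he : Continuous fun s : ℝ => expInt η (x - s) :=
    continuous_expInt.comp (by fun_prop : Continuous fun s : ℝ => (η, x - s))
  have h0 : AEStronglyMeasurable fun s : ℝ =>
      Complex.exp (rate j η * ((x - s : ℝ) : ℂ)) * q₀ s :=
    (Continuous.aestronglyMeasurable (by fun_prop)).mul hq1
  have h1 : AEStronglyMeasurable fun s : ℝ =>
      Complex.exp (rate (1 - j) η * ((x - s : ℝ) : ℂ)) * ((A : ℂ) - (starRingEnd ℂ) (q₀ (-s))) :=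
    (Continuous.aestronglyMeasurable (by fun_prop)).mul (aestronglyMeasurable_const.sub hq2)
  have h2 : AEStronglyMeasurable fun s : ℝ => -(A * (expInt η (x - s) * q₀ s)) :=
    ((he.aestronglyMeasurable.mul hq1).const_mul _).neg
  have h3 : Continuous fun p : (ℂ × ℂ) × ℂ => !![0, p.1.1; p.1.2, p.2] := by
    refine continuous_matrix fun a b => ?_
    fin_cases a <;> fin_cases b
    · exact continuous_const
    · exact continuous_fst.fst
    · exact continuous_fst.snd
    · exact continuous_snd
  exact (h3.comp_aestronglyMeasurable ((h0.prodMk h1).prodMk h2)).congr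
    (Eventually.of_forall fun _ => rfl)

theorem continuous_jostKernel (A : ℝ) (q₀ : ℝ → ℂ) (j : Fin 2) (s : ℝ) :
    Continuous fun p : ℂ × ℝ => jostKernel A q₀ j p.1 p.2 s := by
  have he : Continuous fun p : ℂ × ℝ => expInt p.1 (p.2 - s) :=
    continuous_expInt.comp (by fun_prop : Continuous fun p : ℂ × ℝ => (p.1, p.2 - s))
  have hr (i : Fin 2) : Continuous fun p : ℂ × ℝ => rate i p.1 := by
    unfold rate; split_ifs <;> fun_prop
  have h0 := hr j
  have h1 := hr (1 - j)
  refine continuous_matrix fun a b => ?_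
  fin_cases a <;> fin_cases b <;> simp [jostKernel] <;> fun_prop

theorem differentiableAt_jostKernel (A : ℝ) (q₀ : ℝ → ℂ) (j : Fin 2) (x s : ℝ) (hη : η ≠ 0)
    (a b : Fin 2) : DifferentiableAt ℂ (fun η => jostKernel A q₀ j η x s a b) η := by
  have he := differentiableAt_expInt hη (x - s)
  have hr (i : Fin 2) : DifferentiableAt ℂ (rate i) η := by
    unfold rate; split_ifs <;> fun_prop
  have h0 := hr j
  have h1 := hr (1 - j)
  fin_cases a <;> fin_cases b <;> simp [jostKernel] <;> fun_prop

/-- By `|expInt η (x - s)| ≤ x - s ≤ |X| + |s|` the kernel is bounded by a multiple of the weight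
`mass`, uniformly in the closed upper half-plane. -/
theorem isVolterra_jost (hA : 0 < A) (hq : IsStepLike A q₀) (j : Fin 2)
    (X : ℝ) : IsVolterra (jostKernel A q₀ j) (jostFree A j) {η | 0 ≤ η.im} X
      (fun s => (1 + A * (1 + |X|)) * mass A q₀ s) (1 + A) where
  ρ_nonneg s := mul_nonneg (by positivity) (mass_nonneg A q₀ s)
  ρ_int x := (hq.integrableOn_mass hA x).const_mul _
  C_nonneg := by positivity
  f₀_le _ hη := norm_jostFree_le hA j hη
  f₀_cont := (differentiableOn_jostFree A j).continuousOn
  k_meas η _ x _ := (aestronglyMeasurable_jostKernel hq j η x).restrict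
  k_le _ hη _ hx _ hs v := norm_jostKernel_mulVec_le hA hη hx hs v
  k_cont s := (continuous_jostKernel A q₀ j s).continuousOn

end Kernel

/-! ### Jost solutions at `-∞` -/

section Jost

variable {A : ℝ} {q₀ : ℝ → ℂ} {j : Fin 2} {η : ℂ}

theorem continuous_jostF (hA : 0 < A) (hq : IsStepLike A q₀) (j : Fin 2) (hη : 0 ≤ η.im) :
    Continuous (jostF A q₀ j η) := by
  rw [continuous_iff_continuousAt]
  intro x
  have h1 := (isVolterra_jost hA hq j (x + 1)).continuousOn_sol
  have h2 : ContinuousOn (jostF A q₀ j η) (Set.Iic (x + 1)) :=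
    h1.comp (f := fun x : ℝ => (η, x)) (by fun_prop) fun s hs => ⟨hη, hs⟩
  exact h2.continuousAt (Iic_mem_nhds (by linarith))

theorem norm_jostF_le (hA : 0 < A) (hq : IsStepLike A q₀) (j : Fin 2) (X : ℝ) :
    ∃ B, ∀ η : ℂ, 0 ≤ η.im → ∀ x ≤ X, ‖jostF A q₀ j η x‖ ≤ B :=
  ⟨_, fun _ hη _ hx => (isVolterra_jost hA hq j X).norm_sol_le hη hx⟩

theorem integrableOn_mul_of_le_mass (hA : 0 < A) (hq : IsStepLike A q₀) {u G : ℝ → ℂ}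
    (hu : AEStronglyMeasurable u) (hle : ∀ s, (1 + |s|) * ‖u s‖ ≤ mass A q₀ s)
    (hG : Continuous G) (hB : ∀ x, ∃ B, ∀ s ≤ x, ‖G s‖ ≤ B) (x : ℝ) :
    IntegrableOn (fun s => u s * G s) (Set.Iic x) ∧
      IntegrableOn (fun s : ℝ => (s : ℂ) * (u s * G s)) (Set.Iic x) := by
  obtain ⟨B, hB⟩ := hB x
  have h1 (w : ℝ → ℂ) (hw : Continuous w) (hw' : ∀ s, ‖w s‖ ≤ 1 + |s|) :
      IntegrableOn (fun s => w s * (u s * G s)) (Set.Iic x) := by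
    refine ((hq.integrableOn_mass hA x).mul_const B).mono'
      (hw.aestronglyMeasurable.mul (hu.mul hG.aestronglyMeasurable)).restrict ?_
    filter_upwards [ae_restrict_mem measurableSet_Iic] with s hs
    rw [norm_mul, norm_mul, ← mul_assoc]
    refine mul_le_mul ?_ (hB s hs) (norm_nonneg _) (mass_nonneg A q₀ s)
    exact (mul_le_mul_of_nonneg_right (hw' s) (norm_nonneg _)).trans (hle s)
  refine ⟨?_, h1 (fun s => (s : ℂ)) (by fun_prop) fun s => ?_⟩
  · simpa using h1 (fun _ => 1) continuous_const (fun s => by simp)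
  · rw [Complex.norm_real, Real.norm_eq_abs]; linarith

theorem integrableOn_q_mul_jostF (hA : 0 < A) (hq : IsStepLike A q₀) (j i : Fin 2)
    (hη : 0 ≤ η.im) (x : ℝ) :
    IntegrableOn (fun s => q₀ s * jostF A q₀ j η s i) (Set.Iic x) ∧
      IntegrableOn (fun s : ℝ => (s : ℂ) * (q₀ s * jostF A q₀ j η s i)) (Set.Iic x) :=
  integrableOn_mul_of_le_mass hA hq hq.aestronglyMeasurable (norm_le_mass_left A q₀)
    ((continuous_apply i).comp (continuous_jostF hA hq j hη))
    (fun x => (norm_jostF_le hA hq j x).imp fun _ hB s hs =>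
      (norm_le_pi_norm _ i).trans (hB η hη s hs)) x

theorem integrableOn_r_mul_jostF (hA : 0 < A) (hq : IsStepLike A q₀) (j i : Fin 2)
    (hη : 0 ≤ η.im) (x : ℝ) :
    IntegrableOn (fun s => ((A : ℂ) - (starRingEnd ℂ) (q₀ (-s))) * jostF A q₀ j η s i)
      (Set.Iic x) :=
  (integrableOn_mul_of_le_mass hA hq
    (aestronglyMeasurable_const.sub hq.aestronglyMeasurable_conj_neg) (norm_le_mass_right A q₀)
    ((continuous_apply i).comp (continuous_jostF hA hq j hη))
    (fun x => (norm_jostF_le hA hq j x).imp fun _ hB s hs =>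
      (norm_le_pi_norm _ i).trans (hB η hη s hs)) x).1

theorem jostF_apply (hA : 0 < A) (hq : IsStepLike A q₀) (j i : Fin 2) (hη : 0 ≤ η.im) (x : ℝ) :
    jostF A q₀ j η x i = jostFree A j η i +
      ∫ s in Set.Iic x, (jostKernel A q₀ j η x s).mulVec (jostF A q₀ j η s) i := by
  have h := isVolterra_jost hA hq j x
  have h1 := congrFun (h.sol_eq (ξ := η) hη le_rfl) i
  have h2 := (ContinuousLinearMap.proj (R := ℂ) (φ := fun _ : Fin 2 => ℂ) i).integral_comp_comm
    (h.integrable_sol (ξ := η) hη le_rfl)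
  rw [jostF, h1, Pi.add_apply]
  congr 1
  exact h2.symm

theorem jostF_apply_zero (hA : 0 < A) (hq : IsStepLike A q₀) (j : Fin 2) (hη : 0 ≤ η.im) (x : ℝ) :
    jostF A q₀ j η x 0 = jostFree A j η 0 + ∫ s in Set.Iic x,
      Complex.exp (rate j η * ((x - s : ℝ) : ℂ)) * (q₀ s * jostF A q₀ j η s 1) := by
  rw [jostF_apply hA hq j 0 hη]
  simp only [jostKernel_mulVec_zero]

theorem jostF_apply_one (hA : 0 < A) (hq : IsStepLike A q₀) (j : Fin 2) (hη : 0 ≤ η.im) (x : ℝ) :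
    jostF A q₀ j η x 1 = jostFree A j η 1 +
      ((∫ s in Set.Iic x, Complex.exp (rate (1 - j) η * ((x - s : ℝ) : ℂ)) *
        (((A : ℂ) - (starRingEnd ℂ) (q₀ (-s))) * jostF A q₀ j η s 0)) -
      A * ∫ s in Set.Iic x, expInt η (x - s) * (q₀ s * jostF A q₀ j η s 1)) := by
  rw [jostF_apply hA hq j 1 hη]
  simp only [jostKernel_mulVec_one]
  rw [integral_sub, integral_const_mul]
  · exact integrableOn_exp_mul (integrableOn_r_mul_jostF hA hq j 0 hη)
      (rate_re_nonpos (1 - j) hη) x x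
  · exact (integrableOn_expInt_mul (fun x => (integrableOn_q_mul_jostF hA hq j 1 hη x).1)
      (fun x => (integrableOn_q_mul_jostF hA hq j 1 hη x).2) hη x).const_mul _

/-- The first row of the differential equation for `F = e^{iηx} φ`. -/
theorem isPrim_jostF_zero (hA : 0 < A) (hq : IsStepLike A q₀) (j : Fin 2) (hη : 0 ≤ η.im) :
    IsPrim (fun x => jostF A q₀ j η x 0)
      (fun x => rate j η * jostF A q₀ j η x 0 + q₀ x * jostF A q₀ j η x 1) := by
  have h1 := (IsPrim.const (jostFree A j η 0)).add
    (isPrim_expConv (fun x => (integrableOn_q_mul_jostF hA hq j 1 hη x).1) (rate_re_nonpos j hη))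
  simp only [← jostF_apply_zero hA hq j hη] at h1
  refine h1.congr_right fun x => ?_
  have h2 : rate j η * jostFree A j η 0 = 0 := by
    rcases fin_two_eq j with rfl | rfl
    · simp [rate]
    · rw [jostFree_one_zero, mul_zero]
  rw [jostF_apply_zero hA hq j hη x]
  linear_combination -h2

/-- The second row of the differential equation for `F = e^{iηx} φ`. The background terms with `A`
in the Volterra equation cancel, since the free term is itself a solution of the background
equation. -/
theorem isPrim_jostF_one (hA : 0 < A) (hq : IsStepLike A q₀) (j : Fin 2) (hη : 0 ≤ η.im) :
    IsPrim (fun x => jostF A q₀ j η x 1) (fun x => rate (1 - j) η * jostF A q₀ j η x 1 -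
      (starRingEnd ℂ) (q₀ (-x)) * jostF A q₀ j η x 0) := by
  have hg x := (integrableOn_q_mul_jostF hA hq j 1 hη x).1
  have hg' x := (integrableOn_q_mul_jostF hA hq j 1 hη x).2
  have h1 := (IsPrim.const (jostFree A j η 1)).add ((isPrim_expConv
    (integrableOn_r_mul_jostF hA hq j 0 hη) (rate_re_nonpos (1 - j) hη)).sub
    ((isPrim_expIntConv hg hg' hη).const_mul A))
  simp only [← jostF_apply_one hA hq j hη] at h1
  refine h1.congr_right fun x => ?_
  have h2 := mul_expIntConv hg hη x
  have h3 := jostF_apply_zero hA hq j hη x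
  have h4 := jostF_apply_one hA hq j hη x
  rcases fin_two_eq j with rfl | rfl
  · have e1 : rate (1 - 0) η = 2 * Complex.I * η := by simp [rate]
    have e2 : rate 0 η = 0 := by simp [rate]
    rw [e1] at h4 ⊢
    simp only [e2, zero_mul, Complex.exp_zero, one_mul] at h3
    rw [jostFree_zero_zero] at h3
    rw [jostFree_zero_one] at h4
    have h5 : 2 * Complex.I * η * ((A : ℂ) / (2 * Complex.I) / (η + Complex.I)) =
        A * (η / (η + Complex.I)) := by
      have := Complex.I_ne_zero
      field_simp
    linear_combination (-2 * Complex.I * η) * h4 + A * h3 + (-1 : ℂ) * h5 + A * h2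
  · have e1 : rate (1 - 1) η = 0 := by simp [rate]
    have e2 : rate 1 η = 2 * Complex.I * η := by simp [rate]
    rw [e1] at h4 ⊢
    rw [e2, jostFree_one_zero] at h3
    linear_combination A * h3

/-- The factor between `jostF` and the Jost solution. For `j = 0` it has a pole at `η = 0`, where
its value is immaterial. -/
noncomputable def jostScale (j : Fin 2) (η : ℂ) : ℂ := if j = 0 then (η + Complex.I) / η else 1

/-- Column `j` of the Jost solution at `-∞` for `ξ = σⱼ η`. -/
noncomputable def jostPhi (A : ℝ) (q₀ : ℝ → ℂ) (j : Fin 2) (η : ℂ) (x : ℝ) : Fin 2 → ℂ :=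
  (jostScale j η * Complex.exp (-(Complex.I * η) * x)) • jostF A q₀ j η x

theorem IsStepLike.integrableOn_left (hA : 0 < A) (hq : IsStepLike A q₀) (x : ℝ) :
    IntegrableOn q₀ (Set.Iic x) := by
  simpa using (integrableOn_mul_of_le_mass hA hq hq.aestronglyMeasurable (norm_le_mass_left A q₀)
    continuous_const (fun _ => ⟨‖(1 : ℂ)‖, fun s _ => le_rfl⟩) x).1

theorem IsStepLike.integrableOn_right (hA : 0 < A) (hq : IsStepLike A q₀) (x : ℝ) :
    IntegrableOn (fun s => (A : ℂ) - (starRingEnd ℂ) (q₀ (-s))) (Set.Iic x) := by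
  simpa using (integrableOn_mul_of_le_mass hA hq
    (aestronglyMeasurable_const.sub hq.aestronglyMeasurable_conj_neg) (norm_le_mass_right A q₀)
    continuous_const (fun _ => ⟨‖(1 : ℂ)‖, fun s _ => le_rfl⟩) x).1

theorem IsStepLike.intervalIntegrable (hA : 0 < A) (hq : IsStepLike A q₀) (x y : ℝ) :
    IntervalIntegrable q₀ volume x y :=
  (IsPrim.integral_Iic (hq.integrableOn_left hA)).1 x y

theorem IsStepLike.intervalIntegrable_conj_neg (hA : 0 < A) (hq : IsStepLike A q₀) (x y : ℝ) :
    IntervalIntegrable (fun s => (starRingEnd ℂ) (q₀ (-s))) volume x y := by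
  have h1 := (IsPrim.integral_Iic (hq.integrableOn_right hA)).1 x y
  simpa using (intervalIntegrable_const (c := (A : ℂ))).sub h1

/-- Solutions of the Lax system, by components. -/
theorem isLaxSolution_iff (hA : 0 < A) (hq : IsStepLike A q₀) (ξ : ℂ) (φ : ℝ → Fin 2 → ℂ) :
    IsLaxSolution q₀ ξ φ ↔
      IsPrim (fun x => φ x 0) (fun x => -(Complex.I * ξ) * φ x 0 + q₀ x * φ x 1) ∧
      IsPrim (fun x => φ x 1)
        (fun x => -(starRingEnd ℂ) (q₀ (-x)) * φ x 0 + Complex.I * ξ * φ x 1) := by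
  have hM (s : ℝ) : (laxM q₀ ξ s).mulVec (φ s) =
      ![-(Complex.I * ξ) * φ s 0 + q₀ s * φ s 1,
        -(starRingEnd ℂ) (q₀ (-s)) * φ s 0 + Complex.I * ξ * φ s 1] := by
    funext i
    fin_cases i <;> simp [laxM, Matrix.mulVec, dotProduct, Fin.sum_univ_two]
  have hint0 (hc : Continuous φ) (x y : ℝ) : IntervalIntegrable
      (fun x => -(Complex.I * ξ) * φ x 0 + q₀ x * φ x 1) volume x y :=
    (Continuous.intervalIntegrable (by fun_prop) x y).add
      ((hq.intervalIntegrable hA x y).mul_continuousOn (by fun_prop))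
  have hint1 (hc : Continuous φ) (x y : ℝ) : IntervalIntegrable
      (fun x => -(starRingEnd ℂ) (q₀ (-x)) * φ x 0 + Complex.I * ξ * φ x 1) volume x y :=
    ((hq.intervalIntegrable_conj_neg hA x y).neg.mul_continuousOn (by fun_prop)).add
      (Continuous.intervalIntegrable (by fun_prop) x y)
  have hvec (hc : Continuous φ) (x y : ℝ) :
      IntervalIntegrable (fun s => (laxM q₀ ξ s).mulVec (φ s)) volume x y := by
    rw [intervalIntegrable_iff]
    refine Integrable.of_eval fun i => ?_
    simp only [hM]
    fin_cases i
    · exact (intervalIntegrable_iff.1 (hint0 hc x y))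
    · exact (intervalIntegrable_iff.1 (hint1 hc x y))
  have hcomp (hc : Continuous φ) (x y : ℝ) (i : Fin 2) :
      (∫ s in x..y, (laxM q₀ ξ s).mulVec (φ s)) i =
        ∫ s in x..y, (laxM q₀ ξ s).mulVec (φ s) i :=
    ((ContinuousLinearMap.proj (R := ℝ) (φ := fun _ : Fin 2 => ℂ) i).intervalIntegral_comp_comm
      (hvec hc x y)).symm
  constructor
  · rintro ⟨hc, h⟩
    refine ⟨⟨hint0 hc, fun x y => ?_⟩, ⟨hint1 hc, fun x y => ?_⟩⟩
    · have h1 := congrFun (h x y) 0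
      rw [hcomp hc] at h1
      simpa [hM] using h1
    · have h1 := congrFun (h x y) 1
      rw [hcomp hc] at h1
      simpa [hM] using h1
  · rintro ⟨h0, h1⟩
    have hc : Continuous φ := by
      refine continuous_pi fun i => ?_
      rcases fin_two_eq i with rfl | rfl
      exacts [h0.continuous, h1.continuous]
    refine ⟨hc, fun x y => ?_⟩
    funext i
    rw [hcomp hc, Pi.sub_apply]
    simp only [hM]
    rcases fin_two_eq i with rfl | rfl
    · simpa using h0.2 x y
    · simpa using h1.2 x y

theorem sigma3_mul_self (j : Fin 2) : sigma3 j * sigma3 j = 1 := by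
  rcases fin_two_eq j with rfl | rfl <;> simp [sigma3]

theorem isLaxSolution_jostPhi (hA : 0 < A) (hq : IsStepLike A q₀) (j : Fin 2) (hη : 0 ≤ η.im) :
    IsLaxSolution q₀ (sigma3 j * η) (jostPhi A q₀ j η) := by
  rw [isLaxSolution_iff hA hq]
  have he : IsPrim (fun x : ℝ => jostScale j η * Complex.exp (-(Complex.I * η) * x))
      fun x => -(Complex.I * η) * (jostScale j η * Complex.exp (-(Complex.I * η) * x)) := by
    refine IsPrim.of_hasDerivAt (fun x => ?_) (by fun_prop)
    have := (((hasDerivAt_id (x : ℂ)).const_mul (-(Complex.I * η))).cexp.comp_ofReal).const_mul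
      (jostScale j η)
    refine this.congr_deriv ?_
    simp only [id]
    ring
  have e0 : rate j η - Complex.I * η = -(Complex.I * (sigma3 j * η)) := by
    rcases fin_two_eq j with rfl | rfl <;> (simp [rate, sigma3]; try ring)
  have e1 : rate (1 - j) η - Complex.I * η = Complex.I * (sigma3 j * η) := by
    rcases fin_two_eq j with rfl | rfl <;> (simp [rate, sigma3]; try ring)
  refine ⟨(he.mul (isPrim_jostF_zero hA hq j hη)).congr_right fun x => ?_,
    (he.mul (isPrim_jostF_one hA hq j hη)).congr_right fun x => ?_⟩
  · rw [← e0]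
    simp only [jostPhi, Pi.smul_apply, smul_eq_mul]
    ring
  · rw [← e1]
    simp only [jostPhi, Pi.smul_apply, smul_eq_mul]
    ring

theorem isJostColumn_jostPhi (hA : 0 < A) (hq : IsStepLike A q₀) (hη : 0 ≤ η.im)
    (h0 : j = 0 → η ≠ 0) :
    IsJostColumn q₀ (sigma3 j * η) atBot (Lminus A (sigma3 j * η)) j (jostPhi A q₀ j η) := by
  refine ⟨isLaxSolution_jostPhi hA hq j hη, ?_⟩
  have h1 := ((isVolterra_jost hA hq j 0).tendsto_sol_atBot (ξ := η) hη).const_smul (jostScale j η)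
  have h2 : jostScale j η • jostFree A j η = fun i => Lminus A (sigma3 j * η) i j := by
    funext i
    rw [Pi.smul_apply, smul_eq_mul]
    rcases fin_two_eq j with rfl | rfl <;> rcases fin_two_eq i with rfl | rfl
    · have := add_I_ne_zero hη
      have := h0 rfl
      simp only [jostScale, jostFree_zero_zero, Lminus, if_true, Matrix.of_apply,
        Matrix.cons_val', Matrix.cons_val_zero, Matrix.cons_val_fin_one]
      field_simp
    · have := add_I_ne_zero hη
      have := h0 rfl
      simp only [jostScale, jostFree_zero_one, Lminus, sigma3, if_true, Matrix.of_apply,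
        Matrix.cons_val', Matrix.cons_val_zero, Matrix.cons_val_one, Matrix.cons_val_fin_one]
      field_simp
    · rw [jostFree_one_zero, mul_zero]; simp [Lminus]
    · rw [jostFree_one_one]; simp [jostScale, Lminus]
  rw [h2] at h1
  refine h1.congr fun x => ?_
  rw [jostPhi, smul_smul, mul_left_comm, ← Complex.exp_add,
    show sigma3 j * Complex.I * (sigma3 j * η) * x + -(Complex.I * η) * x =
      (sigma3 j * sigma3 j - 1) * (Complex.I * η * x) by ring, sigma3_mul_self, sub_self,
    zero_mul, Complex.exp_zero, mul_one]
  rfl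

end Jost

/-! ### Uniqueness, Wronskians and the reflection `φ(x, ξ) ↦ conj φ(-x, -conj ξ)` -/

section Unique

variable {A : ℝ} {q₀ : ℝ → ℂ} {ξ : ℂ} {φ ψ : ℝ → Fin 2 → ℂ}

theorem IsLaxSolution.sub_smul (hA : 0 < A) (hq : IsStepLike A q₀) (hφ : IsLaxSolution q₀ ξ φ)
    (hψ : IsLaxSolution q₀ ξ ψ) (c : ℂ) : IsLaxSolution q₀ ξ fun x => ψ x - c • φ x := by
  rw [isLaxSolution_iff hA hq] at hφ hψ ⊢
  refine ⟨(hψ.1.sub (hφ.1.const_mul c)).congr_right fun x => ?_,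
    (hψ.2.sub (hφ.2.const_mul c)).congr_right fun x => ?_⟩ <;>
  · simp only [Pi.sub_apply, Pi.smul_apply, smul_eq_mul]
    ring

theorem norm_laxM_mulVec_le (q₀ : ℝ → ℂ) (ξ : ℂ) (s : ℝ) (v : Fin 2 → ℂ) :
    ‖(laxM q₀ ξ s).mulVec v‖ ≤ (‖ξ‖ + ‖q₀ s‖ + ‖(starRingEnd ℂ) (q₀ (-s))‖) * ‖v‖ := by
  have h0 := norm_le_pi_norm v 0
  have h1 := norm_le_pi_norm v 1
  have hξ := norm_nonneg ξ
  have hq1 := norm_nonneg (q₀ s)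
  have hq2 := norm_nonneg ((starRingEnd ℂ) (q₀ (-s)))
  have hv := norm_nonneg v
  have m1 := mul_le_mul_of_nonneg_left h0 hξ
  have m2 := mul_le_mul_of_nonneg_left h1 hq1
  have m3 := mul_le_mul_of_nonneg_left h0 hq2
  have m4 := mul_le_mul_of_nonneg_left h1 hξ
  have m5 := mul_nonneg hq1 hv
  have m6 := mul_nonneg hq2 hv
  rw [pi_norm_le_iff_of_nonneg (by positivity)]
  intro i
  have hM : (laxM q₀ ξ s).mulVec v i = if i = 0 then -(Complex.I * ξ) * v 0 + q₀ s * v 1 else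
      -(starRingEnd ℂ) (q₀ (-s)) * v 0 + Complex.I * ξ * v 1 := by
    fin_cases i <;> simp [laxM, Matrix.mulVec, dotProduct, Fin.sum_univ_two]
  rw [hM]
  split_ifs
  · refine (norm_add_le _ _).trans ?_
    simp only [norm_mul, norm_neg, Complex.norm_I, one_mul]
    linarith
  · refine (norm_add_le _ _).trans ?_
    simp only [norm_mul, norm_neg, Complex.norm_I, one_mul]
    linarith

/-- A solution that vanishes at one point vanishes: the set of its zeros is open, since on an
interval where the norm of the coefficients has integral at most `1 / 2` the maximum of the
solution is at most half of itself. -/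
theorem IsLaxSolution.eq_zero (hA : 0 < A) (hq : IsStepLike A q₀) (hφ : IsLaxSolution q₀ ξ φ)
    {x₀ : ℝ} (h0 : φ x₀ = 0) (x : ℝ) : φ x = 0 := by
  set m : ℝ → ℝ := fun s => ‖ξ‖ + ‖q₀ s‖ + ‖(starRingEnd ℂ) (q₀ (-s))‖
  have hm (x y : ℝ) : IntervalIntegrable m volume x y :=
    (intervalIntegrable_const.add (hq.intervalIntegrable hA x y).norm).add
      (hq.intervalIntegrable_conj_neg hA x y).norm
  have hopen : IsOpen {x | φ x = 0} := by
    rw [Metric.isOpen_iff]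
    intro z hz
    have hc : Continuous fun y => ∫ s in z..y, m s :=
      intervalIntegral.continuous_primitive hm z
    obtain ⟨δ, hδ, hδ'⟩ := Metric.continuous_iff.1 hc z (1 / 2) (by norm_num)
    refine ⟨δ / 2, by positivity, fun y hy => ?_⟩
    have hball : ∀ t ∈ Set.Icc (z - δ / 2) (z + δ / 2), |∫ s in z..t, m s| ≤ 1 / 2 := by
      intro t ht
      have := hδ' t (by
        rw [Real.dist_eq, abs_lt]; constructor <;> linarith [ht.1, ht.2])
      rw [intervalIntegral.integral_same, Real.dist_eq, sub_zero] at this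
      exact this.le
    have hzI : z ∈ Set.Icc (z - δ / 2) (z + δ / 2) := ⟨by linarith, by linarith⟩
    obtain ⟨t, ht, hmax⟩ := isCompact_Icc.exists_isMaxOn ⟨z, hzI⟩ hφ.1.norm.continuousOn
    have h1 : ‖φ t‖ ≤ |∫ s in z..t, m s * ‖φ t‖| := by
      have h2 := hφ.2 z t
      rw [show φ z = 0 from hz, sub_zero] at h2
      nth_rw 1 [h2]
      refine intervalIntegral.norm_integral_le_abs_of_norm_le ?_ ((hm z t).mul_const _)
      filter_upwards [ae_restrict_mem measurableSet_uIoc] with s hs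
      refine (norm_laxM_mulVec_le q₀ ξ s (φ s)).trans
        (mul_le_mul_of_nonneg_left (hmax ?_) (by positivity))
      exact Set.uIcc_subset_Icc hzI ht (Set.uIoc_subset_uIcc hs)
    rw [intervalIntegral.integral_mul_const, abs_mul, abs_of_nonneg (norm_nonneg (φ t))] at h1
    have h3 : ‖φ t‖ ≤ 0 := by nlinarith [hball t ht, norm_nonneg (φ t)]
    have hyI : y ∈ Set.Icc (z - δ / 2) (z + δ / 2) := by
      rw [Metric.mem_ball, Real.dist_eq, abs_lt] at hy
      exact ⟨by linarith, by linarith⟩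
    exact norm_le_zero_iff.1 ((hmax hyI).trans h3)
  have hclosed : IsClosed {x | φ x = 0} := isClosed_eq hφ.1 continuous_const
  exact ((IsClopen.eq_univ ⟨hclosed, hopen⟩ ⟨x₀, h0⟩).symm ▸ Set.mem_univ x :
    x ∈ {x | φ x = 0})

/-- The Wronskian of two solutions is constant, as the Lax matrix has trace zero. -/
theorem IsLaxSolution.wr_eq (hA : 0 < A) (hq : IsStepLike A q₀) (hφ : IsLaxSolution q₀ ξ φ)
    (hψ : IsLaxSolution q₀ ξ ψ) (x y : ℝ) : wr (φ x) (ψ x) = wr (φ y) (ψ y) := by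
  rw [isLaxSolution_iff hA hq] at hφ hψ
  exact ((hφ.1.mul hψ.2).sub (hφ.2.mul hψ.1)).eq_of_zero (fun x => by ring) x y

theorem wr_smul_smul (a c : ℂ) (u v : Fin 2 → ℂ) : wr (a • u) (c • v) = a * c * wr u v := by
  simp only [wr, Pi.smul_apply, smul_eq_mul]; ring

theorem continuous_wr : Continuous fun p : (Fin 2 → ℂ) × (Fin 2 → ℂ) => wr p.1 p.2 := by
  unfold wr; fun_prop

theorem Lminus_diag (A : ℝ) (ξ : ℂ) (j : Fin 2) : Lminus A ξ j j = 1 := by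
  fin_cases j <;> simp [Lminus]

/-- Jost columns at `-∞` are unique. Two of them have Wronskian `0`, hence are proportional, and
the normalization fixes the factor. -/
theorem IsJostColumn.unique (hA : 0 < A) (hq : IsStepLike A q₀) {j : Fin 2} {η : ℂ}
    (hη : 0 ≤ η.im) {L : Matrix (Fin 2) (Fin 2) ℂ} (hL : L j j = 1)
    (hφ : IsJostColumn q₀ (sigma3 j * η) atBot L j φ)
    (hψ : IsJostColumn q₀ (sigma3 j * η) atBot L j ψ) : ψ = φ := by
  have he (x : ℝ) : sigma3 j * Complex.I * (sigma3 j * η) * x = Complex.I * η * x := by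
    linear_combination (Complex.I * η * x) * sigma3_mul_self j
  obtain ⟨hφ1, hφ2⟩ := hφ
  obtain ⟨hψ1, hψ2⟩ := hψ
  simp only [he] at hφ2 hψ2
  have hwr (x : ℝ) : wr (φ x) (ψ x) = 0 := by
    have h1 := (continuous_wr.tendsto _).comp (hφ2.prodMk_nhds hψ2)
    have h2 : wr (fun i => L i j) (fun i => L i j) = 0 := by simp [wr, mul_comm]
    simp only [h2, Function.comp_def, wr_smul_smul] at h1
    rw [← norm_le_zero_iff]
    refine ge_of_tendsto (by simpa using h1.norm) ?_
    filter_upwards [eventually_le_atBot 0] with y hy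
    rw [hφ1.wr_eq hA hq hψ1 x y]
    have h3 : 1 ≤ ‖Complex.exp (Complex.I * η * y)‖ := by
      rw [Complex.norm_exp]
      refine Real.one_le_exp ?_
      simp
      nlinarith
    refine le_mul_of_one_le_left (norm_nonneg _) ?_
    nlinarith
  have hφj := tendsto_pi_nhds.1 hφ2 j
  have hψj := tendsto_pi_nhds.1 hψ2 j
  simp only [hL, Pi.smul_apply, smul_eq_mul] at hφj hψj
  obtain ⟨x₀, hx₀⟩ := (hφj.eventually_ne one_ne_zero).exists
  have hx₀' : φ x₀ j ≠ 0 := right_ne_zero_of_mul hx₀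
  set c := ψ x₀ j / φ x₀ j with hc
  have hd := (hφ1.sub_smul hA hq hψ1 c).eq_zero hA hq (x₀ := x₀) (by
    have hw := hwr x₀
    unfold wr at hw
    funext i
    rw [Pi.sub_apply, Pi.smul_apply, smul_eq_mul, Pi.zero_apply, hc, sub_eq_zero,
      div_mul_eq_mul_div, eq_div_iff hx₀']
    rcases fin_two_eq j with rfl | rfl <;> rcases fin_two_eq i with rfl | rfl
    · ring
    · linear_combination hw
    · linear_combination -hw
    · ring)
  have hψφ (x : ℝ) : ψ x = c • φ x := sub_eq_zero.1 (hd x)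
  have hc1 : c = 1 := by
    refine tendsto_nhds_unique (f := fun x : ℝ => Complex.exp (Complex.I * η * x) * ψ x j)
      (l := atBot) ?_ hψj
    have := hφj.const_mul c
    rw [mul_one] at this
    refine this.congr fun x => ?_
    rw [hψφ x, Pi.smul_apply, smul_eq_mul]; ring
  funext x
  rw [hψφ x, hc1, one_smul]

theorem phiMinus_eq (hA : 0 < A) (hq : IsStepLike A q₀) {j : Fin 2} {η : ℂ} (hη : 0 ≤ η.im)
    (h0 : j = 0 → η ≠ 0) : phiMinus A q₀ (sigma3 j * η) j = jostPhi A q₀ j η := by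
  have h1 := isJostColumn_jostPhi hA hq hη h0
  exact h1.unique hA hq hη (Lminus_diag _ _ _) (Classical.epsilon_spec ⟨_, h1⟩)

/-- The reflection `Λ conj φ(-x)`, where `Λ` swaps the components. It maps solutions for `ξ` to
solutions for `-conj ξ` and exchanges the Jost solutions at the two ends. -/
noncomputable def reflect (φ : ℝ → Fin 2 → ℂ) (x : ℝ) (i : Fin 2) : ℂ :=
  (starRingEnd ℂ) (φ (-x) (1 - i))

theorem reflect_reflect (φ : ℝ → Fin 2 → ℂ) : reflect (reflect φ) = φ := by
  funext x i
  simp [reflect]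

theorem IsPrim.conj_neg {G g : ℝ → ℂ} (hG : IsPrim G g) :
    IsPrim (fun x => (starRingEnd ℂ) (G (-x))) fun x => -(starRingEnd ℂ) (g (-x)) := by
  have h1 (x y : ℝ) : IntervalIntegrable (fun x => g (-x)) volume x y := by
    simpa using IntervalIntegrable.comp_sub_left (hG.1 (-x) (-y)) 0
  refine ⟨fun x y => ?_, fun x y => ?_⟩
  · exact IntervalIntegrable.neg ⟨Complex.conjCLE.toContinuousLinearMap.integrable_comp (h1 x y).1,
      Complex.conjCLE.toContinuousLinearMap.integrable_comp (h1 x y).2⟩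
  · have h2 : (∫ s in x..y, (starRingEnd ℂ) (g (-s))) =
        (starRingEnd ℂ) (∫ s in x..y, g (-s)) :=
      Complex.conjCLE.toContinuousLinearMap.intervalIntegral_comp_comm (h1 x y)
    rw [intervalIntegral.integral_neg, h2, intervalIntegral.integral_comp_neg, ← hG.2, map_sub]
    ring

theorem IsLaxSolution.reflect (hA : 0 < A) (hq : IsStepLike A q₀) (hφ : IsLaxSolution q₀ ξ φ) :
    IsLaxSolution q₀ (-(starRingEnd ℂ) ξ) (reflect φ) := by
  rw [isLaxSolution_iff hA hq] at hφ ⊢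
  refine ⟨hφ.2.conj_neg.congr_right fun x => ?_, hφ.1.conj_neg.congr_right fun x => ?_⟩ <;>
  · simp only [NonlocalLPD.reflect]
    simp
    try ring

theorem sigma3_one_sub (j : Fin 2) : sigma3 (1 - j) = -sigma3 j := by
  rcases fin_two_eq j with rfl | rfl <;> simp [sigma3]

theorem conj_sigma3 (j : Fin 2) : (starRingEnd ℂ) (sigma3 j) = sigma3 j := by
  rcases fin_two_eq j with rfl | rfl <;> simp [sigma3]

theorem IsJostColumn.reflect (hA : 0 < A) (hq : IsStepLike A q₀) {l l' : Filter ℝ}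
    (hl : Tendsto (fun x : ℝ => -x) l' l) {L L' : Matrix (Fin 2) (Fin 2) ℂ} {j : Fin 2}
    (hL : ∀ i, (starRingEnd ℂ) (L (1 - i) j) = L' i (1 - j)) (hφ : IsJostColumn q₀ ξ l L j φ) :
    IsJostColumn q₀ (-(starRingEnd ℂ) ξ) l' L' (1 - j) (reflect φ) := by
  refine ⟨hφ.1.reflect hA hq, ?_⟩
  rw [tendsto_pi_nhds]
  intro i
  have h1 := (Complex.continuous_conj.tendsto _).comp
    ((tendsto_pi_nhds.1 hφ.2 (1 - i)).comp hl)
  rw [hL] at h1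
  refine h1.congr fun x => ?_
  simp only [Function.comp_apply, Pi.smul_apply, smul_eq_mul, map_mul, ← Complex.exp_conj,
    NonlocalLPD.reflect, conj_sigma3, sigma3_one_sub, Complex.conj_I, Complex.conj_ofReal]
  congr 2
  push_cast
  ring

theorem conj_Lminus (A : ℝ) (ξ : ℂ) (j i : Fin 2) :
    (starRingEnd ℂ) (Lminus A ξ (1 - i) j) = Lplus A (-(starRingEnd ℂ) ξ) i (1 - j) := by
  fin_cases j <;> fin_cases i <;> simp [Lminus, Lplus, Complex.conj_ofNat]

theorem conj_Lplus (A : ℝ) (ξ : ℂ) (j i : Fin 2) :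
    (starRingEnd ℂ) (Lplus A ξ (1 - i) j) = Lminus A (-(starRingEnd ℂ) ξ) i (1 - j) := by
  fin_cases j <;> fin_cases i <;> simp [Lminus, Lplus, Complex.conj_ofNat]

theorem phiPlus_eq (hA : 0 < A) (hq : IsStepLike A q₀) {j : Fin 2} {η : ℂ} (hη : 0 ≤ η.im)
    (h0 : j = 1 → η ≠ 0) :
    phiPlus A q₀ (sigma3 j * (starRingEnd ℂ) η) j = reflect (jostPhi A q₀ (1 - j) η) := by
  have e1 : -(starRingEnd ℂ) (sigma3 (1 - j) * η) = sigma3 j * (starRingEnd ℂ) η := by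
    rw [sigma3_one_sub, map_mul, map_neg, conj_sigma3]; ring
  have e2 : -(starRingEnd ℂ) (sigma3 j * (starRingEnd ℂ) η) = sigma3 (1 - j) * η := by
    rw [sigma3_one_sub, map_mul, conj_sigma3, Complex.conj_conj]; ring
  have h1 := isJostColumn_jostPhi hA hq (j := 1 - j) hη fun h => h0 (by
    rcases fin_two_eq j with rfl | rfl
    · simp at h
    · rfl)
  have h2 : IsJostColumn q₀ (sigma3 j * (starRingEnd ℂ) η) atTop
      (Lplus A (sigma3 j * (starRingEnd ℂ) η)) j (reflect (jostPhi A q₀ (1 - j) η)) := by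
    have := h1.reflect hA hq tendsto_neg_atTop_atBot (conj_Lminus A _ _)
    rwa [e1, sub_sub_cancel] at this
  have h3 := (Classical.epsilon_spec (p := IsJostColumn q₀ (sigma3 j * (starRingEnd ℂ) η) atTop
    (Lplus A (sigma3 j * (starRingEnd ℂ) η)) j) ⟨_, h2⟩).reflect hA hq tendsto_neg_atBot_atTop
      (conj_Lplus A _ _)
  rw [e2] at h3
  have h4 := h1.unique hA hq hη (Lminus_diag _ _ _) h3
  rw [← h4, reflect_reflect]
  rfl

end Unique

/-! ### High-frequency limits -/

/-- A Riemann–Lebesgue lemma in the closed upper half-plane, uniform in a family of absolutely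
continuous factors `S`. The integrable factor `h` is approximated by a smooth function with compact
support, for which one integrates by parts. -/
theorem norm_integral_exp_mul_le {h : ℝ → ℂ} {x : ℝ} (hh : IntegrableOn h (Set.Iic x)) {m : ℝ → ℝ}
    (hm : ∀ a b, IntervalIntegrable m volume a b) (B : ℝ) {ε : ℝ} (hε : 0 < ε) :
    ∃ R > 0, ∀ η : ℂ, 0 ≤ η.im → R ≤ ‖η‖ → ∀ S S' : ℝ → ℂ, IsPrim S S' →
      (∀ s ≤ x, ‖S s‖ ≤ B) → (∀ s ≤ x, ‖S' s‖ ≤ m s) →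
      ‖∫ s in Set.Iic x, Complex.exp (2 * Complex.I * η * ((x - s : ℝ) : ℂ)) * (h s * S s)‖
        ≤ ε := by
  set B' := max B 0 with hB'
  have hB'0 : 0 ≤ B' := le_max_right _ _
  set δ := ε / 2 / (B' + 1) with hδ
  have hδ0 : 0 < δ := by positivity
  have hmem : MemLp ((Set.Iic x).indicator h) 1 volume :=
    memLp_one_iff_integrable.2 ((integrable_indicator_iff measurableSet_Iic).2 hh)
  obtain ⟨g, hgc, hgs, hg⟩ := hmem.exist_eLpNorm_sub_le ENNReal.one_ne_top le_rfl hδ0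
  have hg1 : ContDiff ℝ 1 g := hgs.of_le (by exact_mod_cast le_top)
  have hgi : Integrable g := hg1.continuous.integrable_of_hasCompactSupport hgc
  have hdiff : ∫ s in Set.Iic x, ‖h s - g s‖ ≤ δ := by
    have h1 : ∫ s, ‖((Set.Iic x).indicator h - g) s‖ ≤ δ := by
      rw [eLpNorm_one_eq_lintegral_enorm] at hg
      rw [integral_norm_eq_lintegral_enorm (hmem.aestronglyMeasurable.sub hgi.1)]
      exact ENNReal.toReal_le_of_le_ofReal hδ0.le hg
    have h2 : ∫ s in Set.Iic x, ‖h s - g s‖ =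
        ∫ s in Set.Iic x, ‖((Set.Iic x).indicator h - g) s‖ := by
      refine setIntegral_congr_fun measurableSet_Iic fun s hs => ?_
      simp only [Pi.sub_apply, Set.indicator_of_mem hs]
    rw [h2]
    exact (setIntegral_le_integral (((integrable_indicator_iff measurableSet_Iic).2 hh).sub
      hgi).norm (Eventually.of_forall fun s => norm_nonneg _)).trans h1
  obtain ⟨a, hax, ha⟩ : ∃ a ≤ x, ∀ s ≤ a, g s = 0 := by
    obtain ⟨c, hc⟩ := hgc.isCompact.bddBelow
    refine ⟨min x (c - 1), min_le_left _ _, fun s hs => ?_⟩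
    refine image_eq_zero_of_notMem_tsupport fun hs' => ?_
    have := hc hs'
    have := hs.trans (min_le_right _ _)
    linarith
  have hgd : Continuous (deriv g) := hg1.continuous_deriv le_rfl
  set D := ‖g x‖ * B' + ∫ s in a..x, (‖deriv g s‖ * B' + ‖g s‖ * m s) with hD
  have hDint : IntervalIntegrable (fun s => ‖deriv g s‖ * B' + ‖g s‖ * m s) volume a x :=
    (Continuous.intervalIntegrable (by fun_prop) _ _).add
      ((hm a x).continuousOn_mul hg1.continuous.norm.continuousOn)
  refine ⟨max 1 (D / ε), by positivity, fun η hη hR S S' hS hSB hS'm => ?_⟩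
  have hη1 : 1 ≤ ‖η‖ := (le_max_left _ _).trans hR
  have hηD : D ≤ ‖η‖ * ε := (div_le_iff₀ hε).1 ((le_max_right _ _).trans hR)
  set e : ℝ → ℂ := fun s => Complex.exp (2 * Complex.I * η * ((x - s : ℝ) : ℂ)) with he
  have hec : Continuous e := by fun_prop
  have he1 (s : ℝ) (hs : s ≤ x) : ‖e s‖ ≤ 1 :=
    norm_exp_le_one (by rw [two_I_mul_re]; linarith) (sub_nonneg.2 hs)
  have hSB' (s : ℝ) (hs : s ≤ x) : ‖S s‖ ≤ B' := (hSB s hs).trans (le_max_left _ _)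
  have hbdd (u : ℝ → ℂ) (hu : IntegrableOn u (Set.Iic x)) :
      IntegrableOn (fun s => e s * (u s * S s)) (Set.Iic x) := by
    refine (hu.norm.mul_const B').mono' (hec.aestronglyMeasurable.mul
      (hu.1.mul hS.continuous.aestronglyMeasurable)) ?_
    filter_upwards [ae_restrict_mem measurableSet_Iic] with s hs
    rw [norm_mul, norm_mul]
    exact (mul_le_of_le_one_left (by positivity) (he1 s hs)).trans
      (mul_le_mul_of_nonneg_left (hSB' s hs) (norm_nonneg _))
  have hsplit : ∫ s in Set.Iic x, e s * (h s * S s) =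
      (∫ s in Set.Iic x, e s * ((h s - g s) * S s)) + ∫ s in Set.Iic x, e s * (g s * S s) := by
    refine Eq.trans ?_ (integral_add (hbdd _ (hh.sub hgi.integrableOn)) (hbdd _ hgi.integrableOn))
    congr 1
    funext s
    change e s * (h s * S s) = e s * ((h s - g s) * S s) + e s * (g s * S s)
    ring
  have hfirst : ‖∫ s in Set.Iic x, e s * ((h s - g s) * S s)‖ ≤ ε / 2 := by
    have h1 : ‖∫ s in Set.Iic x, e s * ((h s - g s) * S s)‖ ≤
        ∫ s in Set.Iic x, ‖h s - g s‖ * B' := by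
      refine norm_integral_le_of_norm_le ((hh.sub hgi.integrableOn).norm.mul_const B') ?_
      filter_upwards [ae_restrict_mem measurableSet_Iic] with s hs
      rw [norm_mul, norm_mul]
      exact (mul_le_of_le_one_left (by positivity) (he1 s hs)).trans
        (mul_le_mul_of_nonneg_left (hSB' s hs) (norm_nonneg _))
    rw [integral_mul_const] at h1
    have h2 : δ * B' ≤ ε / 2 := by
      rw [hδ, div_mul_eq_mul_div, div_le_iff₀ (by positivity)]
      nlinarith
    exact h1.trans ((mul_le_mul_of_nonneg_right hdiff hB'0).trans h2)
  have hsecond : ‖∫ s in Set.Iic x, e s * (g s * S s)‖ ≤ ε / 2 := by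
    have h1 : ∫ s in Set.Iic x, e s * (g s * S s) = ∫ s in a..x, e s * (g s * S s) := by
      rw [← intervalIntegral.integral_Iic_sub_Iic
        ((hbdd _ hgi.integrableOn).mono_set (Set.Iic_subset_Iic.2 hax)) (hbdd _ hgi.integrableOn)]
      have h0 : ∫ s in Set.Iic a, e s * (g s * S s) = 0 :=
        setIntegral_eq_zero_of_forall_eq_zero fun s hs => by rw [ha s hs, zero_mul, mul_zero]
      rw [h0, sub_zero]
    have hge : IsPrim g (deriv g) := IsPrim.of_hasDerivAt
      (fun s => (hg1.differentiable one_ne_zero s).hasDerivAt) hgd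
    have hee : IsPrim e fun s => -(2 * Complex.I * η) * e s := by
      refine IsPrim.of_hasDerivAt (fun s => ?_) (by fun_prop)
      have h2 : HasDerivAt (fun s : ℝ => 2 * Complex.I * η * ((x - s : ℝ) : ℂ))
          (2 * Complex.I * η * (((-1 : ℝ)) : ℂ)) s :=
        (((hasDerivAt_id s).const_sub x).ofReal_comp).const_mul _
      refine h2.cexp.congr_deriv ?_
      simp only [he]
      push_cast
      ring
    have hprod := (hee.mul (hge.mul hS))
    have h2 := hprod.2 a x
    have hI1 : IntervalIntegrable (fun s => e s * (g s * S s)) volume a x :=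
      (hec.mul (hg1.continuous.mul hS.continuous)).intervalIntegrable _ _
    have hI2 : IntervalIntegrable (fun s => e s * (deriv g s * S s + g s * S' s)) volume a x :=
      ((hge.mul hS).1 a x).continuousOn_mul hec.continuousOn
    have h3 : (∫ s in a..x, (-(2 * Complex.I * η) * e s * (g s * S s) +
        e s * (deriv g s * S s + g s * S' s))) =
        -(2 * Complex.I * η) * (∫ s in a..x, e s * (g s * S s)) +
          ∫ s in a..x, e s * (deriv g s * S s + g s * S' s) := by
      rw [← intervalIntegral.integral_const_mul, ← intervalIntegral.integral_add
        (hI1.const_mul _) hI2]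
      congr 1
      funext s
      ring
    simp only [h3, ha a le_rfl, zero_mul, mul_zero, sub_zero] at h2
    have h4 : ‖∫ s in a..x, e s * (deriv g s * S s + g s * S' s)‖ ≤
        ∫ s in a..x, (‖deriv g s‖ * B' + ‖g s‖ * m s) := by
      refine intervalIntegral.norm_integral_le_of_norm_le hax (Eventually.of_forall fun s hs => ?_)
        hDint
      rw [norm_mul]
      refine (mul_le_of_le_one_left (norm_nonneg _) (he1 s hs.2)).trans ((norm_add_le _ _).trans ?_)
      rw [norm_mul, norm_mul]
      exact add_le_add (mul_le_mul_of_nonneg_left (hSB' s hs.2) (norm_nonneg _))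
        (mul_le_mul_of_nonneg_left (hS'm s hs.2) (norm_nonneg _))
    have h5 : ‖e x * (g x * S x)‖ ≤ ‖g x‖ * B' := by
      rw [norm_mul, norm_mul]
      exact (mul_le_of_le_one_left (by positivity) (he1 x le_rfl)).trans
        (mul_le_mul_of_nonneg_left (hSB' x le_rfl) (norm_nonneg _))
    have h6 : ‖2 * Complex.I * η * ∫ s in a..x, e s * (g s * S s)‖ ≤ D := by
      have h7 : 2 * Complex.I * η * ∫ s in a..x, e s * (g s * S s) =
          (∫ s in a..x, e s * (deriv g s * S s + g s * S' s)) - e x * (g x * S x) := by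
        linear_combination h2
      rw [h7, hD]
      exact (norm_sub_le _ _).trans (by linarith)
    rw [h1]
    simp only [norm_mul, Complex.norm_ofNat, Complex.norm_I, mul_one] at h6
    nlinarith [norm_nonneg (∫ s in a..x, e s * (g s * S s))]
  rw [hsplit]
  exact (norm_add_le _ _).trans (by linarith)

/-- Neighbourhoods of infinity in the closed upper half-plane. -/
noncomputable def upperInfty : Filter ℂ := comap norm atTop ⊓ 𝓟 {η : ℂ | 0 ≤ η.im}

instance : upperInfty.IsCountablyGenerated := by unfold upperInfty; infer_instance

theorem eventually_upperInfty_im : ∀ᶠ η in upperInfty, 0 ≤ η.im :=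
  mem_inf_of_right (mem_principal_self _)

theorem tendsto_norm_upperInfty : Tendsto (fun η : ℂ => ‖η‖) upperInfty atTop :=
  tendsto_comap.mono_left inf_le_left

theorem tendsto_neg_conj_upperInfty :
    Tendsto (fun η : ℂ => -(starRingEnd ℂ) η) upperInfty upperInfty := by
  refine tendsto_inf.2 ⟨tendsto_comap_iff.2 ?_, tendsto_principal.2 ?_⟩
  · refine tendsto_norm_upperInfty.congr fun η => ?_
    simp
  · filter_upwards [eventually_upperInfty_im] with η hη
    simpa using hη

section Limits

variable {A : ℝ} {q₀ : ℝ → ℂ}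

theorem tendsto_expInt_conv {u : ℝ → ℂ} {G : ℂ → ℝ → ℂ} {x B : ℝ} (hu : IntegrableOn u (Set.Iic x))
    (hG : ∀ η : ℂ, 0 ≤ η.im → ∀ s ≤ x, ‖G η s‖ ≤ B) :
    Tendsto (fun η => ∫ s in Set.Iic x, expInt η (x - s) * (u s * G η s)) upperInfty (𝓝 0) := by
  rw [tendsto_zero_iff_norm_tendsto_zero]
  have h1 : Tendsto (fun η : ℂ => 1 / ‖η‖ * ∫ s in Set.Iic x, ‖u s‖ * B) upperInfty (𝓝 0) := by
    have := (tendsto_inv_atTop_zero.comp tendsto_norm_upperInfty).mul_const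
      (∫ s in Set.Iic x, ‖u s‖ * B)
    simpa [Function.comp_def] using this
  refine squeeze_zero' (Eventually.of_forall fun _ => norm_nonneg _) ?_ h1
  filter_upwards [eventually_upperInfty_im, tendsto_norm_upperInfty.eventually_gt_atTop 0]
    with η hη hpos
  rw [← integral_const_mul]
  refine norm_integral_le_of_norm_le ((hu.norm.mul_const B).const_mul _) ?_
  filter_upwards [ae_restrict_mem measurableSet_Iic] with s hs
  rw [norm_mul, norm_mul]
  exact mul_le_mul (norm_expInt_le_inv hη (norm_pos_iff.1 hpos) (sub_nonneg.2 hs))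
    (mul_le_mul_of_nonneg_left (hG η hη s hs) (norm_nonneg _)) (by positivity) (by positivity)

theorem tendsto_exp_conv {h : ℝ → ℂ} {m : ℝ → ℝ} {S S' : ℂ → ℝ → ℂ} {x B : ℝ}
    (hh : IntegrableOn h (Set.Iic x)) (hm : ∀ a b, IntervalIntegrable m volume a b)
    (hS : ∀ η : ℂ, 0 ≤ η.im → IsPrim (S η) (S' η))
    (hSB : ∀ η : ℂ, 0 ≤ η.im → ∀ s ≤ x, ‖S η s‖ ≤ B)
    (hS'm : ∀ η : ℂ, 0 ≤ η.im → ∀ s ≤ x, ‖S' η s‖ ≤ m s) :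
    Tendsto (fun η => ∫ s in Set.Iic x, Complex.exp (2 * Complex.I * η * ((x - s : ℝ) : ℂ)) *
      (h s * S η s)) upperInfty (𝓝 0) := by
  rw [tendsto_zero_iff_norm_tendsto_zero, Metric.tendsto_nhds]
  intro ε hε
  obtain ⟨R, -, hR⟩ := norm_integral_exp_mul_le hh hm B (half_pos hε)
  filter_upwards [eventually_upperInfty_im, tendsto_norm_upperInfty.eventually_ge_atTop R]
    with η hη hRη
  have := hR η hη hRη (S η) (S' η) (hS η hη) (hSB η hη) (hS'm η hη)
  rw [Real.dist_eq, sub_zero, abs_norm]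
  linarith

/-- The component that oscillates relative to the background tends to `0`. -/
theorem tendsto_jostF_off (hA : 0 < A) (hq : IsStepLike A q₀) (j : Fin 2) (x : ℝ) :
    Tendsto (fun η => jostF A q₀ j η x (1 - j)) upperInfty (𝓝 0) := by
  obtain ⟨B, hB⟩ := norm_jostF_le hA hq j x
  have hBi (i : Fin 2) : ∀ η : ℂ, 0 ≤ η.im → ∀ s ≤ x, ‖jostF A q₀ j η s i‖ ≤ B :=
    fun η hη s hs => (norm_le_pi_norm _ i).trans (hB η hη s hs)
  have hq1 := hq.integrableOn_left hA x
  have hq2 := hq.integrableOn_right hA x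
  rcases fin_two_eq j with rfl | rfl
  · have h1 : Tendsto (fun η => jostFree A 0 η 1) upperInfty (𝓝 0) := by
      simp only [jostFree_zero_one]
      have h2 : Tendsto (fun η : ℂ => ‖η + Complex.I‖) upperInfty atTop := by
        refine tendsto_atTop_mono' _ ?_ tendsto_norm_upperInfty
        filter_upwards [eventually_upperInfty_im] with η hη using norm_le_norm_add_I hη
      rw [tendsto_zero_iff_norm_tendsto_zero]
      simp only [norm_div]
      exact h2.const_div_atTop _
    have h2 := tendsto_exp_conv (S := fun η s => jostF A q₀ 0 η s 0)
      (m := fun s => ‖q₀ s‖ * B) hq2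
      (fun a b => (hq.intervalIntegrable hA a b).norm.mul_const B)
      (fun η hη => isPrim_jostF_zero hA hq 0 hη) (hBi 0) (fun η hη s hs => by
        simp only [rate, if_true, zero_mul, zero_add, norm_mul]
        exact mul_le_mul_of_nonneg_left (hBi 1 η hη s hs) (norm_nonneg _))
    have h3 := (tendsto_expInt_conv hq1 (hBi 1)).const_mul (A : ℂ)
    have h4 := h1.add (h2.sub h3)
    rw [mul_zero, sub_zero, add_zero] at h4
    refine h4.congr' ?_
    filter_upwards [eventually_upperInfty_im] with η hη
    rw [sub_zero, jostF_apply_one hA hq 0 hη]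
    simp [rate]
  · have h2 := tendsto_exp_conv (S := fun η s => jostF A q₀ 1 η s 1)
      (m := fun s => ‖(starRingEnd ℂ) (q₀ (-s))‖ * B) hq1
      (fun a b => (hq.intervalIntegrable_conj_neg hA a b).norm.mul_const B)
      (fun η hη => isPrim_jostF_one hA hq 1 hη) (hBi 1) (fun η hη s hs => by
        simp only [sub_self, rate, if_true, zero_mul, zero_sub, norm_neg, norm_mul]
        exact mul_le_mul_of_nonneg_left (hBi 0 η hη s hs) (norm_nonneg _))
    refine h2.congr' ?_
    filter_upwards [eventually_upperInfty_im] with η hη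
    rw [sub_self, jostF_apply_zero hA hq 1 hη, jostFree_one_zero]
    simp [rate]

theorem tendsto_setIntegral_mul {u : ℝ → ℂ} {G : ℂ → ℝ → ℂ} {x B : ℝ}
    (hu : IntegrableOn u (Set.Iic x)) (hGc : ∀ η : ℂ, 0 ≤ η.im → Continuous (G η))
    (hG : ∀ η : ℂ, 0 ≤ η.im → ∀ s ≤ x, ‖G η s‖ ≤ B)
    (h0 : ∀ s, Tendsto (fun η => G η s) upperInfty (𝓝 0)) :
    Tendsto (fun η => ∫ s in Set.Iic x, u s * G η s) upperInfty (𝓝 0) := by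
  have h1 := tendsto_integral_filter_of_dominated_convergence (l := upperInfty)
    (μ := volume.restrict (Set.Iic x)) (F := fun η s => u s * G η s) (f := fun _ => (0 : ℂ))
    (fun s => ‖u s‖ * B) ?_ ?_ (hu.norm.mul_const B) ?_
  · simpa using h1
  · filter_upwards [eventually_upperInfty_im] with η hη
    exact hu.1.mul (hGc η hη).aestronglyMeasurable
  · filter_upwards [eventually_upperInfty_im] with η hη
    filter_upwards [ae_restrict_mem measurableSet_Iic] with s hs
    rw [norm_mul]
    exact mul_le_mul_of_nonneg_left (hG η hη s hs) (norm_nonneg _)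
  · refine Eventually.of_forall fun s => ?_
    simpa using (h0 s).const_mul (u s)

theorem tendsto_jostF_diag (hA : 0 < A) (hq : IsStepLike A q₀) (j : Fin 2) (x : ℝ) :
    Tendsto (fun η => jostF A q₀ j η x j) upperInfty (𝓝 1) := by
  obtain ⟨B, hB⟩ := norm_jostF_le hA hq j x
  have hBi (i : Fin 2) : ∀ η : ℂ, 0 ≤ η.im → ∀ s ≤ x, ‖jostF A q₀ j η s i‖ ≤ B :=
    fun η hη s hs => (norm_le_pi_norm _ i).trans (hB η hη s hs)
  have hc (i : Fin 2) : ∀ η : ℂ, 0 ≤ η.im → Continuous fun s => jostF A q₀ j η s i :=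
    fun η hη => (continuous_apply i).comp (continuous_jostF hA hq j hη)
  have hq1 := hq.integrableOn_left hA x
  have hq2 := hq.integrableOn_right hA x
  rcases fin_two_eq j with rfl | rfl
  · have h1 : Tendsto (fun η => jostFree A 0 η 0) upperInfty (𝓝 1) := by
      simp only [jostFree_zero_zero]
      have h2 : Tendsto (fun η : ℂ => ‖η + Complex.I‖) upperInfty atTop := by
        refine tendsto_atTop_mono' _ ?_ tendsto_norm_upperInfty
        filter_upwards [eventually_upperInfty_im] with η hη using norm_le_norm_add_I hη
      have h3 : Tendsto (fun η : ℂ => Complex.I / (η + Complex.I)) upperInfty (𝓝 0) := by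
        rw [tendsto_zero_iff_norm_tendsto_zero]
        simp only [norm_div]
        exact h2.const_div_atTop _
      have h4 := h3.const_sub 1
      rw [sub_zero] at h4
      refine h4.congr' ?_
      filter_upwards [eventually_upperInfty_im] with η hη
      have := add_I_ne_zero hη
      field_simp
      ring
    have h2 := tendsto_setIntegral_mul hq1 (hc 1) (hBi 1) (tendsto_jostF_off hA hq 0)
    have h3 := h1.add h2
    rw [add_zero] at h3
    refine h3.congr' ?_
    filter_upwards [eventually_upperInfty_im] with η hη
    rw [jostF_apply_zero hA hq 0 hη]
    simp [rate]
  · have h2 := tendsto_setIntegral_mul hq2 (hc 0) (hBi 0) (tendsto_jostF_off hA hq 1)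
    have h3 := (tendsto_expInt_conv hq1 (hBi 1)).const_mul (A : ℂ)
    have h4 := (h2.sub h3).const_add 1
    rw [mul_zero, sub_zero, add_zero] at h4
    refine h4.congr' ?_
    filter_upwards [eventually_upperInfty_im] with η hη
    rw [jostF_apply_one hA hq 1 hη, jostFree_one_one]
    simp [rate]

end Limits

/-! ### Scattering coefficients -/

section Scattering

variable {A : ℝ} {q₀ : ℝ → ℂ}

theorem continuousOn_jostF (hA : 0 < A) (hq : IsStepLike A q₀) (j i : Fin 2) :
    ContinuousOn (fun η => jostF A q₀ j η 0 i) {η | 0 ≤ η.im} := by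
  have h1 := (isVolterra_jost hA hq j 0).continuousOn_sol
  have h2 : ContinuousOn (fun η => jostF A q₀ j η 0) {η | 0 ≤ η.im} :=
    h1.comp (f := fun η : ℂ => (η, (0 : ℝ))) (by fun_prop) fun s hs => ⟨hs, Set.mem_Iic.2 le_rfl⟩
  exact continuousOn_pi.1 h2 i

theorem isOpen_im_pos : IsOpen {η : ℂ | 0 < η.im} :=
  isOpen_lt continuous_const Complex.continuous_im

theorem differentiableOn_jostF (hA : 0 < A) (hq : IsStepLike A q₀) (j i : Fin 2) :
    DifferentiableOn ℂ (fun η => jostF A q₀ j η 0 i) {η | 0 < η.im} := by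
  have hsub : {η : ℂ | 0 < η.im} ⊆ {η | 0 ≤ η.im} :=
    fun η (hη : 0 < η.im) => hη.le
  refine differentiableOn_pi.1 ((isVolterra_jost hA hq j 0).differentiableOn_sol isOpen_im_pos
    hsub ((differentiableOn_jostFree A j).mono hsub) (fun x _ s _ a b η hη => ?_) le_rfl) i
  refine (differentiableAt_jostKernel A q₀ j x s ?_ a b).differentiableWithinAt
  rintro rfl
  simp at hη

/-- The quadratic form in the Jost solutions at `-∞`, evaluated at `x = 0`, that gives `a₁`
(for `j = 0`) and `a₂` (for `j = 1`) after the Jost solutions at `+∞` are expressed by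
reflection. -/
noncomputable def scat (A : ℝ) (q₀ : ℝ → ℂ) (j : Fin 2) (η : ℂ) : ℂ :=
  jostF A q₀ j η 0 j * (starRingEnd ℂ) (jostF A q₀ j (-(starRingEnd ℂ) η) 0 j) -
    jostF A q₀ j η 0 (1 - j) * (starRingEnd ℂ) (jostF A q₀ j (-(starRingEnd ℂ) η) 0 (1 - j))

theorem neg_conj_im (η : ℂ) : (-(starRingEnd ℂ) η).im = η.im := by simp

theorem conj_scat (A : ℝ) (q₀ : ℝ → ℂ) (j : Fin 2) (η : ℂ) :
    (starRingEnd ℂ) (scat A q₀ j (-(starRingEnd ℂ) η)) = scat A q₀ j η := by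
  simp only [scat, map_sub, map_mul, map_neg, Complex.conj_conj, neg_neg]
  ring

theorem continuousOn_conj_neg_conj {f : ℂ → ℂ} (hf : ContinuousOn f {η | 0 ≤ η.im}) :
    ContinuousOn (fun η => (starRingEnd ℂ) (f (-(starRingEnd ℂ) η))) {η | 0 ≤ η.im} :=
  Complex.continuous_conj.comp_continuousOn
    (hf.comp Complex.continuous_conj.neg.continuousOn fun η hη => by simpa using hη)

theorem differentiableOn_conj_neg_conj {f : ℂ → ℂ} (hf : DifferentiableOn ℂ f {η | 0 < η.im}) :
    DifferentiableOn ℂ (fun η => (starRingEnd ℂ) (f (-(starRingEnd ℂ) η))) {η | 0 < η.im} := by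
  intro η hη
  have h1 : DifferentiableAt ℂ f (-(starRingEnd ℂ) η) :=
    hf.differentiableAt (isOpen_im_pos.mem_nhds (by simpa using hη))
  have h2 : DifferentiableAt ℂ (fun z => f (-z)) ((starRingEnd ℂ) η) :=
    DifferentiableAt.comp (g := f) ((starRingEnd ℂ) η) h1 (by fun_prop)
  have h3 := h2.conj_conj
  rw [Complex.conj_conj] at h3
  exact h3.differentiableWithinAt

theorem continuousOn_scat (hA : 0 < A) (hq : IsStepLike A q₀) (j : Fin 2) :
    ContinuousOn (scat A q₀ j) {η | 0 ≤ η.im} :=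
  ((continuousOn_jostF hA hq j j).mul
    (continuousOn_conj_neg_conj (continuousOn_jostF hA hq j j))).sub
    ((continuousOn_jostF hA hq j (1 - j)).mul
      (continuousOn_conj_neg_conj (continuousOn_jostF hA hq j (1 - j))))

theorem differentiableOn_scat (hA : 0 < A) (hq : IsStepLike A q₀) (j : Fin 2) :
    DifferentiableOn ℂ (scat A q₀ j) {η | 0 < η.im} :=
  ((differentiableOn_jostF hA hq j j).mul
    (differentiableOn_conj_neg_conj (differentiableOn_jostF hA hq j j))).sub
    ((differentiableOn_jostF hA hq j (1 - j)).mul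
      (differentiableOn_conj_neg_conj (differentiableOn_jostF hA hq j (1 - j))))

theorem tendsto_scat (hA : 0 < A) (hq : IsStepLike A q₀) (j : Fin 2) :
    Tendsto (scat A q₀ j) upperInfty (𝓝 1) := by
  have h1 := tendsto_jostF_diag hA hq j 0
  have h2 := tendsto_jostF_off hA hq j 0
  have hc (z : ℂ) := Complex.continuous_conj.tendsto z
  have h3 := (h1.mul ((hc _).comp (h1.comp tendsto_neg_conj_upperInfty))).sub
    (h2.mul ((hc _).comp (h2.comp tendsto_neg_conj_upperInfty)))
  simp only [map_one, map_zero, mul_one, mul_zero, sub_zero] at h3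
  exact h3

theorem jostPhi_zero_apply (A : ℝ) (q₀ : ℝ → ℂ) (j : Fin 2) (η : ℂ) (i : Fin 2) :
    jostPhi A q₀ j η 0 i = jostScale j η * jostF A q₀ j η 0 i := by
  simp [jostPhi]

theorem phiMinus_zero_apply (hA : 0 < A) (hq : IsStepLike A q₀) {ξ : ℂ} (hξ : 0 ≤ ξ.im)
    (h0 : ξ ≠ 0) (i : Fin 2) :
    phiMinus A q₀ ξ 0 0 i = (ξ + Complex.I) / ξ * jostF A q₀ 0 ξ 0 i := by
  have h1 := phiMinus_eq hA hq (j := 0) hξ fun _ => h0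
  rw [show sigma3 0 * ξ = ξ by simp [sigma3]] at h1
  rw [h1, jostPhi_zero_apply]
  simp [jostScale]

theorem phiMinus_one_apply (hA : 0 < A) (hq : IsStepLike A q₀) {ξ : ℂ} (hξ : ξ.im ≤ 0)
    (i : Fin 2) : phiMinus A q₀ ξ 1 0 i = jostF A q₀ 1 (-ξ) 0 i := by
  have h1 := phiMinus_eq hA hq (j := 1) (η := -ξ) (by simpa using hξ) (by simp)
  rw [show sigma3 1 * -ξ = ξ by simp [sigma3]] at h1
  rw [h1, jostPhi_zero_apply]
  simp [jostScale]

theorem phiPlus_zero_apply (hA : 0 < A) (hq : IsStepLike A q₀) {ξ : ℂ} (hξ : ξ.im ≤ 0)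
    (i : Fin 2) : phiPlus A q₀ ξ 0 0 i =
      (starRingEnd ℂ) (jostF A q₀ 1 ((starRingEnd ℂ) ξ) 0 (1 - i)) := by
  have h1 := phiPlus_eq hA hq (j := 0) (η := (starRingEnd ℂ) ξ) (by simpa using hξ) (by simp)
  rw [show sigma3 0 * (starRingEnd ℂ) ((starRingEnd ℂ) ξ) = ξ by simp [sigma3]] at h1
  rw [h1, reflect, neg_zero, sub_zero, jostPhi_zero_apply]
  simp [jostScale]

theorem phiPlus_one_apply (hA : 0 < A) (hq : IsStepLike A q₀) {ξ : ℂ} (hξ : 0 ≤ ξ.im)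
    (h0 : ξ ≠ 0) (i : Fin 2) : phiPlus A q₀ ξ 1 0 i =
      (ξ + Complex.I) / ξ * (starRingEnd ℂ) (jostF A q₀ 0 (-(starRingEnd ℂ) ξ) 0 (1 - i)) := by
  have h1 := phiPlus_eq hA hq (j := 1) (η := -(starRingEnd ℂ) ξ) (by simpa using hξ)
    (by simpa using h0)
  rw [show sigma3 1 * (starRingEnd ℂ) (-(starRingEnd ℂ) ξ) = ξ by simp [sigma3]] at h1
  rw [h1, reflect, neg_zero, sub_self, jostPhi_zero_apply, map_mul]
  congr 1
  simp only [jostScale, if_true, map_div₀, map_add, map_neg, Complex.conj_conj, Complex.conj_I]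
  rw [← neg_add, neg_div_neg_eq]

theorem a₁_eq (hA : 0 < A) (hq : IsStepLike A q₀) {ξ : ℂ} (hξ : 0 ≤ ξ.im) (h0 : ξ ≠ 0) :
    a₁ A q₀ ξ = ((ξ + Complex.I) / ξ) ^ 2 * scat A q₀ 0 ξ := by
  simp only [a₁, wr, phiMinus_zero_apply hA hq hξ h0, phiPlus_one_apply hA hq hξ h0, scat,
    sub_self, sub_zero]
  ring

theorem a₂_eq (hA : 0 < A) (hq : IsStepLike A q₀) {ξ : ℂ} (hξ : ξ.im ≤ 0) :
    a₂ A q₀ ξ = scat A q₀ 1 (-ξ) := by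
  simp only [a₂, wr, phiMinus_one_apply hA hq hξ, phiPlus_zero_apply hA hq hξ, scat,
    sub_self, sub_zero, map_neg, neg_neg]
  ring

theorem b_eq (hA : 0 < A) (hq : IsStepLike A q₀) {x : ℝ} (h0 : x ≠ 0) :
    b A q₀ x = (x + Complex.I) / x *
      ((starRingEnd ℂ) (jostF A q₀ 1 x 0 1) * jostF A q₀ 0 x 0 1 -
        (starRingEnd ℂ) (jostF A q₀ 1 x 0 0) * jostF A q₀ 0 x 0 0) := by
  have h1 : ((x : ℂ)).im = 0 := Complex.ofReal_im x
  simp only [b, wr, phiMinus_zero_apply hA hq h1.ge (Complex.ofReal_ne_zero.2 h0),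
    phiPlus_zero_apply hA hq h1.le, sub_self, sub_zero, Complex.conj_ofReal]
  ring

/-- The Jost solutions at `-∞` have Wronskian `1`. -/
theorem wronskian_jost (hA : 0 < A) (hq : IsStepLike A q₀) {x : ℝ} (h0 : x ≠ 0) :
    (x + Complex.I) / x * (jostF A q₀ 0 x 0 0 * jostF A q₀ 1 (-x) 0 1 -
      jostF A q₀ 0 x 0 1 * jostF A q₀ 1 (-x) 0 0) = 1 := by
  have hx : 0 ≤ (x : ℂ).im := (Complex.ofReal_im x).ge
  have hx' : 0 ≤ (-(x : ℂ)).im := by simp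
  have s0 := isLaxSolution_jostPhi hA hq 0 hx
  have s1 := isLaxSolution_jostPhi hA hq 1 hx'
  rw [show sigma3 0 * (x : ℂ) = x by simp [sigma3]] at s0
  rw [show sigma3 1 * (-x : ℂ) = x by simp [sigma3]] at s1
  have hw (t : ℝ) : wr (jostPhi A q₀ 0 x t) (jostPhi A q₀ 1 (-x) t) =
      (x + Complex.I) / x * wr (jostF A q₀ 0 x t) (jostF A q₀ 1 (-x) t) := by
    rw [jostPhi, jostPhi, wr_smul_smul]
    simp only [jostScale, if_true, one_ne_zero, if_false]
    rw [show -(Complex.I * -(x : ℂ)) * t = -(-(Complex.I * x) * t) by ring, Complex.exp_neg]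
    have := Complex.exp_ne_zero (-(Complex.I * x) * t)
    field_simp
  have t0 := (isVolterra_jost hA hq 0 0).tendsto_sol_atBot (ξ := (x : ℂ)) hx
  have t1 := (isVolterra_jost hA hq 1 0).tendsto_sol_atBot (ξ := -(x : ℂ)) hx'
  have t2 := ((continuous_wr.tendsto _).comp (t0.prodMk_nhds t1)).const_mul
    (((x : ℂ) + Complex.I) / x)
  have e1 : ((x : ℂ) + Complex.I) / x * wr (jostFree A 0 x) (jostFree A 1 (-x)) = 1 := by
    have h2 := add_I_ne_zero hx
    have h3 : (x : ℂ) ≠ 0 := Complex.ofReal_ne_zero.2 h0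
    simp only [wr, jostFree_zero_zero, jostFree_one_one, jostFree_one_zero]
    field_simp
    ring
  have t3 : Tendsto (fun _ : ℝ => ((x : ℂ) + Complex.I) / x *
      wr (jostF A q₀ 0 x 0) (jostF A q₀ 1 (-x) 0)) atBot (𝓝 1) := by
    rw [← e1]
    refine t2.congr fun t => ?_
    rw [← hw, ← s0.wr_eq hA hq s1 t 0, hw]
    rfl
  exact tendsto_nhds_unique tendsto_const_nhds t3

/-- The determinant relation of the scattering matrix. It is a Plücker identity between the
Wronskians of `φ₋⁽¹⁾`, `φ₋⁽²⁾` and their reflections. -/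
theorem one_sub_b_mul (hA : 0 < A) (hq : IsStepLike A q₀) {x : ℝ} (h0 : x ≠ 0) :
    1 - b A q₀ x * (starRingEnd ℂ) (b A q₀ (-x)) = a₁ A q₀ x * a₂ A q₀ x := by
  have w1 := wronskian_jost hA hq h0
  have w2 := congrArg (starRingEnd ℂ) (wronskian_jost hA hq (neg_ne_zero.2 h0))
  have e : (starRingEnd ℂ) ((((-x : ℝ) : ℂ) + Complex.I) / ((-x : ℝ) : ℂ)) =
      (x + Complex.I) / x := by
    simp only [map_div₀, map_add, Complex.conj_ofReal, Complex.conj_I]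
    push_cast
    rw [← neg_add, neg_div_neg_eq]
  rw [map_mul, e] at w2
  rw [a₁_eq hA hq (Complex.ofReal_im x).ge (Complex.ofReal_ne_zero.2 h0),
    a₂_eq hA hq (Complex.ofReal_im x).le, b_eq hA hq h0, b_eq hA hq (neg_ne_zero.2 h0), map_mul, e]
  simp only [scat, map_sub, map_mul, map_neg, map_one, Complex.conj_conj, Complex.conj_ofReal,
    Complex.ofReal_neg, neg_neg, sub_self, sub_zero] at w1 w2 ⊢
  linear_combination (-1 : ℂ) * w2 - w1 * ((x + Complex.I) / x *
    ((starRingEnd ℂ) (jostF A q₀ 0 (-x) 0 0) * (starRingEnd ℂ) (jostF A q₀ 1 x 0 1) -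
      (starRingEnd ℂ) (jostF A q₀ 0 (-x) 0 1) * (starRingEnd ℂ) (jostF A q₀ 1 x 0 0)))

theorem isLaxSolution_jostF_zero (hA : 0 < A) (hq : IsStepLike A q₀) (j : Fin 2) :
    IsLaxSolution q₀ 0 (jostF A q₀ j 0) := by
  rw [isLaxSolution_iff hA hq]
  have hr (i : Fin 2) : rate i 0 = 0 := by simp [rate]
  refine ⟨(isPrim_jostF_zero hA hq j le_rfl).congr_right fun x => ?_,
    (isPrim_jostF_one hA hq j le_rfl).congr_right fun x => ?_⟩ <;>
  · rw [hr]; ring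

/-- At `ξ = 0` the regularized first column is a multiple of the second column. This is the origin
of the pole of `a₁` at `0`. -/
theorem jostF_zero_zero (hA : 0 < A) (hq : IsStepLike A q₀) (x : ℝ) :
    jostF A q₀ 0 0 x = (-(A : ℂ) / 2) • jostF A q₀ 1 0 x := by
  have hAc : (A : ℂ) ≠ 0 := Complex.ofReal_ne_zero.2 hA.ne'
  have h1 := isJostColumn_jostPhi hA hq (j := 1) (η := 0) le_rfl (by simp)
  have h2 : IsJostColumn q₀ (sigma3 1 * 0) atBot (Lminus A (sigma3 1 * 0)) 1
      fun x => (0 : Fin 2 → ℂ) - (2 / (A : ℂ)) • jostF A q₀ 0 0 x := by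
    refine ⟨?_, ?_⟩
    · rw [mul_zero]
      refine (isLaxSolution_jostF_zero hA hq 0).sub_smul hA hq ?_ _
      rw [isLaxSolution_iff hA hq]
      exact ⟨(IsPrim.const 0).congr_right fun x => by simp,
        (IsPrim.const 0).congr_right fun x => by simp⟩
    · have h3 := ((isVolterra_jost hA hq 0 0).tendsto_sol_atBot (ξ := 0) (by simp)).const_smul
        (2 / (A : ℂ)) |>.const_sub 0
      have h4 : (0 : Fin 2 → ℂ) - (2 / (A : ℂ)) • jostFree A 0 0 =
          fun i => Lminus A (sigma3 1 * 0) i 1 := by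
        funext i
        rw [Pi.sub_apply, Pi.smul_apply, smul_eq_mul]
        rcases fin_two_eq i with rfl | rfl
        · rw [jostFree_zero_zero]; simp [Lminus]
        · rw [jostFree_zero_one, zero_add, div_div, mul_assoc, Complex.I_mul_I]
          simp [Lminus]
          field_simp
      rw [h4] at h3
      simpa using! h3
  have h5 := congrFun (h1.unique hA hq le_rfl (Lminus_diag _ _ _) h2) x
  have h6 : jostPhi A q₀ 1 0 x = jostF A q₀ 1 0 x := by simp [jostPhi, jostScale]
  rw [← h6, ← h5, zero_sub, smul_neg, smul_smul]
  have h7 : -(-(A : ℂ) / 2 * (2 / A)) = 1 := by field_simp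
  rw [← neg_smul, h7, one_smul]

theorem scat_zero_zero (hA : 0 < A) (hq : IsStepLike A q₀) :
    scat A q₀ 0 0 = -((A : ℂ) ^ 2 / 4) * scat A q₀ 1 0 := by
  simp only [scat, map_zero, neg_zero, jostF_zero_zero hA hq, Pi.smul_apply, smul_eq_mul, map_mul,
    map_div₀, map_neg, Complex.conj_ofReal, Complex.conj_ofNat, sub_self, sub_zero]
  ring

/-- A nontrivial solution for `ξ = 0`, as it tends to `(0, 1)` at `-∞`. -/
theorem jostF_one_zero_ne (hA : 0 < A) (hq : IsStepLike A q₀) (x : ℝ) : jostF A q₀ 1 0 x ≠ 0 := by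
  intro h
  have h1 := (isLaxSolution_jostF_zero hA hq 1).eq_zero hA hq h
  have h2 := (isVolterra_jost hA hq 1 0).tendsto_sol_atBot (ξ := 0) (by simp)
  have h3 : jostFree A 1 0 = 0 := tendsto_nhds_unique h2
    (tendsto_const_nhds.congr fun t => (h1 t).symm)
  have h4 := congrFun h3 1
  rw [jostFree_one_one] at h4
  exact one_ne_zero h4

end Scattering

/-! ### Logarithms and principal values in the upper half-plane -/

/-- A function in the closed upper half-plane of the kind that occurs in the scalar factorization
problem: holomorphic in the interior and continuous up to the boundary, without zeros, equal to
`1` at infinity, and symmetric under `η ↦ -conj η`. -/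
structure UpperFactor (f : ℂ → ℂ) : Prop where
  cont : ContinuousOn f {η | 0 ≤ η.im}
  diff : DifferentiableOn ℂ f {η | 0 < η.im}
  ne_zero : ∀ η : ℂ, 0 ≤ η.im → f η ≠ 0
  lim : Tendsto f upperInfty (𝓝 1)
  symm : ∀ η : ℂ, 0 ≤ η.im → (starRingEnd ℂ) (f (-(starRingEnd ℂ) η)) = f η

theorem eventually_upperInfty_iff {p : ℂ → Prop} :
    (∀ᶠ η in upperInfty, p η) ↔ ∃ R, ∀ η : ℂ, 0 ≤ η.im → R ≤ ‖η‖ → p η := by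
  rw [upperInfty, eventually_inf_principal, eventually_comap, eventually_atTop]
  constructor
  · rintro ⟨R, hR⟩
    exact ⟨R, fun η hη h => hR _ h η rfl hη⟩
  · rintro ⟨R, hR⟩
    exact ⟨R, fun t ht η hη him => hR η him (hη ▸ ht)⟩

theorem tendsto_ofReal_atTop_upperInfty : Tendsto (fun x : ℝ => (x : ℂ)) atTop upperInfty := by
  refine tendsto_inf.2 ⟨tendsto_comap_iff.2 ?_, tendsto_principal.2 (Eventually.of_forall
    fun x => (Complex.ofReal_im x).ge)⟩
  refine tendsto_abs_atTop_atTop.congr fun x => ?_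
  simp

theorem tendsto_ofReal_atBot_upperInfty : Tendsto (fun x : ℝ => (x : ℂ)) atBot upperInfty := by
  refine tendsto_inf.2 ⟨tendsto_comap_iff.2 ?_, tendsto_principal.2 (Eventually.of_forall
    fun x => (Complex.ofReal_im x).ge)⟩
  refine tendsto_abs_atBot_atTop.congr fun x => ?_
  simp

theorem isClosed_im_nonneg : IsClosed {η : ℂ | 0 ≤ η.im} :=
  isClosed_le continuous_const Complex.continuous_im

theorem exists_bound_upper {f : ℂ → ℂ} {c : ℂ} (hf : ContinuousOn f {η | 0 ≤ η.im})
    (hlim : Tendsto f upperInfty (𝓝 c)) : ∃ M, ∀ η : ℂ, 0 ≤ η.im → ‖f η‖ ≤ M := by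
  obtain ⟨R, hR⟩ := eventually_upperInfty_iff.1
    (hlim.norm.eventually_le_const (lt_add_one ‖c‖))
  have hK : IsCompact (Metric.closedBall (0 : ℂ) R ∩ {η | 0 ≤ η.im}) :=
    (isCompact_closedBall 0 R).inter_right isClosed_im_nonneg
  obtain ⟨M, hM⟩ := hK.exists_bound_of_continuousOn (hf.mono Set.inter_subset_right)
  refine ⟨max M (‖c‖ + 1), fun η hη => ?_⟩
  rcases le_total R ‖η‖ with h | h
  · exact (hR η hη h).trans (le_max_right _ _)
  · exact (hM η ⟨by simpa using h, hη⟩).trans (le_max_left _ _)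

/-- A continuous function in the closed upper half-plane with a limit at infinity is uniformly
continuous. -/
theorem exists_delta_upper {f : ℂ → ℂ} {c : ℂ} (hf : ContinuousOn f {η | 0 ≤ η.im})
    (hlim : Tendsto f upperInfty (𝓝 c)) {ε : ℝ} (hε : 0 < ε) :
    ∃ δ > 0, ∀ η ζ : ℂ, 0 ≤ η.im → 0 ≤ ζ.im → dist η ζ < δ → dist (f η) (f ζ) < ε := by
  -- Extend `f` to the plane by reflection in the real axis.
  let r : ℂ → ℂ := fun η => (η.re : ℂ) + (|η.im| : ℝ) * Complex.I
  have hr : Continuous r := by fun_prop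
  have hrim (η : ℂ) : (r η).im = |η.im| := by simp [r]
  have hrn (η : ℂ) : ‖r η‖ = ‖η‖ := by
    rw [← sq_eq_sq₀ (norm_nonneg _) (norm_nonneg _), ← Complex.normSq_eq_norm_sq,
      ← Complex.normSq_eq_norm_sq, Complex.normSq_apply, Complex.normSq_apply]
    simp [r]
  have hr0 (η : ℂ) (hη : 0 ≤ η.im) : r η = η := by
    simp [r, abs_of_nonneg hη, Complex.re_add_im]
  have hg : Continuous fun η => f (r η) := by
    rw [← continuousOn_univ]
    exact hf.comp hr.continuousOn fun η _ => by
      change 0 ≤ (r η).im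
      rw [hrim]; exact abs_nonneg _
  have hrt : Tendsto r (cocompact ℂ) upperInfty := by
    refine tendsto_inf.2 ⟨tendsto_comap_iff.2 ?_, tendsto_principal.2 (Eventually.of_forall
      fun η => ?_)⟩
    · exact tendsto_norm_cocompact_atTop.congr fun η => (hrn η).symm
    · change 0 ≤ (r η).im
      rw [hrim]; exact abs_nonneg _
  obtain ⟨δ, hδ, h⟩ := Metric.uniformContinuous_iff.1
    (hg.uniformContinuous_of_tendsto_cocompact (hlim.comp hrt)) ε hε
  refine ⟨δ, hδ, fun η ζ hη hζ hd => ?_⟩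
  have := h hd
  rwa [hr0 η hη, hr0 ζ hζ] at this

theorem tendsto_add_upperInfty {t : ℝ} (ht : 0 ≤ t) :
    Tendsto (fun η : ℂ => η + t * Complex.I) upperInfty upperInfty := by
  refine tendsto_inf.2 ⟨tendsto_comap_iff.2 ?_, tendsto_principal.2 ?_⟩
  · refine tendsto_atTop_mono (f := fun η : ℂ => ‖η‖ - |t|) (fun η => ?_)
      (tendsto_atTop_add_const_right _ _ tendsto_norm_upperInfty)
    have h1 := norm_sub_le (η + t * Complex.I) (t * Complex.I)
    rw [add_sub_cancel_right, norm_mul, Complex.norm_I, mul_one, Complex.norm_real,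
      Real.norm_eq_abs] at h1
    simp only [Function.comp_apply]
    linarith
  · filter_upwards [eventually_upperInfty_im] with η hη
    simp
    linarith

theorem im_log_eq_zero {r : ℂ} (hr : (starRingEnd ℂ) r = r) (h1 : ‖r - 1‖ < 1) :
    (Complex.log r).im = 0 := by
  obtain ⟨t, rfl⟩ := Complex.conj_eq_iff_real.1 hr
  have h2 : |t - 1| < 1 := by
    have : ‖((t - 1 : ℝ) : ℂ)‖ < 1 := by simpa using h1
    rwa [Complex.norm_real, Real.norm_eq_abs] at this
  rw [Complex.log_im, Complex.arg_ofReal_of_nonneg (by linarith [(abs_lt.1 h2).1])]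

/-- The logarithm of a function in the closed upper half-plane that is real on the imaginary axis.
By uniform continuity `f η / f (η + i h)` is close to `1` for a small `h`, and `f (η + i N h)` is
close to `1` for a large `N`, so that a finite sum of principal logarithms does. -/
theorem UpperFactor.exists_log {f : ℂ → ℂ} (hf : UpperFactor f) :
    ∃ L : ℂ → ℂ, ContinuousOn L {η | 0 ≤ η.im} ∧ DifferentiableOn ℂ L {η | 0 < η.im} ∧
      (∀ η : ℂ, 0 ≤ η.im → Complex.exp (L η) = f η) ∧ Tendsto L upperInfty (𝓝 0) ∧
      (L 0).im = 0 := by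
  obtain ⟨M, hM⟩ := exists_bound_upper (hf.cont.inv₀ fun η hη => hf.ne_zero η hη)
    (hf.lim.inv₀ one_ne_zero)
  have hM0 : 0 < M := (norm_pos_iff.2 (inv_ne_zero (hf.ne_zero 0 le_rfl))).trans_le (hM 0 le_rfl)
  obtain ⟨δ, hδ, hd⟩ := exists_delta_upper hf.cont hf.lim (ε := 1 / M) (by positivity)
  obtain ⟨R, hR⟩ := eventually_upperInfty_iff.1
    (Metric.tendsto_nhds.1 hf.lim 1 one_pos)
  set h := δ / 2 with hh
  have hh0 : 0 < h := by positivity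
  obtain ⟨N, hN⟩ := exists_nat_ge (R / h)
  rw [div_le_iff₀ hh0] at hN
  set p : ℕ → ℂ → ℂ := fun k η => η + ((k * h : ℝ) : ℂ) * Complex.I with hp
  have hpim (k : ℕ) (η : ℂ) : (p k η).im = η.im + k * h := by simp [hp]
  have hkh (k : ℕ) : (0 : ℝ) ≤ k * h := by positivity
  have hpos (k : ℕ) (η : ℂ) (hη : 0 ≤ η.im) : 0 ≤ (p k η).im := by
    rw [hpim]; linarith [hkh k]
  have hratio (k : ℕ) (η : ℂ) (hη : 0 ≤ η.im) : ‖f (p k η) / f (p (k + 1) η) - 1‖ < 1 := by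
    have hne := hf.ne_zero _ (hpos (k + 1) η hη)
    have e : f (p k η) / f (p (k + 1) η) - 1 =
        (f (p k η) - f (p (k + 1) η)) * (f (p (k + 1) η))⁻¹ := by field_simp
    have h1 := hd _ _ (hpos k η hη) (hpos (k + 1) η hη) (by
      have : p k η - p (k + 1) η = ((-h : ℝ) : ℂ) * Complex.I := by
        simp only [hp]; push_cast; ring
      rw [dist_eq_norm, this, norm_mul, Complex.norm_I, mul_one, Complex.norm_real, norm_neg,
        Real.norm_of_nonneg hh0.le]
      linarith)
    rw [dist_eq_norm, lt_div_iff₀ hM0] at h1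
    rw [e, norm_mul]
    exact (mul_le_mul_of_nonneg_left (hM _ (hpos (k + 1) η hη)) (norm_nonneg _)).trans_lt h1
  have hlast (η : ℂ) (hη : 0 ≤ η.im) : ‖f (p N η) - 1‖ < 1 := by
    have h1 := hR (p N η) (hpos N η hη) (by
      have := (le_abs_self _).trans (Complex.abs_im_le_norm (p N η))
      rw [hpim] at this
      linarith)
    rwa [dist_eq_norm] at h1
  have hslit {z : ℂ} (hz : ‖z - 1‖ < 1) : z ∈ Complex.slitPlane := by
    have := Complex.mem_slitPlane_of_norm_lt_one hz
    rwa [add_sub_cancel] at this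
  have hpc (k : ℕ) : ContinuousOn (fun η => f (p k η)) {η | 0 ≤ η.im} :=
    hf.cont.comp (by fun_prop) fun η hη => hpos k η hη
  have hpd (k : ℕ) : DifferentiableOn ℂ (fun η => f (p k η)) {η | 0 < η.im} := by
    refine hf.diff.comp (by fun_prop) fun η hη => ?_
    change 0 < (p k η).im
    rw [hpim]
    have : 0 < η.im := hη
    linarith [hkh k]
  have hpl (k : ℕ) : Tendsto (fun η => f (p k η)) upperInfty (𝓝 1) :=
    hf.lim.comp (tendsto_add_upperInfty (hkh k))
  have hlog : Tendsto Complex.log (𝓝 1) (𝓝 0) := by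
    have := (continuousAt_clog Complex.one_mem_slitPlane).tendsto
    rwa [Complex.log_one] at this
  refine ⟨fun η => (∑ k ∈ Finset.range N, Complex.log (f (p k η) / f (p (k + 1) η))) +
    Complex.log (f (p N η)), ?_, ?_, ?_, ?_, ?_⟩
  · refine ContinuousOn.add (continuousOn_finsetSum _ fun k _ => ?_) ?_
    · exact ((hpc k).div (hpc (k + 1)) fun η hη => hf.ne_zero _ (hpos (k + 1) η hη)).clog
        fun η hη => hslit (hratio k η hη)
    · exact (hpc N).clog fun η hη => hslit (hlast η hη)
  · refine DifferentiableOn.add (DifferentiableOn.fun_sum fun k _ => ?_) ?_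
    · exact ((hpd k).div (hpd (k + 1)) fun η hη => hf.ne_zero _ (hpos (k + 1) η (le_of_lt hη))).clog
        fun η hη => hslit (hratio k η (le_of_lt hη))
    · exact (hpd N).clog fun η hη => hslit (hlast η (le_of_lt hη))
  · intro η hη
    have hne (k : ℕ) := hf.ne_zero _ (hpos k η hη)
    have htel (n : ℕ) : ∏ k ∈ Finset.range n, f (p k η) / f (p (k + 1) η) =
        f (p 0 η) / f (p n η) := by
      induction n with
      | zero => rw [Finset.prod_range_zero, div_self (hne 0)]
      | succ n ih => rw [Finset.prod_range_succ, ih, div_mul_div_cancel₀ (hne n)]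
    rw [Complex.exp_add, Complex.exp_log (hne N), Complex.exp_sum,
      Finset.prod_congr rfl fun k _ => Complex.exp_log (div_ne_zero (hne k) (hne (k + 1))),
      htel, div_mul_cancel₀ _ (hne N)]
    simp [hp]
  · have h1 : Tendsto (fun η => ∑ k ∈ Finset.range N,
        Complex.log (f (p k η) / f (p (k + 1) η))) upperInfty (𝓝 (∑ k ∈ Finset.range N, 0)) := by
      refine tendsto_finsetSum _ fun k _ => ?_
      have := (hpl k).div (hpl (k + 1)) one_ne_zero
      rw [div_one] at this
      exact hlog.comp this
    have h2 := h1.add (hlog.comp (hpl N))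
    rw [Finset.sum_const_zero, add_zero] at h2
    exact h2
  · have hreal (k : ℕ) : (starRingEnd ℂ) (f (p k 0)) = f (p k 0) := by
      have h1 := hf.symm (p k 0) (hpos k 0 le_rfl)
      have h2 : -(starRingEnd ℂ) (p k 0) = p k 0 := by simp [hp]
      rwa [h2] at h1
    rw [Complex.add_im, Complex.im_sum, Finset.sum_eq_zero fun k _ => im_log_eq_zero
      (by rw [map_div₀, hreal, hreal]) (hratio k 0 le_rfl),
      im_log_eq_zero (hreal N) (hlast 0 le_rfl), add_zero]

section PrincipalValue

theorem punctured_eq {ε R : ℝ} (hε : 0 < ε) :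
    {x : ℝ | ε < |x| ∧ |x| < R} = Set.Ioo (-R) (-ε) ∪ Set.Ioo ε R := by
  ext x
  simp only [Set.mem_ofPred_eq, Set.mem_union, Set.mem_Ioo, lt_abs, abs_lt]
  constructor
  · rintro ⟨h1 | h1, h2, h3⟩
    · exact Or.inr ⟨h1, h3⟩
    · exact Or.inl ⟨h2, by linarith⟩
  · rintro (⟨h1, h2⟩ | ⟨h1, h2⟩)
    · exact ⟨Or.inr (by linarith), h1, by linarith⟩
    · exact ⟨Or.inl h1, by linarith, h2⟩

theorem integrableOn_punctured {f : ℝ → ℂ} (hf : ContinuousOn f {0}ᶜ) {ε R : ℝ} (hε : 0 < ε) :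
    IntegrableOn f {x : ℝ | ε < |x| ∧ |x| < R} := by
  rw [punctured_eq hε]
  have h1 (a b : ℝ) (h : ∀ x ∈ Set.Icc a b, x ≠ 0) : IntegrableOn f (Set.Ioo a b) :=
    ((hf.mono fun x hx => h x hx).integrableOn_Icc).mono_set Set.Ioo_subset_Icc_self
  exact (h1 _ _ fun x hx => by linarith [hx.2] |> fun h : x < 0 => h.ne).union
    (h1 _ _ fun x hx => by linarith [hx.1] |> fun h : 0 < x => h.ne')

theorem integral_punctured {f : ℝ → ℂ} (hf : ContinuousOn f {0}ᶜ) {ε R : ℝ} (hε : 0 < ε)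
    (hR : ε ≤ R) : ∫ x in {x : ℝ | ε < |x| ∧ |x| < R}, f x =
      (∫ x in (-R)..(-ε), f x) + ∫ x in ε..R, f x := by
  have hi := integrableOn_punctured hf hε (R := R)
  rw [punctured_eq hε] at hi ⊢
  rw [setIntegral_union ?_ measurableSet_Ioo hi.left_of_union hi.right_of_union,
    intervalIntegral.integral_of_le (by linarith), intervalIntegral.integral_of_le hR,
    integral_Ioc_eq_integral_Ioo, integral_Ioc_eq_integral_Ioo]
  refine Set.disjoint_left.2 fun x hx hx' => ?_
  linarith [hx.2, hx'.1]

/-- The substitution `x = eˢ`. -/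
theorem integral_div_eq_integral_comp_exp {g : ℝ → ℂ} (hg : Continuous g) {ε R : ℝ} (hε : 0 < ε)
    (hR : 0 < R) : ∫ x in ε..R, g x / x = ∫ s in Real.log ε..Real.log R, g (Real.exp s) := by
  have h1 := intervalIntegral.integral_deriv_smul_comp' (a := Real.log ε) (b := Real.log R)
    (f := Real.exp) (f' := Real.exp) (g := fun x : ℝ => g x / (x : ℂ))
    (fun x _ => Real.hasDerivAt_exp x) Real.continuous_exp.continuousOn (by
      refine hg.continuousOn.div (by fun_prop) ?_
      rintro _ ⟨s, -, rfl⟩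
      exact Complex.ofReal_ne_zero.2 (Real.exp_ne_zero s))
  rw [Real.exp_log hε, Real.exp_log hR] at h1
  rw [← h1]
  congr 1
  funext s
  have : ((Real.exp s : ℝ) : ℂ) ≠ 0 := Complex.ofReal_ne_zero.2 (Real.exp_ne_zero s)
  rw [Complex.real_smul, Function.comp_apply, mul_div_cancel₀ _ this]

variable {L : ℂ → ℂ}

theorem continuous_comp_ofReal (hc : ContinuousOn L {η | 0 ≤ η.im}) :
    Continuous fun x : ℝ => L x := by
  rw [← continuousOn_univ]
  exact hc.comp Complex.continuous_ofReal.continuousOn fun x _ => (Complex.ofReal_im x).ge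

/-- Cauchy's theorem for `L(z) dz / z` in a half-annulus, which the exponential turns into a
rectangle. -/
theorem integral_punctured_eq_arcs (hc : ContinuousOn L {η | 0 ≤ η.im})
    (hd : DifferentiableOn ℂ L {η | 0 < η.im}) {ε R : ℝ} (hε : 0 < ε) (hR : ε ≤ R) :
    ∫ x in {x : ℝ | ε < |x| ∧ |x| < R}, L x / x =
      Complex.I * (∫ θ in (0 : ℝ)..Real.pi, L (ε * Complex.exp (θ * Complex.I))) -
        Complex.I * ∫ θ in (0 : ℝ)..Real.pi, L (R * Complex.exp (θ * Complex.I)) := by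
  have hR0 : 0 < R := hε.trans_le hR
  have hLc := continuous_comp_ofReal hc
  have hmaps : Set.MapsTo Complex.exp (Set.uIcc (Real.log ε) (Real.log R) ×ℂ
      Set.uIcc 0 Real.pi) {η | 0 ≤ η.im} := by
    intro ζ hζ
    rw [Complex.mem_reProdIm, Set.uIcc_of_le Real.pi_pos.le] at hζ
    change 0 ≤ (Complex.exp ζ).im
    rw [Complex.exp_im]
    exact mul_nonneg (Real.exp_pos _).le (Real.sin_nonneg_of_mem_Icc hζ.2)
  have hrect := Complex.integral_boundary_rect_eq_zero_of_continuousOn_of_differentiableOn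
    (fun ζ => L (Complex.exp ζ)) ⟨Real.log ε, 0⟩ ⟨Real.log R, Real.pi⟩
    (hc.comp Complex.continuous_exp.continuousOn hmaps) (by
      refine hd.comp Complex.differentiable_exp.differentiableOn fun ζ hζ => ?_
      rw [Complex.mem_reProdIm, min_eq_left Real.pi_pos.le, max_eq_right Real.pi_pos.le] at hζ
      change 0 < (Complex.exp ζ).im
      rw [Complex.exp_im]
      exact mul_pos (Real.exp_pos _) (Real.sin_pos_of_mem_Ioo hζ.2))
  have e1 (s : ℝ) : Complex.exp (s + (0 : ℝ) * Complex.I) = ((Real.exp s : ℝ) : ℂ) := by simp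
  have e2 (s : ℝ) : Complex.exp (s + Real.pi * Complex.I) = ((-Real.exp s : ℝ) : ℂ) := by
    rw [Complex.exp_add, Complex.exp_pi_mul_I]; simp
  have e3 {r : ℝ} (hr : 0 < r) (θ : ℝ) : Complex.exp ((Real.log r : ℝ) + θ * Complex.I) =
      r * Complex.exp (θ * Complex.I) := by
    rw [Complex.exp_add, ← Complex.ofReal_exp, Real.exp_log hr]
  simp only [e1, e2, e3 hε, e3 hR0, smul_eq_mul] at hrect
  have hf : ContinuousOn (fun x : ℝ => L x / x) {0}ᶜ :=
    hLc.continuousOn.div (by fun_prop) fun x hx => Complex.ofReal_ne_zero.2 hx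
  rw [integral_punctured hf hε hR, integral_div_eq_integral_comp_exp hLc hε hR0]
  have h2 : ∫ x in (-R)..(-ε), L x / x =
      -∫ s in Real.log ε..Real.log R, L ((-Real.exp s : ℝ) : ℂ) := by
    rw [← intervalIntegral.integral_comp_neg, ← intervalIntegral.integral_neg]
    have h3 := integral_div_eq_integral_comp_exp (g := fun x : ℝ => -L ((-x : ℝ) : ℂ))
      (hLc.comp continuous_neg).neg hε hR0
    rw [← h3]
    congr 1
    funext x
    push_cast
    rw [div_neg, neg_div]
  rw [h2]
  linear_combination hrect

/-- In the half-annulus identity the small arc contributes `I π L(0)` in the limit, the large one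
nothing. -/
theorem hasPrincipalValue_upper (hc : ContinuousOn L {η | 0 ≤ η.im})
    (hd : DifferentiableOn ℂ L {η | 0 < η.im}) (hlim : Tendsto L upperInfty (𝓝 0)) :
    HasPrincipalValue (fun x => L x / x) (Complex.I * Real.pi * L 0) := by
  obtain ⟨M, hM⟩ := exists_bound_upper hc hlim
  have hpt {r θ : ℝ} (hr : 0 ≤ r) (hθ : θ ∈ Set.uIoc 0 Real.pi) :
      0 ≤ (r * Complex.exp (θ * Complex.I)).im := by
    rw [Set.uIoc_of_le Real.pi_pos.le] at hθ
    rw [Complex.im_ofReal_mul, Complex.exp_ofReal_mul_I_im]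
    exact mul_nonneg hr (Real.sin_nonneg_of_nonneg_of_le_pi hθ.1.le hθ.2)
  have hnorm {r θ : ℝ} (hr : 0 ≤ r) : ‖(r * Complex.exp (θ * Complex.I) : ℂ)‖ = r := by
    rw [norm_mul, Complex.norm_exp_ofReal_mul_I, mul_one, Complex.norm_real,
      Real.norm_of_nonneg hr]
  have harc {l : Filter ℝ} [l.IsCountablyGenerated] {c : ℂ} (hl : ∀ᶠ r in l, 0 ≤ r)
      (h : ∀ θ ∈ Set.uIoc 0 Real.pi,
        Tendsto (fun r : ℝ => L (r * Complex.exp (θ * Complex.I))) l (𝓝 c)) :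
      Tendsto (fun r : ℝ => Complex.I * ∫ θ in (0 : ℝ)..Real.pi, L (r * Complex.exp (θ * Complex.I)))
        l (𝓝 (Complex.I * Real.pi * c)) := by
    have h1 := intervalIntegral.tendsto_integral_filter_of_dominated_convergence
      (μ := volume) (a := 0) (b := Real.pi) (f := fun _ => c) (fun _ => M)
      (F := fun (r θ : ℝ) => L (r * Complex.exp (θ * Complex.I))) (l := l) (by
        filter_upwards [hl] with r hr
        refine ContinuousOn.aestronglyMeasurable ?_ measurableSet_uIoc
        exact hc.comp (by fun_prop) fun θ hθ => hpt hr hθ) (by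
        filter_upwards [hl] with r hr
        exact Eventually.of_forall fun θ hθ => hM _ (hpt hr hθ)) (by simp)
      (Eventually.of_forall h)
    rw [intervalIntegral.integral_const, sub_zero, Complex.real_smul] at h1
    rw [mul_assoc]
    exact h1.const_mul _
  have h0 := harc (l := 𝓝[>] 0) (c := L 0)
    (by filter_upwards [self_mem_nhdsWithin] with r hr using le_of_lt hr) fun θ hθ => by
      refine (hc 0 (by simp)).tendsto.comp (tendsto_nhdsWithin_iff.2 ⟨?_, ?_⟩)
      · have : Continuous fun r : ℝ => (r * Complex.exp (θ * Complex.I) : ℂ) := by fun_prop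
        have := this.tendsto 0
        rw [Complex.ofReal_zero, zero_mul] at this
        exact this.mono_left nhdsWithin_le_nhds
      · filter_upwards [self_mem_nhdsWithin] with r hr using hpt (le_of_lt hr) hθ
  have hinf := harc (l := atTop) (c := 0) (eventually_ge_atTop 0) fun θ hθ => by
    refine hlim.comp (tendsto_inf.2 ⟨tendsto_comap_iff.2 ?_, tendsto_principal.2 ?_⟩)
    · refine tendsto_id.congr' ?_
      filter_upwards [eventually_ge_atTop 0] with r hr using (hnorm hr).symm
    · filter_upwards [eventually_ge_atTop 0] with r hr using hpt hr hθ
  have hboth := (h0.comp tendsto_fst).sub (hinf.comp (tendsto_snd (f := 𝓝[>] (0 : ℝ))))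
  rw [mul_zero, sub_zero] at hboth
  refine hboth.congr' ?_
  have hev : ∀ᶠ p : ℝ × ℝ in (𝓝[>] 0) ×ˢ atTop, (0 < p.1 ∧ p.1 < 1) ∧ 1 ≤ p.2 :=
    Eventually.prod_mk (Ioo_mem_nhdsGT one_pos) (eventually_ge_atTop 1)
  filter_upwards [hev] with p hp
  exact (integral_punctured_eq_arcs hc hd hp.1.1 (hp.1.2.le.trans hp.2)).symm

theorem HasPrincipalValue.comp_neg {f : ℝ → ℂ} {c : ℂ} (h : HasPrincipalValue f c) :
    HasPrincipalValue (fun x => f (-x)) c := by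
  refine h.congr fun p => ?_
  have hs : (fun x : ℝ => -x) ⁻¹' {x : ℝ | p.1 < |x| ∧ |x| < p.2} =
      {x : ℝ | p.1 < |x| ∧ |x| < p.2} := by
    ext x; simp
  have := (Measure.measurePreserving_neg (volume : Measure ℝ)).setIntegral_preimage_emb
    (MeasurableEquiv.neg ℝ).measurableEmbedding f {x : ℝ | p.1 < |x| ∧ |x| < p.2}
  rw [hs] at this
  exact this.symm

/-- The scalar factorization problem `g(x) = f₁(x) f₂(-x)` on the line: the logarithm of `g` is
the sum of the logarithms of the factors, and each factor contributes half a residue at `0` to the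
principal value. -/
theorem exists_logBranch {f₁ f₂ : ℂ → ℂ} (h₁ : UpperFactor f₁) (h₂ : UpperFactor f₂)
    {g : ℝ → ℂ} (hg : ∀ x : ℝ, x ≠ 0 → g x = f₁ x * f₂ (-x)) :
    ∃ (l : ℝ → ℂ) (c : ℂ) (r₁ r₂ : ℝ), IsLogBranch g l ∧
      HasPrincipalValue (fun x => l x / x) c ∧ f₁ 0 = Complex.exp r₁ ∧ f₂ 0 = Complex.exp r₂ ∧
      c = Complex.I * Real.pi * (r₁ - r₂) := by
  obtain ⟨L₁, hc₁, hd₁, he₁, hl₁, hi₁⟩ := h₁.exists_log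
  obtain ⟨L₂, hc₂, hd₂, he₂, hl₂, hi₂⟩ := h₂.exists_log
  have him (x : ℝ) : 0 ≤ (x : ℂ).im := (Complex.ofReal_im x).ge
  have hC₁ := continuous_comp_ofReal hc₁
  have hC₂ : Continuous fun x : ℝ => L₂ ((-x : ℝ) : ℂ) :=
    (continuous_comp_ofReal hc₂).comp continuous_neg
  have hr {z : ℂ} (hz : z.im = 0) : ((z.re : ℝ) : ℂ) = z := Complex.ext rfl (by simp [hz])
  refine ⟨fun x => L₁ x + L₂ ((-x : ℝ) : ℂ), Complex.I * Real.pi * ((L₁ 0).re - (L₂ 0).re),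
    (L₁ 0).re, (L₂ 0).re, ⟨hC₁.add hC₂, ?_, ?_, ?_⟩, ?_, ?_, ?_, rfl⟩
  · intro x hx
    rw [Complex.exp_add, he₁ _ (him x), he₂ _ (him _), hg x hx, Complex.ofReal_neg]
  · have h := (hl₁.comp tendsto_ofReal_atBot_upperInfty).add
      (hl₂.comp (tendsto_ofReal_atTop_upperInfty.comp tendsto_neg_atBot_atTop))
    rw [add_zero] at h
    exact h
  · have h := (hl₁.comp tendsto_ofReal_atTop_upperInfty).add
      (hl₂.comp (tendsto_ofReal_atBot_upperInfty.comp tendsto_neg_atTop_atBot))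
    rw [add_zero] at h
    exact h
  · have p₁ := hasPrincipalValue_upper hc₁ hd₁ hl₁
    have p₂ := (hasPrincipalValue_upper hc₂ hd₂ hl₂).comp_neg
    have h := Tendsto.sub p₁ p₂
    rw [← mul_sub] at h
    rw [hr hi₁, hr hi₂]
    refine h.congr' ?_
    have hev : ∀ᶠ p : ℝ × ℝ in (𝓝[>] 0) ×ˢ atTop, 0 < p.1 :=
      (tendsto_fst (g := atTop)).eventually self_mem_nhdsWithin
    filter_upwards [hev] with p hp
    have hquot {u : ℝ → ℂ} (hu : Continuous u) : ContinuousOn (fun x : ℝ => u x / (x : ℂ)) {0}ᶜ :=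
      hu.continuousOn.div (by fun_prop) fun x hx => Complex.ofReal_ne_zero.2 hx
    have e : (fun x : ℝ => L₂ ((-x : ℝ) : ℂ) / ((-x : ℝ) : ℂ)) =
        fun x : ℝ => -(L₂ ((-x : ℝ) : ℂ) / (x : ℂ)) := by
      funext x
      rw [Complex.ofReal_neg, div_neg]
    rw [e, integral_neg, sub_neg_eq_add, ← integral_add
      (integrableOn_punctured (hquot hC₁) hp) (integrableOn_punctured (hquot hC₂) hp)]
    simp only [add_div]
  · rw [hr hi₁, he₁ 0 (by simp)]
  · rw [hr hi₂, he₂ 0 (by simp)]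

end PrincipalValue

/-! ### Removal of the zeros -/

theorem tendsto_inv_add_upperInfty (b : ℂ) :
    Tendsto (fun η : ℂ => (η + b)⁻¹) upperInfty (𝓝 0) := by
  refine tendsto_zero_iff_norm_tendsto_zero.2 ?_
  simp only [norm_inv]
  refine tendsto_inv_atTop_zero.comp (tendsto_atTop_mono (f := fun η : ℂ => ‖η‖ - ‖b‖)
    (fun η => ?_) (tendsto_atTop_add_const_right _ _ tendsto_norm_upperInfty))
  have h1 := norm_sub_le (η + b) b
  rw [add_sub_cancel_right] at h1
  linarith

theorem eventually_ne_upperInfty (b : ℂ) : ∀ᶠ η in upperInfty, η ≠ b := by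
  filter_upwards [tendsto_norm_upperInfty.eventually (eventually_gt_atTop ‖b‖)] with η h h'
  rw [h'] at h
  exact h.false

theorem tendsto_div_upperInfty (a b : ℂ) :
    Tendsto (fun η : ℂ => (η + a) / (η + b)) upperInfty (𝓝 1) := by
  have h := ((tendsto_inv_add_upperInfty b).const_mul (a - b)).const_add 1
  rw [mul_zero, add_zero] at h
  refine h.congr' ?_
  filter_upwards [eventually_ne_upperInfty (-b)] with η hη
  have : η + b ≠ 0 := fun h => hη (eq_neg_of_add_eq_zero_left h)
  field_simp
  ring

/-- The symmetry in the imaginary axis extends by continuity to the boundary and to an exceptional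
interior point. -/
theorem symm_of_interior {f : ℂ → ℂ} (hf : ContinuousOn f {η | 0 ≤ η.im}) (z : ℂ)
    (h : ∀ η : ℂ, 0 < η.im → η ≠ z → (starRingEnd ℂ) (f (-(starRingEnd ℂ) η)) = f η)
    (η : ℂ) (hη : 0 ≤ η.im) : (starRingEnd ℂ) (f (-(starRingEnd ℂ) η)) = f η := by
  have hp : Tendsto (fun t : ℝ => η + t * Complex.I) (𝓝[>] 0) (𝓝 η) := by
    have : Continuous fun t : ℝ => η + t * Complex.I := by fun_prop
    have := this.tendsto 0
    rw [Complex.ofReal_zero, zero_mul, add_zero] at this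
    exact this.mono_left nhdsWithin_le_nhds
  have him : ∀ᶠ t : ℝ in 𝓝[>] 0, 0 < (η + t * Complex.I).im := by
    filter_upwards [self_mem_nhdsWithin] with t ht
    have : 0 < t := ht
    simp
    linarith
  have hne : ∀ᶠ t : ℝ in 𝓝[>] 0, η + t * Complex.I ≠ z := by
    by_cases hz : η = z
    · filter_upwards [self_mem_nhdsWithin] with t ht h'
      have h0 : (t : ℂ) * Complex.I = 0 := by linear_combination h' - hz
      have : 0 < t := ht
      simp [this.ne'] at h0
    · exact hp.eventually_ne hz
  have hconj : Tendsto (fun t : ℝ => -(starRingEnd ℂ) (η + t * Complex.I)) (𝓝[>] 0)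
      (𝓝 (-(starRingEnd ℂ) η)) := ((Complex.continuous_conj.tendsto η).comp hp).neg
  have h1 : Tendsto (fun t : ℝ => f (η + t * Complex.I)) (𝓝[>] 0) (𝓝 (f η)) :=
    (hf η hη).tendsto.comp (tendsto_nhdsWithin_iff.2 ⟨hp, him.mono fun t ht => le_of_lt ht⟩)
  have h2 : Tendsto (fun t : ℝ => (starRingEnd ℂ) (f (-(starRingEnd ℂ) (η + t * Complex.I))))
      (𝓝[>] 0) (𝓝 ((starRingEnd ℂ) (f (-(starRingEnd ℂ) η)))) := by
    refine (Complex.continuous_conj.tendsto _).comp ((hf (-(starRingEnd ℂ) η) ?_).tendsto.comp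
      (tendsto_nhdsWithin_iff.2 ⟨hconj, him.mono fun t ht => ?_⟩))
    · simpa using hη
    · change 0 ≤ (-(starRingEnd ℂ) (η + t * Complex.I)).im
      rw [neg_conj_im]
      exact ht.le
  refine tendsto_nhds_unique_of_eventuallyEq h2 h1 ?_
  filter_upwards [him, hne] with t h3 h4 using h _ h3 h4

/-- Division by `η - i t` turns a function whose only zero is a simple one at `i t`, and which
behaves like `η` at infinity, into a factor without zeros. -/
theorem UpperFactor.of_simple_zero {g : ℂ → ℂ} {t : ℝ} (ht : 0 < t)
    (hc : ContinuousOn g {η | 0 ≤ η.im}) (hd : DifferentiableOn ℂ g {η | 0 < η.im})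
    (hz : ∀ η : ℂ, 0 ≤ η.im → (g η = 0 ↔ η = Complex.I * t))
    (hd0 : deriv g (Complex.I * t) ≠ 0)
    (hlim : Tendsto (fun η => g η / (η - Complex.I * t)) upperInfty (𝓝 1))
    (hs : ∀ η : ℂ, 0 < η.im → (starRingEnd ℂ) (g (-(starRingEnd ℂ) η)) = -g η) :
    ∃ f, UpperFactor f ∧ ∀ η : ℂ, η.im = 0 → f η = g η / (η - Complex.I * t) := by
  have him : 0 < (Complex.I * (t : ℂ)).im := by simpa using ht
  have hn : {η : ℂ | 0 < η.im} ∈ 𝓝 (Complex.I * (t : ℂ)) := isOpen_im_pos.mem_nhds him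
  have hn' : {η : ℂ | 0 ≤ η.im} ∈ 𝓝 (Complex.I * (t : ℂ)) :=
    mem_of_superset hn fun η (hη : 0 < η.im) => hη.le
  have hg0 : g (Complex.I * t) = 0 := (hz _ him.le).2 rfl
  have hne {η : ℂ} (h : η ≠ Complex.I * t) :
      dslope g (Complex.I * t) η = g η / (η - Complex.I * t) := by
    rw [dslope_of_ne _ h, slope_def_field, hg0, sub_zero]
  have hcont : ContinuousOn (dslope g (Complex.I * t)) {η | 0 ≤ η.im} :=
    (continuousOn_dslope hn').2 ⟨hc, hd.differentiableAt hn⟩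
  refine ⟨dslope g (Complex.I * t), ⟨hcont, (Complex.differentiableOn_dslope hn).2 hd, ?_, ?_, ?_⟩,
    fun η hη => hne ?_⟩
  · intro η hη
    by_cases h : η = Complex.I * t
    · rw [h, dslope_same]
      exact hd0
    · rw [hne h]
      exact div_ne_zero (fun h' => h ((hz η hη).1 h')) (sub_ne_zero.2 h)
  · refine hlim.congr' ?_
    filter_upwards [eventually_ne_upperInfty (Complex.I * t)] with η hη using (hne hη).symm
  · refine symm_of_interior hcont (Complex.I * t) fun η hη h => ?_
    have h' : -(starRingEnd ℂ) η ≠ Complex.I * t := by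
      intro h2
      apply h
      have h3 := congrArg (starRingEnd ℂ) h2
      simp at h3
      linear_combination h3
    rw [hne h, hne h', map_div₀, hs η hη]
    have e : (starRingEnd ℂ) (-(starRingEnd ℂ) η - Complex.I * t) = -(η - Complex.I * t) := by
      simp
      ring
    rw [e, neg_div_neg_eq]
  · rintro rfl
    exact him.ne' hη

variable {A : ℝ} {q₀ : ℝ → ℂ} {ξ₁ : ℝ}

theorem I_mul_ofReal_ne_zero {t : ℝ} (ht : 0 < t) : Complex.I * (t : ℂ) ≠ 0 :=
  mul_ne_zero Complex.I_ne_zero (Complex.ofReal_ne_zero.2 ht.ne')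

theorem scat_zero_eq_zero_iff (hA : 0 < A) (hq : IsStepLike A q₀)
    (hz : HasSingleSimpleZero A q₀ ξ₁) {ξ : ℂ} (hξ : 0 ≤ ξ.im) (h0 : ξ ≠ 0) :
    scat A q₀ 0 ξ = 0 ↔ ξ = Complex.I * ξ₁ := by
  rw [← hz.2.1 ξ hξ h0, a₁_eq hA hq hξ h0, mul_eq_zero, or_iff_right]
  exact pow_ne_zero 2 (div_ne_zero (add_I_ne_zero hξ) h0)

/-- A holomorphic multiple of `a₁` has a simple zero at `i ξ₁` as well. -/
theorem deriv_mul_a₁_ne_zero (hz : HasSingleSimpleZero A q₀ ξ₁) {g h : ℂ → ℂ}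
    (hh : DifferentiableAt ℂ h (Complex.I * ξ₁)) (h0 : h (Complex.I * ξ₁) ≠ 0)
    (hg : ∀ ξ : ℂ, 0 < ξ.im → g ξ = h ξ * a₁ A q₀ ξ) : deriv g (Complex.I * ξ₁) ≠ 0 := by
  have him : 0 < (Complex.I * (ξ₁ : ℂ)).im := by simpa using hz.1
  have he : g =ᶠ[𝓝 (Complex.I * (ξ₁ : ℂ))] fun ξ => h ξ * a₁ A q₀ ξ := by
    filter_upwards [isOpen_im_pos.mem_nhds him] with ξ hξ using hg ξ hξ
  have ha : a₁ A q₀ (Complex.I * ξ₁) = 0 := (hz.2.1 _ him.le (I_mul_ofReal_ne_zero hz.1)).2 rfl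
  rw [he.deriv_eq, deriv_fun_mul hh (differentiableAt_of_deriv_ne_zero hz.2.2), ha, mul_zero,
    zero_add]
  exact mul_ne_zero h0 hz.2.2

/-! ### The case `a₂(0) ≠ 0` -/

variable {A : ℝ} {q₀ : ℝ → ℂ} {ξ₁ : ℝ}

/-- The factor that carries `a₁` when `a₂(0) ≠ 0`, namely `ξ² a₁(ξ) / ((ξ - i ξ₁)(ξ + i))`. -/
theorem Case1.exists_factor_a₁ (hA : 0 < A) (hq : IsStepLike A q₀) (h : Case1 A q₀ ξ₁) :
    ∃ f, UpperFactor f ∧ ∀ η : ℂ, η.im = 0 →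
      f η = (η + Complex.I) * scat A q₀ 0 η / (η - Complex.I * ξ₁) := by
  obtain ⟨hz, h2⟩ := h
  have him : 0 < (Complex.I * (ξ₁ : ℂ)).im := by simpa using hz.1
  have hs0 : scat A q₀ 0 0 ≠ 0 := by
    have h3 := h2 0 (by simp)
    rw [a₂_eq hA hq (by simp), neg_zero] at h3
    rw [scat_zero_zero hA hq]
    have hAc : (A : ℂ) ≠ 0 := Complex.ofReal_ne_zero.2 hA.ne'
    exact mul_ne_zero (neg_ne_zero.2 (div_ne_zero (pow_ne_zero 2 hAc) (by norm_num))) h3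
  refine UpperFactor.of_simple_zero (g := fun η => (η + Complex.I) * scat A q₀ 0 η) hz.1
    ((by fun_prop : ContinuousOn (fun η => η + Complex.I) _).mul (continuousOn_scat hA hq 0))
    ((by fun_prop : DifferentiableOn ℂ (fun η => η + Complex.I) _).mul
      (differentiableOn_scat hA hq 0)) (fun η hη => ?_) ?_ ?_ fun η hη => ?_
  · rw [mul_eq_zero, or_iff_right (add_I_ne_zero hη)]
    by_cases h0 : η = 0
    · subst h0
      exact iff_of_false hs0 (I_mul_ofReal_ne_zero hz.1).symm
    · exact scat_zero_eq_zero_iff hA hq hz hη h0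
  · refine deriv_mul_a₁_ne_zero hz (h := fun ξ => ξ ^ 2 / (ξ + Complex.I)) ?_ ?_ fun ξ hξ => ?_
    · exact DifferentiableAt.div (by fun_prop) (by fun_prop) (add_I_ne_zero him.le)
    · exact div_ne_zero (pow_ne_zero 2 (I_mul_ofReal_ne_zero hz.1)) (add_I_ne_zero him.le)
    · have h0 : ξ ≠ 0 := by rintro rfl; simp at hξ
      have h1 := add_I_ne_zero hξ.le
      rw [a₁_eq hA hq hξ.le h0]
      field_simp
  · have h3 := (tendsto_div_upperInfty Complex.I (-(Complex.I * ξ₁))).mul (tendsto_scat hA hq 0)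
    rw [mul_one] at h3
    exact h3.congr fun η => by rw [← sub_eq_add_neg, div_mul_eq_mul_div]
  · rw [map_mul, conj_scat, ← neg_mul]
    congr 1
    simp
    ring

/-- The factor that carries `a₂` when `a₂(0) ≠ 0`, namely `a₂(ξ) (ξ - i ξ₁) / (ξ - i)` at
`ξ = -η`. -/
theorem Case1.upperFactor_a₂ (hA : 0 < A) (hq : IsStepLike A q₀) (h : Case1 A q₀ ξ₁) :
    UpperFactor fun η => scat A q₀ 1 η * ((η + Complex.I * ξ₁) / (η + Complex.I)) := by
  obtain ⟨hz, h2⟩ := h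
  have him {η : ℂ} (hη : 0 ≤ η.im) : η + Complex.I * ξ₁ ≠ 0 := by
    intro h
    have := congrArg Complex.im h
    simp at this
    linarith [hz.1]
  refine ⟨(continuousOn_scat hA hq 1).mul (ContinuousOn.div (by fun_prop) (by fun_prop)
    fun η hη => add_I_ne_zero hη), (differentiableOn_scat hA hq 1).mul
    (DifferentiableOn.div (by fun_prop) (by fun_prop)
    fun η hη => add_I_ne_zero (le_of_lt hη)), fun η hη => ?_, ?_, fun η hη => ?_⟩
  · refine mul_ne_zero ?_ (div_ne_zero (him hη) (add_I_ne_zero hη))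
    have h3 := h2 (-η) (by simpa using hη)
    rwa [a₂_eq hA hq (by simpa using hη), neg_neg] at h3
  · have h3 := (tendsto_scat hA hq 1).mul (tendsto_div_upperInfty (Complex.I * ξ₁) Complex.I)
    rwa [mul_one] at h3
  · rw [map_mul, conj_scat, map_div₀, ← neg_div_neg_eq]
    congr 2 <;>
    · simp
      ring

theorem Case1.formula (hA : 0 < A) (hq : IsStepLike A q₀) (h : Case1 A q₀ ξ₁) :
    ∃ (l : ℝ → ℂ) (c : ℂ),
      IsLogBranch (fun x : ℝ => (x : ℂ) ^ 2 / ((x : ℂ) ^ 2 + 1) *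
        (1 - b A q₀ x * (starRingEnd ℂ) (b A q₀ (-x)))) l ∧
      HasPrincipalValue (fun x : ℝ => l x / (x : ℂ)) c ∧
      (ξ₁ : ℂ) = (A : ℂ) / 2 * Complex.exp (-(1 / (2 * (Real.pi : ℂ) * Complex.I) * c)) := by
  obtain ⟨f₁, hf₁, he₁⟩ := h.exists_factor_a₁ hA hq
  have hf₂ := h.upperFactor_a₂ hA hq
  obtain ⟨hz, h2⟩ := h
  have hne (x : ℝ) : (x : ℂ) - Complex.I * ξ₁ ≠ 0 := by
    intro h
    have := congrArg Complex.im h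
    simp at this
    exact hz.1.ne' this
  obtain ⟨l, c, r₁, r₂, hl, hpv, hr₁, hr₂, hc⟩ := exists_logBranch hf₁ hf₂
    (g := fun x : ℝ => (x : ℂ) ^ 2 / ((x : ℂ) ^ 2 + 1) *
        (1 - b A q₀ x * (starRingEnd ℂ) (b A q₀ (-x)))) (fun x hx => by
      have hxc : (x : ℂ) ≠ 0 := Complex.ofReal_ne_zero.2 hx
      have h3 := add_I_ne_zero (η := (x : ℂ)) (by simp)
      have h4 : (x : ℂ) - Complex.I ≠ 0 := by
        have := add_I_ne_zero (η := -(x : ℂ)) (by simp)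
        intro h
        apply this
        linear_combination -h
      have h5 : (x : ℂ) ^ 2 + 1 = (x + Complex.I) * (x - Complex.I) := by
        linear_combination Complex.I_sq
      have h6 : -(x : ℂ) + Complex.I * ξ₁ = -(x - Complex.I * ξ₁) := by ring
      have h7 : -(x : ℂ) + Complex.I = -(x - Complex.I) := by ring
      rw [one_sub_b_mul hA hq hx, he₁ x (by simp), a₁_eq hA hq (by simp) hxc,
        a₂_eq hA hq (by simp), h5, h6, h7, neg_div_neg_eq]
      have := hne x
      field_simp)
  refine ⟨l, c, hl, hpv, ?_⟩
  have hAc : (A : ℂ) ≠ 0 := Complex.ofReal_ne_zero.2 hA.ne'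
  have hξc : (ξ₁ : ℂ) ≠ 0 := Complex.ofReal_ne_zero.2 hz.1.ne'
  -- The quotient of the values at `0` of the two factors does not involve `a₂(0)`.
  have hq1 : Complex.exp r₁ * (2 * ξ₁ / A) ^ 2 = Complex.exp r₂ := by
    rw [← hr₁, ← hr₂, he₁ 0 (by simp), scat_zero_zero hA hq, zero_add, zero_sub, zero_add]
    field_simp
    ring
  have hq2 : Real.exp r₁ * (2 * ξ₁ / A) ^ 2 = Real.exp r₂ := by exact_mod_cast hq1
  have hq3 : Real.exp ((r₂ - r₁) / 2) = 2 * ξ₁ / A := by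
    rw [← sq_eq_sq₀ (Real.exp_pos _).le (by have := hz.1; positivity), ← Real.exp_nat_mul]
    have : ((2 : ℕ) : ℝ) * ((r₂ - r₁) / 2) = r₂ - r₁ := by push_cast; ring
    rw [this, Real.exp_sub, ← hq2, mul_div_cancel_left₀ _ (Real.exp_ne_zero _)]
  have hq4 : -(1 / (2 * (Real.pi : ℂ) * Complex.I) * c) = (((r₂ - r₁) / 2 : ℝ) : ℂ) := by
    have hpi : (Real.pi : ℂ) ≠ 0 := Complex.ofReal_ne_zero.2 Real.pi_ne_zero
    have hI := Complex.I_ne_zero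
    rw [hc]
    push_cast
    field_simp
    ring
  rw [hq4, ← Complex.ofReal_exp, hq3]
  push_cast
  field_simp

/-! ### The case `a₂(0) = 0` -/

variable {A : ℝ} {q₀ : ℝ → ℂ} {ξ₁ : ℝ}

theorem tendsto_ofReal_punctured {s : Set ℂ} (hs : ∀ x : ℝ, x ≠ 0 → (x : ℂ) ∈ s) :
    Tendsto (fun x : ℝ => (x : ℂ)) (𝓝[≠] 0) (𝓝[s] 0) := by
  refine tendsto_nhdsWithin_iff.2 ⟨?_, ?_⟩
  · have := Complex.continuous_ofReal.tendsto 0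
    rw [Complex.ofReal_zero] at this
    exact this.mono_left nhdsWithin_le_nhds
  · filter_upwards [self_mem_nhdsWithin] with x hx using hs x hx

theorem tendsto_neg_punctured : Tendsto (fun x : ℝ => -x) (𝓝[≠] 0) (𝓝[≠] 0) := by
  refine tendsto_nhdsWithin_iff.2 ⟨?_, ?_⟩
  · have := continuous_neg.tendsto (0 : ℝ)
    rw [neg_zero] at this
    exact this.mono_left nhdsWithin_le_nhds
  · filter_upwards [self_mem_nhdsWithin] with x hx using neg_ne_zero.2 hx

/-- The limits of `b` and of `x a₁(x)` at a simple zero of `a₂`. With `y = (p, s)` the column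
`φ₋⁽²⁾`, `w` the column `φ₋⁽¹⁾` and a tilde for `f(x) ↦ conj f(-x)`, one has `w₀ s - w₁ p = 1`, hence
`s b = a₂ w₁ - p̃` and `s a₁ = w̃₀ - w₁ b̃`; and `x w` tends to a multiple of `y`. -/
theorem exists_tendsto_b (hA : 0 < A) (hq : IsStepLike A q₀) (h0 : a₂ A q₀ 0 = 0) {d a₁₁ : ℂ}
    (hd : HasDerivWithinAt (a₂ A q₀) d {ξ : ℂ | ξ.im ≤ 0} 0)
    (ha : Tendsto (fun ξ : ℂ => ξ * a₁ A q₀ ξ) (𝓝[{ξ : ℂ | 0 ≤ ξ.im ∧ ξ ≠ 0}] 0) (𝓝 a₁₁)) :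
    ∃ b₀ : ℂ, Tendsto (b A q₀) (𝓝[≠] 0) (𝓝 b₀) ∧
      a₁₁ = -((A : ℂ) ^ 2 / 4) * d + Complex.I * A * b₀.re := by
  set p : ℝ → ℂ := fun x => jostF A q₀ 1 ((-x : ℝ) : ℂ) 0 0 with hp
  set s : ℝ → ℂ := fun x => jostF A q₀ 1 ((-x : ℝ) : ℂ) 0 1 with hs
  set w : Fin 2 → ℝ → ℂ := fun i x => (x + Complex.I) / x * jostF A q₀ 0 (x : ℂ) 0 i with hw
  have hcj (j i : Fin 2) : Continuous fun x : ℝ => jostF A q₀ j (x : ℂ) 0 i :=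
    continuous_comp_ofReal (continuousOn_jostF hA hq j i)
  have hpc : Continuous p := (hcj 1 0).comp continuous_neg
  have hsc : Continuous s := (hcj 1 1).comp continuous_neg
  have hp0 : p 0 = jostF A q₀ 1 0 0 0 := by simp [hp]
  have hs0 : s 0 = jostF A q₀ 1 0 0 1 := by simp [hs]
  have hlim {f : ℝ → ℂ} (hf : Continuous f) : Tendsto f (𝓝[≠] 0) (𝓝 (f 0)) :=
    (hf.tendsto 0).mono_left nhdsWithin_le_nhds
  have hconj {f : ℝ → ℂ} {c : ℂ} (hf : Tendsto f (𝓝[≠] 0) (𝓝 c)) :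
      Tendsto (fun x => (starRingEnd ℂ) (f (-x))) (𝓝[≠] 0) (𝓝 ((starRingEnd ℂ) c)) :=
    (Complex.continuous_conj.tendsto c).comp (hf.comp tendsto_neg_punctured)
  -- `x w(x)` tends to `-(i A / 2) y(0)`.
  have hxw (i : Fin 2) : Tendsto (fun x : ℝ => x * w i x) (𝓝[≠] 0)
      (𝓝 (-(Complex.I * A / 2) * jostF A q₀ 1 0 0 i)) := by
    have h1 := hlim (f := fun x : ℝ => ((x : ℂ) + Complex.I) * jostF A q₀ 0 (x : ℂ) 0 i)
      ((by fun_prop : Continuous fun x : ℝ => (x : ℂ) + Complex.I).mul (hcj 0 i))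
    have h2 : jostF A q₀ 0 0 0 i = -(A : ℂ) / 2 * jostF A q₀ 1 0 0 i := by
      rw [jostF_zero_zero hA hq, Pi.smul_apply, smul_eq_mul]
    simp only [Complex.ofReal_zero, zero_add, h2] at h1
    have e : Complex.I * (-(A : ℂ) / 2 * jostF A q₀ 1 0 0 i) =
      -(Complex.I * A / 2) * jostF A q₀ 1 0 0 i := by ring
    rw [e] at h1
    refine h1.congr' ?_
    filter_upwards [self_mem_nhdsWithin] with x hx
    have : (x : ℂ) ≠ 0 := Complex.ofReal_ne_zero.2 hx
    simp only [hw]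
    field_simp
  have hW {x : ℝ} (hx : x ≠ 0) : w 0 x * s x - w 1 x * p x = 1 := by
    rw [← wronskian_jost hA hq hx]
    simp only [hw, hs, hp, Complex.ofReal_neg]
    ring
  have hb {x : ℝ} (hx : x ≠ 0) : b A q₀ x =
      (starRingEnd ℂ) (s (-x)) * w 1 x - (starRingEnd ℂ) (p (-x)) * w 0 x := by
    rw [b_eq hA hq hx]
    simp only [hw, hs, hp, neg_neg]
    ring
  have ha₂ (x : ℝ) : a₂ A q₀ x =
      s x * (starRingEnd ℂ) (s (-x)) - p x * (starRingEnd ℂ) (p (-x)) := by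
    rw [a₂_eq hA hq (Complex.ofReal_im x).le]
    simp only [scat, hs, hp, neg_neg, sub_self, map_neg, Complex.conj_ofReal, Complex.ofReal_neg]
  have hwc (i : Fin 2) (x : ℝ) : (starRingEnd ℂ) (w i (-x)) =
      (x + Complex.I) / x * (starRingEnd ℂ) (jostF A q₀ 0 (-x) 0 i) := by
    simp only [hw, map_mul, map_div₀, map_add, map_neg, Complex.conj_ofReal, Complex.conj_I,
      Complex.ofReal_neg]
    rw [← neg_add, neg_div_neg_eq]
  have ha₁ {x : ℝ} (hx : x ≠ 0) : a₁ A q₀ x =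
      w 0 x * (starRingEnd ℂ) (w 0 (-x)) - w 1 x * (starRingEnd ℂ) (w 1 (-x)) := by
    rw [a₁_eq hA hq (Complex.ofReal_im x).ge (Complex.ofReal_ne_zero.2 hx), hwc, hwc]
    simp only [scat, hw, sub_zero, Complex.conj_ofReal]
    ring
  have hsne : s 0 ≠ 0 := by
    intro h
    have h1 := ha₂ 0
    rw [neg_zero, Complex.ofReal_zero, h0, h, zero_mul, zero_sub, eq_comm, neg_eq_zero,
      Complex.mul_conj, Complex.ofReal_eq_zero, Complex.normSq_eq_zero] at h1
    refine jostF_one_zero_ne hA hq 0 (funext fun i => ?_)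
    fin_cases i
    · exact hp0 ▸ h1
    · exact hs0 ▸ h
  have hslope : Tendsto (fun x : ℝ => a₂ A q₀ x / x) (𝓝[≠] 0) (𝓝 d) := by
    have h1 := (hasDerivWithinAt_iff_tendsto_slope.1 hd).comp (tendsto_ofReal_punctured
      fun x hx => ⟨(Complex.ofReal_im x).le, Complex.ofReal_ne_zero.2 hx⟩)
    refine h1.congr fun x => ?_
    rw [Function.comp_apply, slope_def_field, h0, sub_zero, sub_zero]
  have hmem : ∀ᶠ x : ℝ in 𝓝[≠] 0, x ≠ 0 ∧ s x ≠ 0 :=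
    Eventually.and self_mem_nhdsWithin ((hlim hsc).eventually_ne hsne)
  -- The limit of `b = (a₂ w₁ - p̃) / s`.
  obtain ⟨b₀, hb₀⟩ : ∃ b₀, b₀ = (d * (-(Complex.I * A / 2) * s 0) - (starRingEnd ℂ) (p 0)) / s 0 :=
    ⟨_, rfl⟩
  have hblim : Tendsto (b A q₀) (𝓝[≠] 0) (𝓝 b₀) := by
    have h1 := ((hslope.mul (hxw 1)).sub (hconj (hlim hpc))).div (hlim hsc) hsne
    rw [← hs0, ← hb₀] at h1
    refine h1.congr' ?_
    filter_upwards [hmem] with x ⟨hx, hsx⟩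
    have hxc : (x : ℂ) ≠ 0 := Complex.ofReal_ne_zero.2 hx
    rw [Pi.div_apply, div_eq_iff hsx, hb hx, ha₂, ← mul_assoc, div_mul_cancel₀ _ hxc]
    linear_combination (starRingEnd ℂ) (p (-x)) * hW hx
  refine ⟨b₀, hblim, ?_⟩
  -- The limit of `x a₁ = (x w̃₀ - x w₁ b̃) / s`.
  have h1 : Tendsto (fun x : ℝ => x * a₁ A q₀ x) (𝓝[≠] 0) (𝓝 a₁₁) :=
    ha.comp (tendsto_ofReal_punctured
      fun x hx => ⟨(Complex.ofReal_im x).ge, Complex.ofReal_ne_zero.2 hx⟩)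
  have h2 := ((hconj (hxw 0)).neg.sub ((hxw 1).mul (hconj hblim))).div (hlim hsc) hsne
  have h3 := tendsto_nhds_unique_of_eventuallyEq h1 h2 (by
    filter_upwards [hmem] with x ⟨hx, hsx⟩
    have hW' := congrArg (starRingEnd ℂ) (hW (neg_ne_zero.2 hx))
    simp only [map_sub, map_mul, map_one] at hW'
    rw [Pi.div_apply, eq_div_iff hsx, ha₁ hx, hb (neg_ne_zero.2 hx)]
    simp only [map_sub, map_mul, map_neg, Complex.conj_conj, Complex.conj_ofReal, neg_neg,
      Complex.ofReal_neg]
    linear_combination x * (starRingEnd ℂ) (w 0 (-x)) * hW hx)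
  rw [← hp0, ← hs0] at h3
  have h4 : (starRingEnd ℂ) (p 0) = d * (-(Complex.I * A / 2) * s 0) - b₀ * s 0 := by
    rw [hb₀]
    field_simp
    ring
  have h5 : (b₀.re : ℂ) = (b₀ + (starRingEnd ℂ) b₀) / 2 := by
    rw [Complex.add_conj]; push_cast; ring
  rw [h3, h5]
  simp only [map_mul, map_neg, map_div₀, Complex.conj_I, Complex.conj_ofReal, h4, map_ofNat]
  field_simp
  ring_nf
  simp only [Complex.I_sq]
  ring

variable {A : ℝ} {q₀ : ℝ → ℂ} {ξ₁ : ℝ}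

theorem upper_diff_zero : {η : ℂ | 0 ≤ η.im} \ {0} = {η : ℂ | 0 ≤ η.im ∧ η ≠ 0} := rfl

theorem ne_zero_of_im_pos {η : ℂ} (h : 0 < η.im) : η ≠ 0 := by
  rintro rfl
  simp at h

/-- The factor that carries `a₁` when `a₂(0) = 0`, namely `ξ a₁(ξ) / (ξ - i ξ₁)`, with the limit
as its value at `0`. -/
theorem exists_factor_a₁_of_pole (hA : 0 < A) (hq : IsStepLike A q₀)
    (hz : HasSingleSimpleZero A q₀ ξ₁) {a₁₁ : ℂ} (h0 : a₁₁ ≠ 0)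
    (ha : Tendsto (fun ξ : ℂ => ξ * a₁ A q₀ ξ) (𝓝[{ξ : ℂ | 0 ≤ ξ.im ∧ ξ ≠ 0}] 0) (𝓝 a₁₁)) :
    ∃ f, UpperFactor f ∧ f 0 = a₁₁ / -(Complex.I * ξ₁) ∧
      ∀ x : ℝ, x ≠ 0 → f x = x * a₁ A q₀ x / (x - Complex.I * ξ₁) := by
  have him : 0 < (Complex.I * (ξ₁ : ℂ)).im := by simpa using hz.1
  have heq {η : ℂ} (hη : 0 ≤ η.im) (hn : η ≠ 0) :
      η * a₁ A q₀ η = (η + Complex.I) ^ 2 / η * scat A q₀ 0 η := by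
    rw [a₁_eq hA hq hη hn]
    field_simp
  set g : ℂ → ℂ := Function.update (fun η => η * a₁ A q₀ η) 0 a₁₁
  have hg0 : g 0 = a₁₁ := Function.update_self _ _ _
  have hgn {η : ℂ} (hn : η ≠ 0) : g η = η * a₁ A q₀ η := Function.update_of_ne hn _ _
  suffices h : ∃ f, UpperFactor f ∧ ∀ η : ℂ, η.im = 0 → f η = g η / (η - Complex.I * ξ₁) by
    obtain ⟨f, hf, hfe⟩ := h
    refine ⟨f, hf, ?_, fun x hx => ?_⟩
    · rw [hfe 0 (by simp), hg0, zero_sub]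
    · rw [hfe x (by simp), hgn (Complex.ofReal_ne_zero.2 hx)]
  refine UpperFactor.of_simple_zero hz.1 ?_ ?_ ?_ ?_ ?_ ?_
  · refine continuousOn_update_iff.2 ⟨?_, fun _ => upper_diff_zero ▸ ha⟩
    refine ContinuousOn.congr (f := fun η => (η + Complex.I) ^ 2 / η * scat A q₀ 0 η) ?_
      fun η hη => heq hη.1 hη.2
    exact (ContinuousOn.div (by fun_prop) (by fun_prop) fun η hη => hη.2).mul
      ((continuousOn_scat hA hq 0).mono Set.sdiff_subset)
  · refine DifferentiableOn.congr (f := fun η => (η + Complex.I) ^ 2 / η * scat A q₀ 0 η) ?_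
      fun η (hη : 0 < η.im) => by
        rw [hgn (ne_zero_of_im_pos hη), heq hη.le (ne_zero_of_im_pos hη)]
    exact (DifferentiableOn.div (by fun_prop) (by fun_prop) fun η hη => ne_zero_of_im_pos hη).mul
      (differentiableOn_scat hA hq 0)
  · intro η hη
    by_cases hn : η = 0
    · subst hn
      rw [hg0]
      exact iff_of_false h0 (I_mul_ofReal_ne_zero hz.1).symm
    · rw [hgn hn, mul_eq_zero, or_iff_right hn, hz.2.1 η hη hn]
  · exact deriv_mul_a₁_ne_zero hz (h := fun ξ => ξ) differentiableAt_id
      (I_mul_ofReal_ne_zero hz.1) fun ξ hξ => hgn (ne_zero_of_im_pos hξ)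
  · have h3 := ((tendsto_div_upperInfty Complex.I (-(Complex.I * ξ₁))).mul
      (tendsto_div_upperInfty Complex.I 0)).mul (tendsto_scat hA hq 0)
    rw [mul_one, mul_one] at h3
    refine h3.congr' ?_
    filter_upwards [eventually_upperInfty_im, eventually_ne_upperInfty 0] with η hη hn
    rw [hgn hn, heq hη hn, add_zero, ← sub_eq_add_neg]
    ring
  · intro η hη
    have hη' : 0 < (-(starRingEnd ℂ) η).im := by rwa [neg_conj_im]
    rw [hgn (ne_zero_of_im_pos hη), hgn (ne_zero_of_im_pos hη'), heq hη.le (ne_zero_of_im_pos hη),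
      heq hη'.le (ne_zero_of_im_pos hη'), map_mul, conj_scat, ← neg_mul]
    congr 1
    simp only [map_div₀, map_pow, map_add, map_neg, Complex.conj_conj, Complex.conj_I]
    rw [← neg_add, neg_sq, div_neg]

/-- The factor that carries `a₂` when `a₂(0) = 0`, namely `a₂(ξ) (ξ - i ξ₁) / ξ` at `ξ = -η`, with
the limit as its value at `0`. -/
theorem exists_factor_a₂_of_zero (hA : 0 < A) (hq : IsStepLike A q₀) (ht : 0 < ξ₁)
    (hz : ∀ ξ : ℂ, ξ.im ≤ 0 → (a₂ A q₀ ξ = 0 ↔ ξ = 0)) {d : ℂ} (h0 : d ≠ 0)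
    (hd : HasDerivWithinAt (a₂ A q₀) d {ξ : ℂ | ξ.im ≤ 0} 0) :
    ∃ f, UpperFactor f ∧ f 0 = -(Complex.I * ξ₁ * d) ∧
      ∀ x : ℝ, x ≠ 0 → f (-x) = a₂ A q₀ x * ((x - Complex.I * ξ₁) / x) := by
  have hn1 {η : ℂ} (hη : 0 ≤ η.im) : η + Complex.I * ξ₁ ≠ 0 := by
    intro h
    have := congrArg Complex.im h
    simp at this
    linarith
  set g : ℂ → ℂ := Function.update (fun η => scat A q₀ 1 η * ((η + Complex.I * ξ₁) / η)) 0
    (-(Complex.I * ξ₁ * d))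
  have hg0 : g 0 = -(Complex.I * ξ₁ * d) := Function.update_self _ _ _
  have hgn {η : ℂ} (hn : η ≠ 0) : g η = scat A q₀ 1 η * ((η + Complex.I * ξ₁) / η) :=
    Function.update_of_ne hn _ _
  have hcont : ContinuousOn g {η | 0 ≤ η.im} := by
    refine continuousOn_update_iff.2 ⟨?_, fun _ => ?_⟩
    · exact ((continuousOn_scat hA hq 1).mono Set.sdiff_subset).mul
        (ContinuousOn.div (by fun_prop) (by fun_prop) fun η hη => hη.2)
    · have hneg : Tendsto (fun η : ℂ => -η) (𝓝[{η : ℂ | 0 ≤ η.im} \ {0}] 0)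
          (𝓝[{ξ : ℂ | ξ.im ≤ 0} \ {0}] 0) := by
        refine tendsto_nhdsWithin_iff.2 ⟨?_, ?_⟩
        · have := continuous_neg.tendsto (0 : ℂ)
          rw [neg_zero] at this
          exact this.mono_left nhdsWithin_le_nhds
        · filter_upwards [self_mem_nhdsWithin] with η hη
          refine ⟨?_, neg_ne_zero.2 hη.2⟩
          have : 0 ≤ η.im := hη.1
          simpa using this
      have h1 := (hasDerivWithinAt_iff_tendsto_slope.1 hd).comp hneg
      have h2 : Tendsto (fun η : ℂ => -(η + Complex.I * ξ₁)) (𝓝[{η : ℂ | 0 ≤ η.im} \ {0}] 0)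
          (𝓝 (-(0 + Complex.I * ξ₁))) :=
        ((by fun_prop : Continuous fun η : ℂ => -(η + Complex.I * ξ₁)).tendsto 0).mono_left
          nhdsWithin_le_nhds
      have h3 := h2.mul h1
      rw [zero_add, neg_mul] at h3
      refine h3.congr' ?_
      filter_upwards [self_mem_nhdsWithin] with η hη
      have hη0 : η ≠ 0 := hη.2
      rw [Function.comp_apply, slope_def_field, (hz 0 (by simp)).2 rfl, sub_zero, sub_zero,
        a₂_eq hA hq (by simpa using hη.1), neg_neg]
      field_simp
  refine ⟨g, ⟨hcont, ?_, ?_, ?_, ?_⟩, hg0, fun x hx => ?_⟩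
  · refine DifferentiableOn.congr (f := fun η => scat A q₀ 1 η * ((η + Complex.I * ξ₁) / η)) ?_
      fun η hη => hgn (ne_zero_of_im_pos hη)
    exact (differentiableOn_scat hA hq 1).mul
      (DifferentiableOn.div (by fun_prop) (by fun_prop) fun η hη => ne_zero_of_im_pos hη)
  · intro η hη
    by_cases hn : η = 0
    · rw [hn, hg0]
      exact neg_ne_zero.2 (mul_ne_zero (I_mul_ofReal_ne_zero ht) h0)
    · rw [hgn hn]
      refine mul_ne_zero (fun h => hn ?_) (div_ne_zero (hn1 hη) hn)
      have h3 := hz (-η) (by simpa using hη)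
      rw [a₂_eq hA hq (by simpa using hη), neg_neg, neg_eq_zero] at h3
      exact h3.1 h
  · have h3 := (tendsto_scat hA hq 1).mul (tendsto_div_upperInfty (Complex.I * ξ₁) 0)
    rw [mul_one] at h3
    refine h3.congr' ?_
    filter_upwards [eventually_ne_upperInfty 0] with η hn
    rw [hgn hn, add_zero]
  · refine symm_of_interior hcont 0 fun η hη hn => ?_
    have hη' : 0 < (-(starRingEnd ℂ) η).im := by rwa [neg_conj_im]
    rw [hgn hn, hgn (ne_zero_of_im_pos hη'), map_mul, conj_scat, map_div₀, ← neg_div_neg_eq]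
    congr 2 <;>
    · simp
      try ring
  · have hxc : (x : ℂ) ≠ 0 := Complex.ofReal_ne_zero.2 hx
    rw [hgn (neg_ne_zero.2 hxc), a₂_eq hA hq (by simp), ← neg_div_neg_eq]
    congr 2 <;> ring

/-- The algebra at the end of the second case: with `ρ = Re b(0)`, the two relations between the
values at `0` of the factors give a quadratic equation for `ξ₁`. -/
theorem eq_of_quadratic {A ξ₁ ρ F₁ F₂ : ℝ} (hA : 0 < A) (hξ : 0 < ξ₁) (h₁ : 0 < F₁) (h₂ : 0 < F₂)
    (h : F₂ ^ 2 = ξ₁ * F₁ * F₂ * (4 * (ξ₁ * F₁ * F₂) / A ^ 2 + 4 * ρ / A)) :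
    ξ₁ = A * ((Real.sqrt (ρ ^ 2 + F₂ ^ 2) - ρ) / (2 * F₁ * F₂)) := by
  set α := ξ₁ * F₁ * F₂ with hα
  have hα0 : 0 < α := by positivity
  have hpos : 0 < 4 * α / A ^ 2 + 4 * ρ / A := by
    by_contra hn
    have := mul_nonpos_of_nonneg_of_nonpos hα0.le (not_lt.1 hn)
    have := pow_pos h₂ 2
    linarith
  have hsum : 0 ≤ ρ + 2 * α / A := by
    have e : ρ + 2 * α / A = A / 4 * (4 * α / A ^ 2 + 4 * ρ / A) + α / A := by
      field_simp
      ring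
    rw [e]
    positivity
  have hsq : ρ ^ 2 + F₂ ^ 2 = (ρ + 2 * α / A) ^ 2 := by
    rw [h]
    field_simp
    ring
  rw [hsq, Real.sqrt_sq hsum, hα]
  field_simp
  ring

theorem Case2.formula (hA : 0 < A) (hq : IsStepLike A q₀) (h : Case2 A q₀ ξ₁) :
    ∃ (b₀ : ℂ) (l : ℝ → ℂ) (c : ℂ) (F₁ F₂ : ℝ),
      Tendsto (b A q₀) (𝓝[≠] 0) (𝓝 b₀) ∧ ‖b₀‖ < 1 ∧
      IsLogBranch (fun x : ℝ => 1 - b A q₀ x * (starRingEnd ℂ) (b A q₀ (-x))) l ∧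
      HasPrincipalValue (fun x : ℝ => l x / (x : ℂ)) c ∧
      (F₁ : ℂ) = Complex.exp (1 / (2 * (Real.pi : ℂ) * Complex.I) * c) ∧
      F₂ = Real.exp (1 / 2 * Real.log (1 - ‖b₀‖ ^ 2)) ∧
      ξ₁ = A * ((Real.sqrt (b₀.re ^ 2 + F₂ ^ 2) - b₀.re) / (2 * F₁ * F₂)) := by
  obtain ⟨hz, hz₂, ⟨d, hd0, hd⟩, ⟨a₁₁, ha0, ha⟩⟩ := h
  obtain ⟨f₁, hf₁, hf₁0, hf₁e⟩ := exists_factor_a₁_of_pole hA hq hz ha0 ha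
  obtain ⟨f₂, hf₂, hf₂0, hf₂e⟩ := exists_factor_a₂_of_zero hA hq hz.1 hz₂ hd0 hd
  obtain ⟨b₀, hb₀, hab⟩ := exists_tendsto_b hA hq ((hz₂ 0 (by simp)).2 rfl) hd ha
  have hg : ∀ x : ℝ, x ≠ 0 →
      1 - b A q₀ x * (starRingEnd ℂ) (b A q₀ (-x)) = f₁ x * f₂ (-x) := fun x hx => by
    have hxc : (x : ℂ) ≠ 0 := Complex.ofReal_ne_zero.2 hx
    have hne : (x : ℂ) - Complex.I * ξ₁ ≠ 0 := by
      intro h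
      have := congrArg Complex.im h
      simp at this
      exact hz.1.ne' this
    rw [one_sub_b_mul hA hq hx, hf₁e x hx, hf₂e x hx]
    field_simp
  obtain ⟨l, c, r₁, r₂, hl, hpv, hr₁, hr₂, hc⟩ := exists_logBranch hf₁ hf₂
    (g := fun x : ℝ => 1 - b A q₀ x * (starRingEnd ℂ) (b A q₀ (-x))) hg
  have hAc : (A : ℂ) ≠ 0 := Complex.ofReal_ne_zero.2 hA.ne'
  have hξc : (ξ₁ : ℂ) ≠ 0 := Complex.ofReal_ne_zero.2 hz.1.ne'
  have hI := Complex.I_ne_zero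
  -- The values at `0` of the two factors multiply to the limit of `1 - b b̃`.
  have hnorm : Real.exp (r₁ + r₂) = 1 - ‖b₀‖ ^ 2 := by
    have h1 : Tendsto (fun x : ℝ => 1 - b A q₀ x * (starRingEnd ℂ) (b A q₀ (-x))) (𝓝[≠] 0)
        (𝓝 (1 - b₀ * (starRingEnd ℂ) b₀)) :=
      (hb₀.mul ((Complex.continuous_conj.tendsto b₀).comp
        (hb₀.comp tendsto_neg_punctured))).const_sub 1
    have h2 : Tendsto (fun x : ℝ => f₁ x * f₂ (-x)) (𝓝[≠] 0) (𝓝 (f₁ 0 * f₂ 0)) := by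
      have c₁ := (continuous_comp_ofReal hf₁.cont).tendsto 0
      have c₂ := ((continuous_comp_ofReal hf₂.cont).comp continuous_neg).tendsto 0
      have h3 := (c₁.mul c₂).mono_left (nhdsWithin_le_nhds (s := {0}ᶜ))
      simpa using h3
    have h3 := tendsto_nhds_unique_of_eventuallyEq h1 h2 (by
      filter_upwards [self_mem_nhdsWithin] with x hx using hg x hx)
    rw [hr₁, hr₂, ← Complex.exp_add, Complex.mul_conj, Complex.normSq_eq_norm_sq] at h3
    exact_mod_cast h3.symm
  have hF₂ : Real.exp (1 / 2 * Real.log (1 - ‖b₀‖ ^ 2)) = Real.exp ((r₁ + r₂) / 2) := by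
    rw [← hnorm, Real.log_exp]
    congr 1
    ring
  have hF₁ : 1 / (2 * (Real.pi : ℂ) * Complex.I) * c = (((r₁ - r₂) / 2 : ℝ) : ℂ) := by
    have hpi : (Real.pi : ℂ) ≠ 0 := Complex.ofReal_ne_zero.2 Real.pi_ne_zero
    rw [hc]
    push_cast
    field_simp
  refine ⟨b₀, l, c, Real.exp ((r₁ - r₂) / 2), Real.exp ((r₁ + r₂) / 2), hb₀, ?_, hl, hpv,
    ?_, hF₂.symm, ?_⟩
  · have := Real.exp_pos (r₁ + r₂)
    rw [hnorm] at this
    exact (sq_lt_one_iff₀ (norm_nonneg _)).1 (by linarith)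
  · rw [hF₁, Complex.ofReal_exp]
  refine eq_of_quadratic hA hz.1 (Real.exp_pos _) (Real.exp_pos _) ?_
  -- `a₁₁ = -i ξ₁ exp r₁` and `d = i exp r₂ / ξ₁` in the relation between `a₁₁`, `d` and `Re b(0)`.
  have hrel : Real.exp r₂ = ξ₁ * (4 * (ξ₁ * Real.exp r₁) / A ^ 2 + 4 * b₀.re / A) := by
    rw [hf₁0, div_eq_iff (neg_ne_zero.2 (mul_ne_zero hI hξc))] at hr₁
    rw [hf₂0] at hr₂
    have h1 : Complex.exp r₂ = ξ₁ * (4 * (ξ₁ * Complex.exp r₁) / A ^ 2 + 4 * b₀.re / A) := by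
      field_simp
      linear_combination -A ^ 2 * hr₂ + 4 * ξ₁ * Complex.I * (hr₁ - hab) -
        (4 * ξ₁ ^ 2 * Complex.exp r₁ + 4 * ξ₁ * A * b₀.re) * Complex.I_sq
    exact_mod_cast h1
  have e₁ : Real.exp ((r₁ - r₂) / 2) * Real.exp ((r₁ + r₂) / 2) = Real.exp r₁ := by
    rw [← Real.exp_add]
    congr 1
    ring
  have e₂ : Real.exp ((r₁ + r₂) / 2) ^ 2 = Real.exp r₁ * Real.exp r₂ := by
    rw [← Real.exp_add, ← Real.exp_nat_mul]
    congr 1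
    push_cast
    ring
  rw [mul_assoc ξ₁, e₁, e₂, hrel]
  ring

end NonlocalLPD

theorem mainTheorem3 (A : ℝ) (hA : 0 < A) (q₀ : ℝ → ℂ) (hq₀ : NonlocalLPD.IsStepLike A q₀)
    (ξ₁ : ℝ) :
    (NonlocalLPD.Case1 A q₀ ξ₁ →
      ∃ (l : ℝ → ℂ) (c : ℂ),
        NonlocalLPD.IsLogBranch
          (fun x : ℝ => (x : ℂ) ^ 2 / ((x : ℂ) ^ 2 + 1) *
            (1 - NonlocalLPD.b A q₀ x * (starRingEnd ℂ) (NonlocalLPD.b A q₀ (-x)))) l ∧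
        NonlocalLPD.HasPrincipalValue (fun x : ℝ => l x / (x : ℂ)) c ∧
        (ξ₁ : ℂ) = (A : ℂ) / 2 *
          Complex.exp (-(1 / (2 * (Real.pi : ℂ) * Complex.I) * c))) ∧
    (NonlocalLPD.Case2 A q₀ ξ₁ →
      ∃ (b₀ : ℂ) (l : ℝ → ℂ) (c : ℂ) (F₁ F₂ : ℝ),
        Tendsto (NonlocalLPD.b A q₀) (𝓝[≠] 0) (𝓝 b₀) ∧
        ‖b₀‖ < 1 ∧
        NonlocalLPD.IsLogBranch
          (fun x : ℝ =>
            1 - NonlocalLPD.b A q₀ x * (starRingEnd ℂ) (NonlocalLPD.b A q₀ (-x))) l ∧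
        NonlocalLPD.HasPrincipalValue (fun x : ℝ => l x / (x : ℂ)) c ∧
        (F₁ : ℂ) = Complex.exp (1 / (2 * (Real.pi : ℂ) * Complex.I) * c) ∧
        F₂ = Real.exp (1 / 2 * Real.log (1 - ‖b₀‖ ^ 2)) ∧
        ξ₁ = A * ((Real.sqrt (b₀.re ^ 2 + F₂ ^ 2) - b₀.re) / (2 * F₁ * F₂))) :=
  ⟨fun h => h.formula hA hq₀, fun h => h.formula hA hq₀⟩
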